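/- Let $d\ge 1$, $T>0$, let $\Omega\subset\mathbb R^d$ be a bounded Lipschitz domain (open, connected, nonempty), put $Q=(0,T)\times\Omega$, and let $\mathcal T$ be a partition of $Q$, i.e. a finite family of nonempty, pairwise disjoint open sets $K\subseteq Q$ covering $Q$ up to a null set. Write $L^2(Q)\times L^2(Q;\mathbb R^d)$ with the norm $\|(v,\tau)\|^2=\|v\|^2_{L^2(Q)}+\|\tau\|^2_{L^2(Q)}$, let $\operatorname{div}(v,\tau)=\partial_t v+\operatorname{div}_x\tau$ and $\nabla_x v$ be understood weakly, and set $$A(v,\tau)=\big(\operatorname{div}(v,\tau),\ \nabla_x v+\tau\big),\qquad A^*(w,\chi)=\big(-\operatorname{div}(w,\chi),\ -\nabla_x w+\chi\big).$$ Let $U$ be the set of all $(v,\tau)\in L^2(Q)\times L^2(Q;\mathbb R^d)$ with $\nabla_x v\in L^2(Q;\mathbb R^d)$ and $\operatorname{div}(v,\tau)\in L^2(Q)$, and let $U_0$ be the set of all $(v,\tau)\in U$ with $\langle\nabla_x v,\chi\rangle_{L^2(Q)}=-\langle v,\operatorname{div}_x\chi\rangle_{L^2(Q)}$ for all $\chi\in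 C^\infty(\overline Q;\mathbb R^d)$. For $\mathbf v=(v,\tau)\in U_0$ let $\gamma_0\mathbf v=v(0,\cdot)\in L^2(\Omega)$ be the value at $t=0$ of the representative of $v$ in $C([0,T];L^2(\Omega))$. Let $Y$ be the Hilbert space of all $(\mathbf w,\xi)\in \big(L^2(Q)\times L^2(Q;\mathbb R^d)\big)\times L^2(\Omega)$ such that $A^*(\mathbf w|_K)\in L^2(K)\times L^2(K;\mathbb R^d)$ for all $K\in\mathcal T$, with the norm $\|(\mathbf w,\xi)\|_Y^2=\|\mathbf w\|^2_{L^2(Q)}+\|A_h^*\mathbf w\|^2_{L^2(Q)}+\|\xi\|^2_{L^2(\Omega)}$, where $(A_h^*\mathbf w)|_K=A^*(\mathbf w|_K)$ for all $K\in\mathcal T$. For $\mathbf v\in U_0$ define $\gamma_A\mathbf v\in Y^*$ by $$\langle\gamma_A\mathbf v,(\mathbf w,\xi)\rangle=\langle A\mathbf v,\mathbf w\rangle_{L^2(Q)}-\langle\mathbf v,A_h^*\mathbf w\rangle_{L^2(Q)}+\langle\gamma_0\mathbf v,\xi\rangle_{L^2(\Omega)},$$ let $\Gamma=\gamma_A U_0\subset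 Y^*$ and $X=\big(L^2(Q)\times L^2(Q;\mathbb R^d)\big)\times\Gamma$, and define $b:X\times Y\to\mathbb R$ by $$b(\mathbf v,\mathbf t;\mathbf w,\xi)=\langle\mathbf v,A_h^*\mathbf w\rangle_{L^2(Q)}+\langle\mathbf t,(\mathbf w,\xi)\rangle.$$ For $(\mathbf v,\mathbf t)\in X$ let $(T_1,T_2)\in Y$ be the Riesz representative of $b(\mathbf v,\mathbf t;\cdot)\in Y^*$, put $\mathcal E(\mathbf v,\mathbf t)=\mathbf v-A_h^*T_1$, and $$\|(\mathbf v,\mathbf t)\|_X^2=\|\mathbf v\|^2_{L^2(Q)}+\|\mathcal E(\mathbf v,\mathbf t)\|^2_{L^2(Q)}+\|A\,\mathcal E(\mathbf v,\mathbf t)\|^2_{L^2(Q)}+\|\gamma_0\,\mathcal E(\mathbf v,\mathbf t)\|^2_{L^2(\Omega)}.$$ **Theorem (well-posedness).** The trace $\gamma_0\mathbf v$ exists for all $\mathbf v\in U_0$, and $\mathcal E(\mathbf v,\mathbf t)\in U_0$ for all $(\mathbf v,\mathbf t)\in X$, so that the quantities above are well defined. For every $F\in Y^*$ there is a unique $(\mathbf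 u,\mathbf s)\in X$ with $$b(\mathbf u,\mathbf s;\mathbf w,\xi)=F(\mathbf w,\xi)\qquad\text{for all }(\mathbf w,\xi)\in Y.$$ Moreover, there is a constant $c_L>0$ with $$c_L\|\mathbf v\|^2_{L^2(Q)}\le\|A\mathbf v\|^2_{L^2(Q)}+\|\gamma_0\mathbf v\|^2_{L^2(\Omega)}\qquad\text{for all }\mathbf v\in U_0,$$ and for every such constant $c_L$ and every $F\in Y^*$ the solution satisfies $$\|(\mathbf u,\mathbf s)\|_X\le\beta^{-1}\|F\|_{Y^*},\qquad \beta=\frac{1+2c_L-\sqrt{(1+2c_L)^2-4c_L^2}}{2c_L}>0.$$ -/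

import Mathlib

open MeasureTheory Set
open scoped ContDiff RealInnerProductSpace

noncomputable section

namespace HeatDPG

/-! ### Domains and partitions -/

/-- The spatial Euclidean space `ℝ^d`. -/
abbrev Space (d : ℕ) := EuclideanSpace ℝ (Fin d)

/-- Time-space points `(t, x)`. -/
abbrev TimeSpace (d : ℕ) := ℝ × Space d

/-- Bounded Lipschitz domain: nonempty, connected, open and bounded, and near each boundary point
`Ω` is, after a rotation, the strict epigraph of a Lipschitz function `g` of the `d - 1`
coordinates orthogonal to some unit vector `e` (the function `g` is only evaluated at the
orthogonal projection `y - ⟪e, y⟫ e` of `y` onto the hyperplane orthogonal to `e`). -/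
structure IsBoundedLipschitzDomain {d : ℕ} (Ω : Set (Space d)) : Prop where
  isOpen : IsOpen Ω
  isConnected : IsConnected Ω
  isBounded : Bornology.IsBounded Ω
  lipschitz_boundary : ∀ x ∈ frontier Ω, ∃ (e : Space d) (r : ℝ) (L : NNReal) (g : Space d → ℝ),
    ‖e‖ = 1 ∧ 0 < r ∧ LipschitzWith L g ∧
      ∀ y ∈ Metric.ball x r, y ∈ Ω ↔ g (y - ⟪e, y⟫ • e) < ⟪e, y⟫

/-- The time-space cylinder `Q = (0, T) × Ω`. -/
def cylinder {d : ℕ} (T : ℝ) (Ω : Set (Space d)) : Set (TimeSpace d) := Ioo 0 T ×ˢ Ω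

/-- A partition of `Q`: finitely many nonempty, pairwise disjoint open cells `K ⊆ Q` which cover
`Q` up to a null set. -/
structure Partition {d : ℕ} (Q : Set (TimeSpace d)) where
  cells : Set (Set (TimeSpace d))
  finite : cells.Finite
  isOpen : ∀ K ∈ cells, IsOpen K
  nonempty : ∀ K ∈ cells, K.Nonempty
  subset : ∀ K ∈ cells, K ⊆ Q
  disjoint : cells.PairwiseDisjoint id
  cover : volume (Q \ ⋃₀ cells) = 0

/-! ### Lebesgue spaces (with their Hilbert space structures) -/

/-- `L²(Q)`. -/
abbrev L2Q {d : ℕ} (Q : Set (TimeSpace d)) := Lp ℝ 2 (volume.restrict Q)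

/-- `L²(Q; ℝ^d)`. -/
abbrev L2QVec {d : ℕ} (Q : Set (TimeSpace d)) := Lp (Space d) 2 (volume.restrict Q)

/-- `L²(Q) × L²(Q; ℝ^d)` with norm `‖(v, τ)‖² = ‖v‖² + ‖τ‖²`. -/
abbrev L2Pair {d : ℕ} (Q : Set (TimeSpace d)) := WithLp 2 (L2Q Q × L2QVec Q)

/-- `L²(Ω)`. -/
abbrev L2Ω {d : ℕ} (Ω : Set (Space d)) := Lp ℝ 2 (volume.restrict Ω)

/-! ### Test functions and classical derivatives -/

/-- `C_c^∞(K; F)`. -/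
def IsTest {d : ℕ} {F : Type*} [NormedAddCommGroup F] [NormedSpace ℝ F]
    (K : Set (TimeSpace d)) (φ : TimeSpace d → F) : Prop :=
  ContDiff ℝ ∞ φ ∧ HasCompactSupport φ ∧ tsupport φ ⊆ K

/-- The time derivative `∂_t φ`. -/
def dt {d : ℕ} (φ : TimeSpace d → ℝ) (z : TimeSpace d) : ℝ := fderiv ℝ φ z (1, 0)

/-- The spatial gradient `∇_x φ`. -/
def gradx {d : ℕ} (φ : TimeSpace d → ℝ) (z : TimeSpace d) : Space d :=
  WithLp.toLp 2 fun i => fderiv ℝ φ z (0, EuclideanSpace.single i 1)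

/-- The spatial divergence `div_x χ`. -/
def divx {d : ℕ} (χ : TimeSpace d → Space d) (z : TimeSpace d) : ℝ :=
  ∑ i, fderiv ℝ χ z (0, EuclideanSpace.single i 1) i

/-! ### Weak derivatives -/

/-- `∇_x v = G` in the weak sense in the open set `K ⊆ Q`. -/
def IsWeakGradx {d : ℕ} {Q : Set (TimeSpace d)} (K : Set (TimeSpace d)) (v : L2Q Q)
    (G : L2QVec Q) : Prop :=
  ∀ χ : TimeSpace d → Space d, IsTest K χ →
    ∫ z in K, ⟪G z, χ z⟫ = -∫ z in K, v z * divx χ z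

/-- `div (v, τ) = ∂_t v + div_x τ = h` in the weak sense in the open set `K ⊆ Q`. -/
def IsWeakDiv {d : ℕ} {Q : Set (TimeSpace d)} (K : Set (TimeSpace d)) (v : L2Pair Q)
    (h : L2Q Q) : Prop :=
  ∀ φ : TimeSpace d → ℝ, IsTest K φ →
    ∫ z in K, h z * φ z = -((∫ z in K, v.fst z * dt φ z) + ∫ z in K, ⟪v.snd z, gradx φ z⟫)

open Classical in
/-- The weak gradient `∇_x v ∈ L²(Q; ℝ^d)` (with value `0` if it does not exist). -/
def weakGradx {d : ℕ} {Q : Set (TimeSpace d)} (v : L2Q Q) : L2QVec Q :=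
  if h : ∃ G, IsWeakGradx Q v G then h.choose else 0

open Classical in
/-- The weak divergence `div (v, τ) ∈ L²(Q)` (with value `0` if it does not exist). -/
def weakDiv {d : ℕ} {Q : Set (TimeSpace d)} (v : L2Pair Q) : L2Q Q :=
  if h : ∃ f, IsWeakDiv Q v f then h.choose else 0

/-- The space `U` of all `(v, τ)` with `∇_x v ∈ L²` and `div (v, τ) ∈ L²`. -/
def U {d : ℕ} (Q : Set (TimeSpace d)) : Set (L2Pair Q) :=
  {v | (∃ G, IsWeakGradx Q v.fst G) ∧ ∃ h, IsWeakDiv Q v h}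

/-- The space `U₀` of all `(v, τ) ∈ U` with `⟨∇_x v, χ⟩ = - ⟨v, div_x χ⟩` for all
`χ ∈ C^∞(Q̄; ℝ^d)` (restrictions to `Q̄` of smooth functions). -/
def U₀ {d : ℕ} (Q : Set (TimeSpace d)) : Set (L2Pair Q) :=
  {v | v ∈ U Q ∧ ∀ χ : TimeSpace d → Space d, ContDiff ℝ ∞ χ →
    ∫ z in Q, ⟪weakGradx v.fst z, χ z⟫ = -∫ z in Q, v.fst z * divx χ z}

/-- `A (v, τ) = (div (v, τ), ∇_x v + τ)`. -/
def opA {d : ℕ} {Q : Set (TimeSpace d)} (v : L2Pair Q) : L2Pair Q :=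
  WithLp.toLp 2 (weakDiv v, weakGradx v.fst + v.snd)

/-- `A* w = g` on the cell `K`, where `A* (w, χ) = (- div (w, χ), - ∇_x w + χ)`. -/
def IsAdjoint {d : ℕ} {Q : Set (TimeSpace d)} (K : Set (TimeSpace d)) (w g : L2Pair Q) : Prop :=
  IsWeakDiv K w (-g.fst) ∧ IsWeakGradx K w.fst (w.snd - g.snd)

/-! ### Initial traces -/

/-- `g = v(0, ·)` for the representative of `v` in `C([0, T]; L²(Ω))`. -/
def IsInitialTrace {d : ℕ} {T : ℝ} {Ω : Set (Space d)} (v : L2Q (cylinder T Ω)) (g : L2Ω Ω) :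
    Prop :=
  ∃ V : ℝ → L2Ω Ω, ContinuousOn V (Icc 0 T) ∧
    (∀ᵐ t ∂(volume.restrict (Ioo 0 T)), ∀ᵐ x ∂(volume.restrict Ω), V t x = v (t, x)) ∧ V 0 = g

open Classical in
/-- The trace `γ₀ (v, τ) = v(0, ·) ∈ L²(Ω)` (with value `0` if it does not exist). -/
def γ₀ {d : ℕ} {T : ℝ} {Ω : Set (Space d)} (v : L2Pair (cylinder T Ω)) : L2Ω Ω :=
  if h : ∃ g, IsInitialTrace v.fst g then h.choose else 0

/-! ### The broken test space `Y` -/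

/-- Pairing over a cell with a square integrable function, as a bounded functional on `L²(Q)`. -/
theorem exists_pairing {d : ℕ} {F : Type*} [NormedAddCommGroup F] [InnerProductSpace ℝ F]
    {Q K : Set (TimeSpace d)} (hK : IsOpen K) (hKQ : K ⊆ Q)
    {ψ : TimeSpace d → F} (hψ : Continuous ψ) (hc : HasCompactSupport ψ) :
    ∃ l : Lp F 2 (volume.restrict Q) →L[ℝ] ℝ, ∀ w, l w = ∫ z in K, ⟪w z, ψ z⟫ := by
  have h1 : MemLp (K.indicator ψ) 2 (volume.restrict Q) :=
    (hψ.memLp_of_hasCompactSupport hc).indicator hK.measurableSet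
  refine ⟨innerSL ℝ h1.toLp, fun w => ?_⟩
  rw [innerSL_apply_apply, L2.inner_def]
  have h2 : ∫ z in K, ⟪w z, ψ z⟫ = ∫ z in Q, K.indicator (fun z => ⟪w z, ψ z⟫) z := by
    rw [integral_indicator hK.measurableSet, Measure.restrict_restrict hK.measurableSet,
      inter_eq_self_of_subset_left hKQ]
  rw [h2]
  refine integral_congr_ae ?_
  filter_upwards [h1.coeFn_toLp] with z hz
  rw [hz]
  by_cases h : z ∈ K
  · simp [h, real_inner_comm]
  · simp [h]

theorem continuous_dt {d : ℕ} {φ : TimeSpace d → ℝ} (h : ContDiff ℝ ∞ φ) :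
    Continuous (dt φ) :=
  (h.continuous_fderiv (by simp)).clm_apply continuous_const

theorem hasCompactSupport_dt {d : ℕ} {φ : TimeSpace d → ℝ} (h : HasCompactSupport φ) :
    HasCompactSupport (dt φ) := h.fderiv_apply ℝ _

theorem continuous_gradx {d : ℕ} {φ : TimeSpace d → ℝ} (h : ContDiff ℝ ∞ φ) :
    Continuous (gradx φ) :=
  (PiLp.continuous_toLp 2 _).comp
    (continuous_pi fun _ => (h.continuous_fderiv (by simp)).clm_apply continuous_const)

theorem hasCompactSupport_gradx {d : ℕ} {φ : TimeSpace d → ℝ} (h : HasCompactSupport φ) :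
    HasCompactSupport (gradx φ) :=
  (h.fderiv ℝ).comp_left
    (g := fun L : TimeSpace d →L[ℝ] ℝ =>
      (WithLp.toLp 2 fun i => L (0, EuclideanSpace.single i 1) : Space d)) (by ext; simp)

theorem continuous_divx {d : ℕ} {χ : TimeSpace d → Space d} (h : ContDiff ℝ ∞ χ) :
    Continuous (divx χ) :=
  continuous_finsetSum _ fun i _ => (PiLp.continuous_apply 2 _ i).comp
    ((h.continuous_fderiv (by simp)).clm_apply continuous_const)

theorem hasCompactSupport_divx {d : ℕ} {χ : TimeSpace d → Space d} (h : HasCompactSupport χ) :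
    HasCompactSupport (divx χ) :=
  (h.fderiv ℝ).comp_left
    (g := fun L : TimeSpace d →L[ℝ] Space d =>
      ∑ i, L (0, EuclideanSpace.single i 1) i) (by simp)

theorem isWeakDiv_iff {d : ℕ} {Q K : Set (TimeSpace d)} (hK : IsOpen K) (hKQ : K ⊆ Q) :
    ∃ (ι : Type) (l₁ l₂ : ι → L2Q Q →L[ℝ] ℝ) (l₃ : ι → L2QVec Q →L[ℝ] ℝ),
      ∀ (v : L2Pair Q) (h : L2Q Q),
        IsWeakDiv K v h ↔ ∀ i, l₁ i h = -(l₂ i v.fst + l₃ i v.snd) := by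
  choose l₁ h₁ using fun φ : {φ : TimeSpace d → ℝ // IsTest K φ} =>
    exists_pairing hK hKQ φ.2.1.continuous φ.2.2.1
  choose l₂ h₂ using fun φ : {φ : TimeSpace d → ℝ // IsTest K φ} =>
    exists_pairing hK hKQ (continuous_dt φ.2.1) (hasCompactSupport_dt φ.2.2.1)
  choose l₃ h₃ using fun φ : {φ : TimeSpace d → ℝ // IsTest K φ} =>
    exists_pairing hK hKQ (continuous_gradx φ.2.1) (hasCompactSupport_gradx φ.2.2.1)
  have key : ∀ a b : ℝ, ⟪a, b⟫ = a * b := fun a b => by simp [mul_comm]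
  refine ⟨_, l₁, l₂, l₃, fun v h => ?_⟩
  simp only [h₁, h₂, h₃, key, Subtype.forall]
  rfl

theorem isWeakGradx_iff {d : ℕ} {Q K : Set (TimeSpace d)} (hK : IsOpen K) (hKQ : K ⊆ Q) :
    ∃ (ι : Type) (l₁ : ι → L2QVec Q →L[ℝ] ℝ) (l₂ : ι → L2Q Q →L[ℝ] ℝ),
      ∀ (v : L2Q Q) (G : L2QVec Q), IsWeakGradx K v G ↔ ∀ i, l₁ i G = -l₂ i v := by
  choose l₁ h₁ using fun χ : {χ : TimeSpace d → Space d // IsTest K χ} =>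
    exists_pairing hK hKQ χ.2.1.continuous χ.2.2.1
  choose l₂ h₂ using fun χ : {χ : TimeSpace d → Space d // IsTest K χ} =>
    exists_pairing hK hKQ (continuous_divx χ.2.1) (hasCompactSupport_divx χ.2.2.1)
  have key : ∀ a b : ℝ, ⟪a, b⟫ = a * b := fun a b => by simp [mul_comm]
  refine ⟨_, l₁, l₂, fun v h => ?_⟩
  simp only [h₁, h₂, key, Subtype.forall]
  rfl

theorem isAdjoint_zero {d : ℕ} {Q K : Set (TimeSpace d)} (hK : IsOpen K) (hKQ : K ⊆ Q) :
    IsAdjoint K (0 : L2Pair Q) 0 := by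
  obtain ⟨_, l₁, l₂, l₃, h⟩ := isWeakDiv_iff hK hKQ
  obtain ⟨_, m₁, m₂, h'⟩ := isWeakGradx_iff hK hKQ
  simp [IsAdjoint, h, h']

theorem isAdjoint_add {d : ℕ} {Q K : Set (TimeSpace d)} (hK : IsOpen K) (hKQ : K ⊆ Q)
    {w g w' g' : L2Pair Q} (h₁ : IsAdjoint K w g) (h₂ : IsAdjoint K w' g') :
    IsAdjoint K (w + w') (g + g') := by
  obtain ⟨_, l₁, l₂, l₃, h⟩ := isWeakDiv_iff hK hKQ
  obtain ⟨_, m₁, m₂, h'⟩ := isWeakGradx_iff hK hKQ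
  simp only [IsAdjoint, h, h', WithLp.add_fst, WithLp.add_snd, map_add, map_neg, map_sub]
    at h₁ h₂ ⊢
  exact ⟨fun i => by linarith [h₁.1 i, h₂.1 i], fun i => by linarith [h₁.2 i, h₂.2 i]⟩

theorem isAdjoint_smul {d : ℕ} {Q K : Set (TimeSpace d)} (hK : IsOpen K) (hKQ : K ⊆ Q)
    (c : ℝ) {w g : L2Pair Q} (h₁ : IsAdjoint K w g) : IsAdjoint K (c • w) (c • g) := by
  obtain ⟨_, l₁, l₂, l₃, h⟩ := isWeakDiv_iff hK hKQ
  obtain ⟨_, m₁, m₂, h'⟩ := isWeakGradx_iff hK hKQ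
  simp only [IsAdjoint, h, h', WithLp.smul_fst, WithLp.smul_snd, map_smul, map_neg, map_sub,
    smul_eq_mul] at h₁ ⊢
  exact ⟨fun i => by linear_combination c * h₁.1 i, fun i => by linear_combination c * h₁.2 i⟩

theorem isClosed_isAdjoint {d : ℕ} {Q K : Set (TimeSpace d)} (hK : IsOpen K) (hKQ : K ⊆ Q) :
    IsClosed {p : L2Pair Q × L2Pair Q | IsAdjoint K p.1 p.2} := by
  obtain ⟨_, l₁, l₂, l₃, h⟩ := isWeakDiv_iff hK hKQ
  obtain ⟨_, m₁, m₂, h'⟩ := isWeakGradx_iff hK hKQ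
  have c1 : Continuous fun p : L2Pair Q × L2Pair Q => p.1.fst :=
    (WithLp.continuous_fst 2 _ _).comp continuous_fst
  have c2 : Continuous fun p : L2Pair Q × L2Pair Q => p.1.snd :=
    (WithLp.continuous_snd 2 _ _).comp continuous_fst
  have c3 : Continuous fun p : L2Pair Q × L2Pair Q => p.2.fst :=
    (WithLp.continuous_fst 2 _ _).comp continuous_snd
  have c4 : Continuous fun p : L2Pair Q × L2Pair Q => p.2.snd :=
    (WithLp.continuous_snd 2 _ _).comp continuous_snd
  simp only [IsAdjoint, h, h', Set.ofPred_and, Set.ofPred_forall, map_neg, map_sub]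
  refine (isClosed_iInter fun i => isClosed_eq ?_ ?_).inter
    (isClosed_iInter fun i => isClosed_eq ?_ ?_)
  · exact ((l₁ i).continuous.comp c3).neg
  · exact (((l₂ i).continuous.comp c1).add ((l₃ i).continuous.comp c2)).neg
  · exact ((m₁ i).continuous.comp c2).sub ((m₁ i).continuous.comp c4)
  · exact ((m₂ i).continuous.comp c1).neg

/-- The Hilbert space of all triples `(w, g, ξ)` in
`(L²(Q) × L²(Q; ℝ^d)) × (L²(Q) × L²(Q; ℝ^d)) × L²(Ω)`, with the product inner product. -/
abbrev Triple {d : ℕ} (T : ℝ) (Ω : Set (Space d)) :=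
  WithLp 2 (L2Pair (cylinder T Ω) × WithLp 2 (L2Pair (cylinder T Ω) × L2Ω Ω))

/-- The broken test space `Y = H(A*, 𝒯) × L²(Ω)`. An element `(w, ξ)` is represented by the triple
`(w, A*_h w, ξ)`, where `A*_h w` is the (unique) function in `L²(Q) × L²(Q; ℝ^d)` that equals
`A* (w|_K)` on every cell `K`; so the inner product inherited from `Triple` is
`⟨w, w'⟩ + ⟨A*_h w, A*_h w'⟩ + ⟨ξ, ξ'⟩`. -/
def Y {d : ℕ} {T : ℝ} {Ω : Set (Space d)} (P : Partition (cylinder T Ω)) :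
    Submodule ℝ (Triple T Ω) where
  carrier := {y | ∀ K ∈ P.cells, IsAdjoint K y.fst y.snd.fst}
  zero_mem' := fun K hK => isAdjoint_zero (P.isOpen K hK) (P.subset K hK)
  add_mem' := fun h₁ h₂ K hK =>
    isAdjoint_add (P.isOpen K hK) (P.subset K hK) (h₁ K hK) (h₂ K hK)
  smul_mem' := fun c _ h₁ K hK => isAdjoint_smul (P.isOpen K hK) (P.subset K hK) c (h₁ K hK)

theorem isClosed_Y {d : ℕ} {T : ℝ} {Ω : Set (Space d)} (P : Partition (cylinder T Ω)) :
    IsClosed (Y P : Set (Triple T Ω)) := by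
  have : (Y P : Set (Triple T Ω)) = ⋂ K, ⋂ (_ : K ∈ P.cells),
      (fun y : Triple T Ω => (y.fst, y.snd.fst)) ⁻¹' {p | IsAdjoint K p.1 p.2} := by
    ext y; simp only [mem_iInter]; rfl
  rw [this]
  refine isClosed_iInter fun K => isClosed_iInter fun hK =>
    (isClosed_isAdjoint (P.isOpen K hK) (P.subset K hK)).preimage ?_
  exact (WithLp.continuous_fst 2 _ _).prodMk
    ((WithLp.continuous_fst 2 _ _).comp (WithLp.continuous_snd 2 _ _))

instance {d : ℕ} {T : ℝ} {Ω : Set (Space d)} (P : Partition (cylinder T Ω)) :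
    CompleteSpace (Y P) := (isClosed_Y P).completeSpace_coe

/-- The component `w` of `(w, ξ) ∈ Y`. -/
def Y.w {d : ℕ} {T : ℝ} {Ω : Set (Space d)} (P : Partition (cylinder T Ω)) :
    Y P →L[ℝ] L2Pair (cylinder T Ω) :=
  (WithLp.fstL 2 ℝ (L2Pair (cylinder T Ω)) (WithLp 2 (L2Pair (cylinder T Ω) × L2Ω Ω))).comp
    (Y P).subtypeL

/-- The element-wise application `A*_h w` for `(w, ξ) ∈ Y`. -/
def Y.adj {d : ℕ} {T : ℝ} {Ω : Set (Space d)} (P : Partition (cylinder T Ω)) :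
    Y P →L[ℝ] L2Pair (cylinder T Ω) :=
  (WithLp.fstL 2 ℝ (L2Pair (cylinder T Ω)) (L2Ω Ω)).comp
    ((WithLp.sndL 2 ℝ (L2Pair (cylinder T Ω)) (WithLp 2 (L2Pair (cylinder T Ω) × L2Ω Ω))).comp
      (Y P).subtypeL)

/-- The component `ξ` of `(w, ξ) ∈ Y`. -/
def Y.ξ {d : ℕ} {T : ℝ} {Ω : Set (Space d)} (P : Partition (cylinder T Ω)) :
    Y P →L[ℝ] L2Ω Ω :=
  (WithLp.sndL 2 ℝ (L2Pair (cylinder T Ω)) (L2Ω Ω)).comp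
    ((WithLp.sndL 2 ℝ (L2Pair (cylinder T Ω)) (WithLp 2 (L2Pair (cylinder T Ω) × L2Ω Ω))).comp
      (Y P).subtypeL)

/-! ### Traces, the trial space `X` and the bilinear form -/

/-- The trace `γ_A v ∈ Y*`, that is,
`⟨γ_A v, (w, ξ)⟩ = ⟨A v, w⟩ - ⟨v, A*_h w⟩ + ⟨γ₀ v, ξ⟩`. -/
def γA {d : ℕ} {T : ℝ} {Ω : Set (Space d)} (P : Partition (cylinder T Ω))
    (v : L2Pair (cylinder T Ω)) : Y P →L[ℝ] ℝ :=
  (innerSL ℝ (opA v)).comp (Y.w P) - (innerSL ℝ v).comp (Y.adj P) + (innerSL ℝ (γ₀ v)).comp (Y.ξ P)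

/-- The trace space `Γ(∂𝒯) = γ_A U₀ ⊆ Y*`. -/
def Γ {d : ℕ} {T : ℝ} {Ω : Set (Space d)} (P : Partition (cylinder T Ω)) :
    Set (Y P →L[ℝ] ℝ) :=
  γA P '' U₀ (cylinder T Ω)

/-- The trial space `X = (L²(Q) × L²(Q; ℝ^d)) × Γ(∂𝒯)`. -/
abbrev X {d : ℕ} {T : ℝ} {Ω : Set (Space d)} (P : Partition (cylinder T Ω)) :=
  L2Pair (cylinder T Ω) × Γ P

/-- The functional `b(v, t; ·) ∈ Y*`, that is, `b(v, t; w, ξ) = ⟨v, A*_h w⟩ + ⟨t, (w, ξ)⟩`. -/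
def b {d : ℕ} {T : ℝ} {Ω : Set (Space d)} (P : Partition (cylinder T Ω)) (x : X P) :
    Y P →L[ℝ] ℝ :=
  (innerSL ℝ x.1).comp (Y.adj P) + x.2

/-- The trial-to-test operator: `⟨trialToTest (v, t), (w, ξ)⟩_Y = b(v, t; w, ξ)`. -/
def trialToTest {d : ℕ} {T : ℝ} {Ω : Set (Space d)} (P : Partition (cylinder T Ω)) (x : X P) :
    Y P :=
  (InnerProductSpace.toDual ℝ (Y P)).symm (b P x)

/-- The extension `ℰ(v, t) = v - A*_h T₁(v, t)`, with `T₁` the first component of the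
trial-to-test operator. -/
def extension {d : ℕ} {T : ℝ} {Ω : Set (Space d)} (P : Partition (cylinder T Ω)) (x : X P) :
    L2Pair (cylinder T Ω) :=
  x.1 - Y.adj P (trialToTest P x)

/-- The norm `‖(v, t)‖_X`, with `‖(v, t)‖_X² = ‖v‖² + ‖ℰ‖² + ‖A ℰ‖² + ‖γ₀ ℰ‖²`. -/
def normX {d : ℕ} {T : ℝ} {Ω : Set (Space d)} (P : Partition (cylinder T Ω)) (x : X P) : ℝ :=
  √(‖x.1‖ ^ 2 + (‖extension P x‖ ^ 2 + ‖opA (extension P x)‖ ^ 2) + ‖γ₀ (extension P x)‖ ^ 2)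

/-! ### Constants -/

/-- `c > 0` satisfies `c ‖v‖² ≤ ‖A v‖² + ‖γ₀ v‖²` for all `v ∈ U₀`. -/
def IsStabilityConstant {d : ℕ} (T : ℝ) (Ω : Set (Space d)) (c : ℝ) : Prop :=
  0 < c ∧ ∀ v ∈ U₀ (cylinder T Ω), c * ‖v‖ ^ 2 ≤ ‖opA v‖ ^ 2 + ‖γ₀ v‖ ^ 2

/-- The inf-sup constant `β` as a function of the constant `c = c_L`. -/
def infSupConstant (c : ℝ) : ℝ :=
  (1 + 2 * c - √((1 + 2 * c) ^ 2 - 4 * c ^ 2)) / (2 * c)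

end HeatDPG

end

noncomputable section

namespace HeatDPG

open Filter Topology
open scoped ENNReal Convolution

set_option linter.unusedSectionVars false

/-! ### Mollification in `L²` -/

section

/-! Everything reduces to one fact about the unbroken problem: `(A, γ₀)` maps `U₀` bijectively onto
`L²(Q) × L²(Q; ℝ^d) × L²(Ω)`, with the stability bound.

Reduction. Write `t = γ_A u` and let `R = (T₁, T₂)` be the Riesz representative of `b(v, t; ·)`. On
a smooth test triple that is not broken along the cells, vanishes at time `T` and carries its
initial value as third component, integration by parts makes `γ_A u` vanish. The Riesz identity then
says that `ℰ = v - A*_h T₁` is a weak solution of `A ℰ = T₁`, `γ₀ ℰ = T₂`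
(`isWeakSolution_extension`). Thus `R` determines `ℰ`, hence `v`, hence `t`, which is uniqueness
(`b_injective`). Conversely, given `F` with representative `R`, solve `A u = T₁`, `γ₀ u = T₂` and
take `v = u + A*_h T₁`, `t = γ_A u`: the terms with `u` cancel and `b(v, t; ·) = F`
(`b_apply_of_isWeakSolution`). Since `‖F‖² = ‖A ℰ‖² + ‖A*_h T₁‖² + ‖γ₀ ℰ‖²` and `‖v‖ ≤ ‖ℰ‖ + ‖A*_h
T₁‖`, the bound by `β⁻¹` is a scalar quadratic inequality (`sq_add_sq_add_le`).

The unbroken problem. The tool is the energy identity `‖v(T)‖² - ‖v(0)‖² = 2⟨div(v, τ), v⟩ + 2⟨τ,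
∇_x v⟩`, proved together with the continuous representative in `exists_trace_curve`. Rewritten in
terms of `∇_x v + τ` it gives the stability constant, so `(A, γ₀)` is injective with closed range.
An element `(w, ξ)` orthogonal to the range satisfies a homogeneous backward heat equation with zero
terminal value, and the same identity forces it to vanish (`eq_zero_of_orthogonal_range`); hence the
range is everything (`exists_isWeakSolution`).

The energy identity itself needs regularisation. Functions on `Q` are read as curves in `L²(Ω)`
(`exists_isCurry`). The integration by parts condition defining `U₀` says that time averages extend
by zero to `H¹(ℝ^d)`, and in a Lipschitz domain such functions are limits of test functions
(`HasWeakGrad.isTestLimit`), so they may be inserted in the equation. One-sided mollification in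
time of the two halves of a cut-off solution (`IsWeakEvolution.isEvolutionLimit`) gives classical
evolutions, for which the identity is the fundamental theorem of calculus; an estimate uniform in
time carries it to the limit. -/

theorem sq_lintegral_mul_le {α : Type*} [MeasurableSpace α] {μ : Measure α} {k g : α → ℝ≥0∞}
    (hk : AEMeasurable k μ) (hg : AEMeasurable g μ) (h1 : ∫⁻ y, k y ∂μ = 1) :
    (∫⁻ y, k y * g y ∂μ) ^ 2 ≤ ∫⁻ y, k y * g y ^ 2 ∂μ := by
  -- Cauchy-Schwarz for the splitting `k * g = k^{1/2} * (k^{1/2} * g)`; the first factor has norm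
  -- one because `k` has mass one.
  have h := ENNReal.lintegral_mul_le_Lp_mul_Lq μ Real.HolderConjugate.two_two
    (hk.pow_const (1 / 2 : ℝ)) ((hk.pow_const (1 / 2 : ℝ)).mul hg)
  have e1 : ∀ y, ((fun y => k y ^ (1 / 2 : ℝ)) * ((fun y => k y ^ (1 / 2 : ℝ)) * g)) y
      = k y * g y := fun y => by
    simp only [Pi.mul_apply]
    rw [← mul_assoc, ← ENNReal.rpow_add_of_nonneg _ _ (by norm_num) (by norm_num)]
    norm_num
  have e2 : ∀ y, ((fun y => k y ^ (1 / 2 : ℝ)) y) ^ (2 : ℝ) = k y := fun y => by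
    rw [← ENNReal.rpow_mul]; norm_num
  have e3 : ∀ y, (((fun y => k y ^ (1 / 2 : ℝ)) * g) y) ^ (2 : ℝ) = k y * g y ^ 2 := fun y => by
    simp only [Pi.mul_apply]
    rw [ENNReal.mul_rpow_of_nonneg _ _ (by norm_num), ← ENNReal.rpow_mul]
    norm_num
  simp only [e1, e2, e3, h1, ENNReal.one_rpow, one_mul] at h
  calc (∫⁻ y, k y * g y ∂μ) ^ 2 ≤ ((∫⁻ y, k y * g y ^ 2 ∂μ) ^ (1 / 2 : ℝ)) ^ 2 := by gcongr
    _ = _ := by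
      rw [← ENNReal.rpow_natCast, ← ENNReal.rpow_mul]; norm_num

variable {E F : Type*} [NormedAddCommGroup E] [NormedSpace ℝ E] [FiniteDimensional ℝ E]
  [MeasurableSpace E] [BorelSpace E] [NormedAddCommGroup F] [NormedSpace ℝ F]
  {μ : Measure E} [μ.IsAddHaarMeasure]

/-- A nonnegative continuous kernel of unit mass with compact support. -/
structure IsMollifier (μ : Measure E) (k : E → ℝ) : Prop where
  continuous : Continuous k
  hasCompactSupport : HasCompactSupport k
  nonneg : ∀ x, 0 ≤ k x
  integral : ∫ x, k x ∂μ = 1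

theorem IsMollifier.lintegral {k : E → ℝ} (hk : IsMollifier μ k) : ∫⁻ y, ‖k y‖ₑ ∂μ = 1 := by
  have : ∀ y, ‖k y‖ₑ = ENNReal.ofReal (k y) := fun y => Real.enorm_eq_ofReal (hk.nonneg y)
  simp only [this]
  rw [← ofReal_integral_eq_lintegral_ofReal
    (hk.continuous.integrable_of_hasCompactSupport hk.hasCompactSupport)
    (ae_of_all _ hk.nonneg), hk.integral, ENNReal.ofReal_one]

theorem eLpNorm_two_sq {α G : Type*} [MeasurableSpace α] {ν : Measure α} [NormedAddCommGroup G]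
    (f : α → G) : eLpNorm f 2 ν ^ 2 = ∫⁻ x, ‖f x‖ₑ ^ 2 ∂ν := by
  rw [eLpNorm_eq_lintegral_rpow_enorm_toReal (by norm_num) (by norm_num), ← ENNReal.rpow_natCast,
    ← ENNReal.rpow_mul]
  norm_num

/-- Jensen's inequality for the probability density `k` at each point, then Tonelli and translation
invariance. -/
theorem IsMollifier.eLpNorm_convolution_le {k : E → ℝ} (hk : IsMollifier μ k) {f : E → F}
    (hf : AEStronglyMeasurable f μ) :
    eLpNorm (k ⋆[ContinuousLinearMap.lsmul ℝ ℝ, μ] f) 2 μ ≤ eLpNorm f 2 μ := by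
  have hm : AEStronglyMeasurable (fun p : E × E => f (p.1 - p.2)) (μ.prod μ) :=
    hf.comp_quasiMeasurePreserving (quasiMeasurePreserving_sub μ μ)
  have hkm : AEMeasurable (fun y => ‖k y‖ₑ) μ := hk.continuous.enorm.aemeasurable
  have hsq : eLpNorm (k ⋆[ContinuousLinearMap.lsmul ℝ ℝ, μ] f) 2 μ ^ 2 ≤ eLpNorm f 2 μ ^ 2 := by
    rw [eLpNorm_two_sq, eLpNorm_two_sq]
    calc ∫⁻ x, ‖(k ⋆[ContinuousLinearMap.lsmul ℝ ℝ, μ] f) x‖ₑ ^ 2 ∂μ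
        ≤ ∫⁻ x, ∫⁻ y, ‖k y‖ₑ * ‖f (x - y)‖ₑ ^ 2 ∂μ ∂μ := by
          refine lintegral_mono fun x => ?_
          have hfx : AEMeasurable (fun y => ‖f (x - y)‖ₑ) μ :=
            (hf.comp_quasiMeasurePreserving (quasiMeasurePreserving_sub_left μ x)).enorm
          refine le_trans ?_ (sq_lintegral_mul_le hkm hfx hk.lintegral)
          gcongr
          refine (enorm_integral_le_lintegral_enorm _).trans (lintegral_mono fun y => ?_)
          simp [enorm_smul]
      _ = ∫⁻ y, ∫⁻ x, ‖k y‖ₑ * ‖f (x - y)‖ₑ ^ 2 ∂μ ∂μ := by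
          refine lintegral_lintegral_swap ?_
          exact (hkm.comp_quasiMeasurePreserving Measure.quasiMeasurePreserving_snd).mul
            (hm.enorm.pow_const 2)
      _ = ∫⁻ y, ‖k y‖ₑ * ∫⁻ x, ‖f x‖ₑ ^ 2 ∂μ ∂μ := by
          refine lintegral_congr fun y => ?_
          rw [lintegral_const_mul' _ _ enorm_ne_top,
            lintegral_sub_right_eq_self (fun x => ‖f x‖ₑ ^ 2) y]
      _ = _ := by
          rw [lintegral_mul_const'' _ hkm, hk.lintegral, one_mul]
  exact (ENNReal.pow_le_pow_left_iff two_ne_zero).1 hsq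

theorem IsMollifier.dist_convolution_le [CompleteSpace F] {k : E → ℝ} (hk : IsMollifier μ k)
    {f : E → F} (hf : Continuous f) {r ε : ℝ}
    (hr : Function.support k ⊆ Metric.ball 0 r) {x : E} (hε : 0 ≤ ε)
    (h : ∀ y ∈ Metric.ball x r, dist (f y) (f x) ≤ ε) :
    dist ((k ⋆[ContinuousLinearMap.lsmul ℝ ℝ, μ] f) x) (f x) ≤ ε :=
  _root_.MeasureTheory.dist_convolution_le hε hr hk.nonneg hk.integral hf.aestronglyMeasurable h

/-- Convolution is a contraction on `L²`, so it suffices to treat continuous compactly supported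
functions, where uniform continuity gives uniform convergence on a fixed compact set. The kernels
need not be centred at the origin, only their supports must shrink to it; both later applications
use off-centre kernels. -/
theorem tendsto_eLpNorm_convolution_sub [CompleteSpace F] {k : ℕ → E → ℝ}
    (hk : ∀ n, IsMollifier μ (k n)) {r : ℕ → ℝ} (hr : Tendsto r atTop (𝓝 0))
    (hkr : ∀ n, Function.support (k n) ⊆ Metric.ball 0 (r n)) {f : E → F} (hf : MemLp f 2 μ) :
    Tendsto (fun n => eLpNorm (k n ⋆[ContinuousLinearMap.lsmul ℝ ℝ, μ] f - f) 2 μ) atTop (𝓝 0) := by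
  have := FiniteDimensional.proper ℝ E
  rw [ENNReal.tendsto_nhds_zero]
  intro ε hε
  by_cases hεt : ε = ⊤
  · simp [hεt]
  have hε3 : ε / 3 ≠ 0 := (ENNReal.div_pos hε.ne' (by norm_num)).ne'
  obtain ⟨g, hgc, hfg, hg, hgm⟩ := hf.exists_hasCompactSupport_eLpNorm_sub_le (by norm_num) hε3
  -- Once the kernel radius is below `1`, this compact set contains the supports of `g` and of all
  -- its mollifications, so a uniform bound on it becomes an `L²` bound.
  set K := Metric.cthickening 1 (tsupport g) with hK
  have hKc : IsCompact K := hgc.isCompact.cthickening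
  obtain ⟨δ, hδ, hδK⟩ : ∃ δ : ℝ, 0 < δ ∧ ENNReal.ofReal δ * μ K ^ (1 / (2 : ℝ≥0∞).toReal) ≤ ε / 3 := by
    have hfin : μ K ^ (1 / (2 : ℝ≥0∞).toReal) ≠ ⊤ :=
      ENNReal.rpow_ne_top_of_nonneg (by norm_num) hKc.measure_lt_top.ne
    obtain ⟨δ, hδ, h⟩ := ENNReal.exists_nnreal_pos_mul_lt hfin hε3
    exact ⟨δ, hδ, by rw [ENNReal.ofReal_coe_nnreal]; exact h.le⟩
  obtain ⟨ρ, hρ, hρg⟩ := Metric.uniformContinuous_iff.1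
    (hgc.uniformContinuous_of_continuous hg) δ hδ
  have hev : ∀ᶠ n in atTop, r n < min ρ 1 := hr.eventually_lt_const (by positivity)
  filter_upwards [hev] with n hn
  have h1 : eLpNorm (k n ⋆[ContinuousLinearMap.lsmul ℝ ℝ, μ] g - g) 2 μ ≤ ε / 3 := by
    refine (eLpNorm_sub_le_of_dist_bdd μ (by norm_num) hKc.measurableSet hδ.le ?_ ?_ ?_).trans hδK
    · intro x
      refine (hk n).dist_convolution_le hg (hkr n) hδ.le fun y hy => ?_
      exact (hρg (lt_of_lt_of_le (Metric.mem_ball.1 hy)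
        (hn.le.trans (min_le_left _ _)))).le
    · refine (support_convolution_subset _).trans ?_
      rintro _ ⟨a, ha, b, hb, rfl⟩
      refine Metric.mem_cthickening_of_dist_le _ b _ _ (subset_tsupport _ hb) ?_
      have := hkr n ha
      rw [mem_ball_zero_iff] at this
      rw [dist_eq_norm, add_sub_cancel_right]
      exact this.le.trans (hn.le.trans (min_le_right _ _))
    · exact (subset_tsupport _).trans (Metric.self_subset_cthickening _)
  have hfi : ∀ x, ConvolutionExistsAt (k n) f x (ContinuousLinearMap.lsmul ℝ ℝ) μ := fun x =>
    (hk n).hasCompactSupport.convolutionExists_left _ (hk n).continuous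
      (hf.locallyIntegrable (by norm_num)) x
  have hgi : ∀ x, ConvolutionExistsAt (k n) g x (ContinuousLinearMap.lsmul ℝ ℝ) μ := fun x =>
    (hk n).hasCompactSupport.convolutionExists_left _ (hk n).continuous
      (hg.locallyIntegrable) x
  have hdec : k n ⋆[ContinuousLinearMap.lsmul ℝ ℝ, μ] f - f
      = (k n ⋆[ContinuousLinearMap.lsmul ℝ ℝ, μ] (f - g)) +
        ((k n ⋆[ContinuousLinearMap.lsmul ℝ ℝ, μ] g - g) - (f - g)) := by
    funext x
    have : (k n ⋆[ContinuousLinearMap.lsmul ℝ ℝ, μ] (f - g)) x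
        = (k n ⋆[ContinuousLinearMap.lsmul ℝ ℝ, μ] f) x
          - (k n ⋆[ContinuousLinearMap.lsmul ℝ ℝ, μ] g) x := by
      simp only [convolution]
      rw [← integral_sub (hfi x) (hgi x)]
      simp [smul_sub]
    simp only [Pi.add_apply, Pi.sub_apply, this]
    abel
  have m1 : AEStronglyMeasurable (k n ⋆[ContinuousLinearMap.lsmul ℝ ℝ, μ] (f - g)) μ :=
    ((hk n).hasCompactSupport.continuous_convolution_left _ (hk n).continuous
      ((hf.sub hgm).locallyIntegrable (by norm_num))).aestronglyMeasurable
  have m2 : AEStronglyMeasurable (k n ⋆[ContinuousLinearMap.lsmul ℝ ℝ, μ] g - g) μ :=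
    (((hk n).hasCompactSupport.continuous_convolution_left _ (hk n).continuous
      hg.locallyIntegrable).sub hg).aestronglyMeasurable
  have m3 := (hf.sub hgm).aestronglyMeasurable
  rw [hdec]
  calc _ ≤ eLpNorm (k n ⋆[ContinuousLinearMap.lsmul ℝ ℝ, μ] (f - g)) 2 μ +
        (eLpNorm (k n ⋆[ContinuousLinearMap.lsmul ℝ ℝ, μ] g - g) 2 μ + eLpNorm (f - g) 2 μ) :=
        (eLpNorm_add_le m1 (m2.sub m3) (by norm_num)).trans
          (by gcongr; exact eLpNorm_sub_le m2 m3 (by norm_num))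
    _ ≤ ε / 3 + (ε / 3 + ε / 3) := by
        gcongr
        exact ((hk n).eLpNorm_convolution_le m3).trans hfg
    _ = ε := by rw [← add_assoc]; exact ENNReal.add_thirds ε

end

/-! ### Weak gradients on `ℝ^d` -/

section

theorem exists_isMollifier {E : Type*} [NormedAddCommGroup E] [NormedSpace ℝ E]
    [FiniteDimensional ℝ E] [MeasurableSpace E] [BorelSpace E] (μ : Measure E)
    [μ.IsAddHaarMeasure] (c : E) {δ : ℝ} (hδ : 0 < δ) :
    ∃ k : E → ℝ, IsMollifier μ k ∧ ContDiff ℝ ∞ k ∧ Function.support k ⊆ Metric.closedBall c δ := by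
  let f : ContDiffBump c := ⟨δ / 2, δ, half_pos hδ, half_lt_self hδ⟩
  exact ⟨f.normed μ, ⟨f.continuous_normed, f.hasCompactSupport_normed, f.nonneg_normed,
    f.integral_normed⟩, f.contDiff_normed, by
      rw [f.support_normed_eq]; exact Metric.ball_subset_closedBall⟩

/-- The gradient of a function on `ℝ^d`. -/
def grad {d : ℕ} (ψ : Space d → ℝ) (x : Space d) : Space d :=
  WithLp.toLp 2 fun i => fderiv ℝ ψ x (EuclideanSpace.single i 1)

/-- The divergence of a vector field on `ℝ^d`. -/
def sdiv {d : ℕ} (χ : Space d → Space d) (x : Space d) : ℝ :=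
  ∑ i, fderiv ℝ χ x (EuclideanSpace.single i 1) i

variable {d : ℕ}

theorem space_inner_eq (a b : Space d) : ⟪a, b⟫ = ∑ i, a i * b i := by
  simp [PiLp.inner_apply, mul_comm]

theorem continuous_grad {ψ : Space d → ℝ} (h : ContDiff ℝ ∞ ψ) : Continuous (grad ψ) :=
  (PiLp.continuous_toLp 2 _).comp
    (continuous_pi fun _ => (h.continuous_fderiv (by simp)).clm_apply continuous_const)

theorem hasCompactSupport_grad {ψ : Space d → ℝ} (h : HasCompactSupport ψ) :
    HasCompactSupport (grad ψ) :=
  (h.fderiv ℝ).comp_left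
    (g := fun L : Space d →L[ℝ] ℝ =>
      (WithLp.toLp 2 fun i => L (EuclideanSpace.single i 1) : Space d)) (by ext; simp)

theorem continuous_sdiv {χ : Space d → Space d} (h : ContDiff ℝ ∞ χ) : Continuous (sdiv χ) :=
  continuous_finsetSum _ fun i _ => (PiLp.continuous_apply 2 _ i).comp
    ((h.continuous_fderiv (by simp)).clm_apply continuous_const)

theorem hasCompactSupport_sdiv {χ : Space d → Space d} (h : HasCompactSupport χ) :
    HasCompactSupport (sdiv χ) :=
  (h.fderiv ℝ).comp_left
    (g := fun L : Space d →L[ℝ] Space d => ∑ i, L (EuclideanSpace.single i 1) i) (by simp)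

theorem sdiv_smul {θ : Space d → ℝ} {χ : Space d → Space d} (hθ : ContDiff ℝ ∞ θ)
    (hχ : ContDiff ℝ ∞ χ) (x : Space d) :
    sdiv (fun y => θ y • χ y) x = θ x * sdiv χ x + ⟪grad θ x, χ x⟫ := by
  have h : fderiv ℝ (fun y => θ y • χ y) x = θ x • fderiv ℝ χ x + (fderiv ℝ θ x).smulRight (χ x) :=
    fderiv_fun_smul (hθ.differentiable (by simp) x) (hχ.differentiable (by simp) x)
  simp only [sdiv, h, space_inner_eq, grad, Finset.mul_sum, ← Finset.sum_add_distrib]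
  exact Finset.sum_congr rfl fun i _ => by simp

theorem sdiv_smul_const {θ : Space d → ℝ} (hθ : ContDiff ℝ ∞ θ) (i : Fin d) (x : Space d) :
    sdiv (fun y => θ y • (EuclideanSpace.single i 1 : Space d)) x
      = fderiv ℝ θ x (EuclideanSpace.single i 1) := by
  rw [sdiv_smul hθ contDiff_const, space_inner_eq]
  simp [sdiv, grad]

/-- `G` is the weak gradient on `ℝ^d` of `u`, both square integrable. -/
structure HasWeakGrad (u : Space d → ℝ) (G : Space d → Space d) : Prop where
  memLp : MemLp u 2
  memLp_grad : MemLp G 2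
  integral_eq : ∀ χ : Space d → Space d, ContDiff ℝ ∞ χ → HasCompactSupport χ →
    ∫ x, ⟪G x, χ x⟫ = -∫ x, u x * sdiv χ x

theorem MemLp.bdd_smul {α F : Type*} [MeasurableSpace α] {μ : Measure α} [NormedAddCommGroup F]
    [NormedSpace ℝ F] {p : ℝ≥0∞} {θ : α → ℝ} {f : α → F} (hf : MemLp f p μ)
    (hθ : AEStronglyMeasurable θ μ) {C : ℝ} (hC : ∀ x, ‖θ x‖ ≤ C) :
    MemLp (fun x => θ x • f x) p μ :=
  hf.of_le_mul (c := C) (hθ.smul hf.1) (ae_of_all _ fun x => by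
    rw [norm_smul]; exact mul_le_mul_of_nonneg_right (hC x) (norm_nonneg _))

theorem HasWeakGrad.smul {u : Space d → ℝ} {G : Space d → Space d} (h : HasWeakGrad u G)
    {θ : Space d → ℝ} (hθ : ContDiff ℝ ∞ θ) (hc : HasCompactSupport θ) :
    HasWeakGrad (fun x => θ x * u x) (fun x => θ x • G x + u x • grad θ x) := by
  obtain ⟨C, hC⟩ := hc.exists_bound_of_continuous hθ.continuous
  obtain ⟨C', hC'⟩ := (hasCompactSupport_grad hc).exists_bound_of_continuous (continuous_grad hθ)
  have hl := h.memLp.locallyIntegrable (by norm_num)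
  have hlG := h.memLp_grad.locallyIntegrable (by norm_num)
  refine ⟨MemLp.bdd_smul h.memLp hθ.continuous.aestronglyMeasurable hC,
    (MemLp.bdd_smul h.memLp_grad hθ.continuous.aestronglyMeasurable hC).add
      (h.memLp.of_le_mul (c := C') (h.memLp.1.smul (continuous_grad hθ).aestronglyMeasurable)
        (ae_of_all _ fun x => ?_)), fun χ hχ hχc => ?_⟩
  · rw [norm_smul, mul_comm]; exact mul_le_mul_of_nonneg_right (hC' x) (norm_nonneg _)
  -- Testing with `θ χ` moves the cut-off onto the function; the product rule for the divergence
  -- produces the extra term `u ∇θ`.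
  · have key := h.integral_eq (fun y => θ y • χ y) (hθ.smul hχ)
      (hχc.mono' fun x hx => subset_tsupport _ fun h0 => hx (by simp [h0]))
    have i1 : Integrable fun x => u x * (θ x * sdiv χ x) :=
      hl.integrable_smul_right_of_hasCompactSupport (hθ.continuous.mul (continuous_sdiv hχ))
        ((hasCompactSupport_sdiv hχc).mul_left)
    have i2 : Integrable fun x => u x * ⟪grad θ x, χ x⟫ :=
      hl.integrable_smul_right_of_hasCompactSupport ((continuous_grad hθ).inner hχ.continuous)
        (hχc.mono' fun x hx => subset_tsupport _ fun h0 => hx (by simp [h0]))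
    have i3 : Integrable fun x => ⟪G x, θ x • χ x⟫ := by
      simp only [space_inner_eq]
      refine integrable_finsetSum _ fun i _ => ?_
      have hGi : LocallyIntegrable fun x => G x i :=
        (h.memLp_grad.continuousLinearMap_comp
          (EuclideanSpace.proj i : Space d →L[ℝ] ℝ)).locallyIntegrable (by norm_num)
      exact hGi.integrable_smul_right_of_hasCompactSupport
        ((PiLp.continuous_apply 2 _ i).comp (hθ.continuous.smul hχ.continuous))
        (hχc.mono' fun x hx => subset_tsupport _ fun h0 => hx (by simp [h0]))
    have e1 : ∀ x, ⟪θ x • G x + u x • grad θ x, χ x⟫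
        = ⟪G x, θ x • χ x⟫ + u x * ⟪grad θ x, χ x⟫ := fun x => by
      simp only [inner_add_left, real_inner_smul_left, real_inner_smul_right]
    have e2 : ∀ x, u x * sdiv (fun y => θ y • χ y) x
        = u x * (θ x * sdiv χ x) + u x * ⟪grad θ x, χ x⟫ := fun x => by
      rw [sdiv_smul hθ hχ]; ring
    simp only [e1, e2] at key ⊢
    rw [integral_add i3 i2, key, integral_add i1 i2]
    simp only [mul_left_comm, mul_assoc]
    ring

/-- The field `y ↦ k(x - y) e_i` is an admissible test field. Differentiating it in `y` changes the
sign of the derivative of `k`, which cancels the sign of the integration by parts. -/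
theorem HasWeakGrad.grad_convolution {u : Space d → ℝ} {G : Space d → Space d}
    (h : HasWeakGrad u G) {k : Space d → ℝ} (hk : ContDiff ℝ ∞ k) (hc : HasCompactSupport k) :
    grad (k ⋆[ContinuousLinearMap.lsmul ℝ ℝ, volume] u)
      = k ⋆[ContinuousLinearMap.lsmul ℝ ℝ, volume] G := by
  have hl := h.memLp.locallyIntegrable (by norm_num)
  have hlG := h.memLp_grad.locallyIntegrable (by norm_num)
  funext x
  ext i
  have hd := hc.hasFDerivAt_convolution_left (ContinuousLinearMap.lsmul ℝ ℝ)
    (hk.of_le (by simp)) hl x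
  have hfd : HasCompactSupport (fderiv ℝ k) := hc.fderiv ℝ
  have hex := hfd.convolutionExists_left
    ((ContinuousLinearMap.lsmul ℝ ℝ : ℝ →L[ℝ] ℝ →L[ℝ] ℝ).precompL (Space d))
    (hk.continuous_fderiv (by simp)) hl x
  have hexG := hc.convolutionExists_left (ContinuousLinearMap.lsmul ℝ ℝ)
    hk.continuous hlG x
  have lhs : grad (k ⋆[ContinuousLinearMap.lsmul ℝ ℝ, volume] u) x i
      = ∫ y, u y * fderiv ℝ k (x - y) (EuclideanSpace.single i 1) := by
    simp only [grad, hd.fderiv]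
    rw [convolution_def, ContinuousLinearMap.integral_apply hex]
    rw [← integral_sub_left_eq_self _ _ x]
    refine integral_congr_ae (ae_of_all _ fun t => ?_)
    simp [ContinuousLinearMap.precompL_apply, mul_comm]
  have rhs : (k ⋆[ContinuousLinearMap.lsmul ℝ ℝ, volume] G) x i = ∫ y, k (x - y) * G y i := by
    rw [convolution_def]
    have := (EuclideanSpace.proj i : Space d →L[ℝ] ℝ).integral_comp_comm hexG
    refine this.symm.trans ?_
    rw [← integral_sub_left_eq_self _ _ x]
    refine integral_congr_ae (ae_of_all _ fun t => ?_)
    simp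
  have hkx : ContDiff ℝ ∞ fun y => k (x - y) := hk.comp (contDiff_const.sub contDiff_id)
  have hkc : HasCompactSupport fun y => k (x - y) :=
    hc.comp_homeomorph (Homeomorph.subLeft x)
  have key := h.integral_eq (fun y => k (x - y) • (EuclideanSpace.single i 1 : Space d))
    (hkx.smul contDiff_const) hkc.smul_right
  simp only [sdiv_smul_const hkx] at key
  have hder : ∀ y, fderiv ℝ (fun y => k (x - y)) y (EuclideanSpace.single i 1)
      = -fderiv ℝ k (x - y) (EuclideanSpace.single i 1) := fun y => by
    have := ((hk.differentiable (by simp)) (x - y)).hasFDerivAt.comp y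
      ((hasFDerivAt_const x y).sub (hasFDerivAt_id y))
    have h' : HasFDerivAt (fun y => k (x - y)) _ y := this
    rw [h'.fderiv]
    simp
  simp only [hder, real_inner_smul_right, mul_neg, integral_neg, neg_neg,
    EuclideanSpace.inner_single_right] at key
  rw [lhs, rhs, ← key]
  simp

end

/-! ### Density of test functions in Lipschitz domains -/

section

open scoped Pointwise

variable {d : ℕ}

/-- `S ∩ closure Ω` can be pushed into `Ω` by arbitrarily small balls of shifts. -/
def ShrinksInto (S Ω : Set (Space d)) : Prop :=
  ∃ (c : ℕ → Space d) (δ : ℕ → ℝ), (∀ n, 0 < δ n) ∧ Tendsto c atTop (𝓝 0) ∧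
    Tendsto δ atTop (𝓝 0) ∧
    ∀ n, ∀ y ∈ closure Ω ∩ S, ∀ s ∈ Metric.closedBall (c n) (δ n), s + y ∈ Ω

/-- `(u, G)` is an `L²` limit of pairs `(ψ, ∇ψ)` with `ψ ∈ C_c^∞(Ω)`. -/
def IsTestLimit (Ω : Set (Space d)) (u : Space d → ℝ) (G : Space d → Space d) : Prop :=
  ∃ ψ : ℕ → Space d → ℝ, (∀ n, ContDiff ℝ ∞ (ψ n) ∧ HasCompactSupport (ψ n) ∧ tsupport (ψ n) ⊆ Ω) ∧
    Tendsto (fun n => eLpNorm (ψ n - u) 2 volume) atTop (𝓝 0) ∧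
    Tendsto (fun n => eLpNorm (grad (ψ n) - G) 2 volume) atTop (𝓝 0)

theorem grad_add {φ ψ : Space d → ℝ} (hφ : ContDiff ℝ ∞ φ) (hψ : ContDiff ℝ ∞ ψ) :
    grad (φ + ψ) = grad φ + grad ψ := by
  funext x; ext i
  simp [grad, fderiv_add (hφ.differentiable (by simp) x) (hψ.differentiable (by simp) x)]

theorem IsTestLimit.zero (Ω : Set (Space d)) : IsTestLimit Ω 0 0 := by
  refine ⟨fun _ => 0, fun _ => ⟨contDiff_const, HasCompactSupport.zero, ?_⟩, ?_, ?_⟩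
  · simp
  · simp
  · have : grad (0 : Space d → ℝ) = 0 := by funext x; ext i; simp [grad]
    simp [this]

theorem IsTestLimit.add {Ω : Set (Space d)} {u u' : Space d → ℝ} {G G' : Space d → Space d}
    (hu : AEStronglyMeasurable u) (hG : AEStronglyMeasurable G)
    (hu' : AEStronglyMeasurable u') (hG' : AEStronglyMeasurable G')
    (h : IsTestLimit Ω u G) (h' : IsTestLimit Ω u' G') : IsTestLimit Ω (u + u') (G + G') := by
  obtain ⟨ψ, h1, h2, h3⟩ := h
  obtain ⟨ψ', h1', h2', h3'⟩ := h'
  have aux : ∀ {F : Type} [NormedAddCommGroup F] {f f' : ℕ → Space d → F} {g g' : Space d → F},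
      (∀ n, Continuous (f n)) → (∀ n, Continuous (f' n)) → AEStronglyMeasurable g →
      AEStronglyMeasurable g' → Tendsto (fun n => eLpNorm (f n - g) 2 volume) atTop (𝓝 0) →
      Tendsto (fun n => eLpNorm (f' n - g') 2 volume) atTop (𝓝 0) →
      Tendsto (fun n => eLpNorm (f n + f' n - (g + g')) 2 volume) atTop (𝓝 0) := by
    intro F _ f f' g g' hf hf' hg hg' ht ht'
    have := ht.add ht'
    rw [add_zero] at this
    refine tendsto_of_tendsto_of_tendsto_of_le_of_le tendsto_const_nhds this
      (fun _ => zero_le) fun n => ?_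
    simp only
    rw [add_sub_add_comm]
    exact eLpNorm_add_le ((hf n).aestronglyMeasurable.sub hg)
      ((hf' n).aestronglyMeasurable.sub hg') (by norm_num)
  refine ⟨fun n => ψ n + ψ' n, fun n => ⟨(h1 n).1.add (h1' n).1, (h1 n).2.1.add (h1' n).2.1,
    (tsupport_add _ _).trans (union_subset (h1 n).2.2 (h1' n).2.2)⟩,
    aux (fun n => (h1 n).1.continuous) (fun n => (h1' n).1.continuous) hu hu' h2 h2', ?_⟩
  simp only [grad_add (h1 _).1 (h1' _).1]
  exact aux (fun n => continuous_grad (h1 n).1) (fun n => continuous_grad (h1' n).1) hG hG' h3 h3'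

/-- Mollifying with a kernel supported in the ball of admissible shifts translates and smooths at
once: the support of the result lies in the sum of that ball and the support of `u`, a compact
subset of `Ω`. -/
theorem HasWeakGrad.isTestLimit_of_shrinksInto {Ω S : Set (Space d)} {u : Space d → ℝ}
    {G : Space d → Space d} (h : HasWeakGrad u G) (hΩ : Bornology.IsBounded Ω) (hS : IsClosed S)
    (hSΩ : ShrinksInto S Ω) (hu : ∀ x, x ∉ closure Ω ∩ S → u x = 0) : IsTestLimit Ω u G := by
  obtain ⟨c, δ, hδ, hc, hδ0, hin⟩ := hSΩ
  choose k hk hks hksupp using fun n => exists_isMollifier (volume : Measure (Space d)) (c n) (hδ n)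
  have hC : IsCompact (closure Ω ∩ S) := (hΩ.isCompact_closure).inter_right hS
  have hsub : ∀ n, Metric.closedBall (c n) (δ n) + closure Ω ∩ S ⊆ Ω := by
    rintro n _ ⟨s, hs, y, hy, rfl⟩
    exact hin n y hy s hs
  have hcpt : ∀ n, IsCompact (Metric.closedBall (c n) (δ n) + closure Ω ∩ S) := fun n =>
    (isCompact_closedBall _ _).add hC
  have hsupp : ∀ n, tsupport (k n ⋆[ContinuousLinearMap.lsmul ℝ ℝ, volume] u)
      ⊆ Metric.closedBall (c n) (δ n) + closure Ω ∩ S := fun n =>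
    closure_minimal ((support_convolution_subset _).trans
      (add_subset_add (hksupp n) fun x hx => by_contra fun h0 => hx (hu x h0))) (hcpt n).isClosed
  have hr : Tendsto (fun n => ‖c n‖ + δ n + 1 / ((n : ℝ) + 1)) atTop (𝓝 0) := by
    simpa using (hc.norm.add hδ0).add tendsto_one_div_add_atTop_nhds_zero_nat
  have hkr : ∀ n, Function.support (k n) ⊆ Metric.ball 0 (‖c n‖ + δ n + 1 / ((n : ℝ) + 1)) :=
    fun n x hx => by
      have h1 := hksupp n hx
      rw [mem_closedBall_iff_norm] at h1
      rw [mem_ball_zero_iff]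
      have h2 : ‖x‖ ≤ ‖x - c n‖ + ‖c n‖ := by simpa using norm_add_le (x - c n) (c n)
      have h3 : 0 < 1 / ((n : ℝ) + 1) := by positivity
      linarith
  refine ⟨fun n => k n ⋆[ContinuousLinearMap.lsmul ℝ ℝ, volume] u, fun n => ⟨?_, ?_, ?_⟩,
    tendsto_eLpNorm_convolution_sub hk hr hkr h.memLp, ?_⟩
  · exact (hk n).hasCompactSupport.contDiff_convolution_left _ (hks n)
      (h.memLp.locallyIntegrable (by norm_num))
  · exact (hcpt n).of_isClosed_subset (isClosed_tsupport _) (hsupp n)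
  · exact (hsupp n).trans (hsub n)
  · simp only [h.grad_convolution (hks _) (hk _).hasCompactSupport]
    exact tendsto_eLpNorm_convolution_sub hk hr hkr h.memLp_grad

theorem shrinksInto_of_closedBall_subset {Ω : Set (Space d)} {x : Space d} {r : ℝ} (hr : 0 < r)
    (h : Metric.ball x r ⊆ Ω) : ShrinksInto (Metric.closedBall x (r / 2)) Ω := by
  refine ⟨fun _ => 0, fun n => r / 4 * (1 / ((n : ℝ) + 1)), fun n => by positivity,
    tendsto_const_nhds, ?_, ?_⟩
  · simpa using tendsto_one_div_add_atTop_nhds_zero_nat.const_mul (r / 4)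
  · rintro n y ⟨-, hy⟩ s hs
    apply h
    rw [mem_closedBall_iff_norm] at hy hs
    rw [mem_ball_iff_norm]
    have h1 : 1 / ((n : ℝ) + 1) ≤ 1 := by
      rw [div_le_one (by positivity)]; linarith [(Nat.cast_nonneg n : (0 : ℝ) ≤ n)]
    have h2 : ‖s + y - x‖ ≤ ‖s - 0‖ + ‖y - x‖ := by
      rw [sub_zero, add_sub_assoc]; exact norm_add_le _ _
    nlinarith

/-- A shift by `ε e` raises the height above the graph by `ε` without moving the horizontal
projection. A perturbation of size `δ` changes the height by at most `δ` and the projection by at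
most `2δ`, hence `g` by at most `2Lδ`. The point stays strictly above the graph if `2Lδ + δ < ε`. -/
theorem shrinksInto_of_epigraph {Ω : Set (Space d)} {x e : Space d} {r : ℝ} {L : NNReal}
    {g : Space d → ℝ} (he : ‖e‖ = 1) (hr : 0 < r) (hg : LipschitzWith L g)
    (h : ∀ y ∈ Metric.ball x r, y ∈ Ω ↔ g (y - ⟪e, y⟫ • e) < ⟪e, y⟫) :
    ShrinksInto (Metric.closedBall x (r / 2)) Ω := by
  -- The total shift is at most `2ε ≤ 2r/5`, so points within `r/2` of `x` stay in the ball of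
  -- radius `r` on which the graph description is valid.
  set ε : ℕ → ℝ := fun n => r / 5 * (1 / ((n : ℝ) + 1)) with hε
  have hε0 : ∀ n, 0 < ε n := fun n => by positivity
  have hεr : ∀ n, ε n ≤ r / 5 := fun n => by
    have h1 : 1 / ((n : ℝ) + 1) ≤ 1 := by
      rw [div_le_one (by positivity)]; linarith [(Nat.cast_nonneg n : (0 : ℝ) ≤ n)]
    simp only [hε]; nlinarith
  have hεt : Tendsto ε atTop (𝓝 0) := by
    simpa [hε] using tendsto_one_div_add_atTop_nhds_zero_nat.const_mul (r / 5)
  have hee : ⟪e, e⟫ = (1 : ℝ) := by rw [real_inner_self_eq_norm_sq, he]; norm_num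
  have hL : (0 : ℝ) < 2 * L + 2 := by positivity
  -- This `δ` satisfies `2Lδ + 2δ = ε`, which leaves a margin `δ` for the strict inequality.
  refine ⟨fun n => ε n • e, fun n => ε n / (2 * L + 2), fun n => div_pos (hε0 n) hL, ?_, ?_, ?_⟩
  · simpa using hεt.smul_const e
  · simpa using hεt.div_const (2 * (L : ℝ) + 2)
  rintro n y ⟨hyΩ, hy⟩ s hs
  rw [mem_closedBall_iff_norm] at hy hs
  set δ := ε n / (2 * L + 2) with hδ
  have hδε : (2 * L + 2) * δ = ε n := by rw [hδ]; field_simp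
  have hδ0 : 0 < δ := div_pos (hε0 n) hL
  -- Points of the closure lie on or above the graph, so the inequality is not strict here.
  have hcl : g (y - ⟪e, y⟫ • e) ≤ ⟪e, y⟫ := by
    have hcont : Continuous fun y : Space d => g (y - ⟪e, y⟫ • e) :=
      hg.continuous.comp (by fun_prop)
    have hyb : y ∈ Metric.ball x r := by rw [mem_ball_iff_norm]; linarith
    have h1 : closure (Metric.ball x r ∩ Ω) ⊆ {y | g (y - ⟪e, y⟫ • e) ≤ ⟪e, y⟫} :=
      closure_minimal (fun z hz => ((h z hz.1).1 hz.2).le)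
        (isClosed_le hcont (continuous_const.inner continuous_id))
    exact h1 (Metric.isOpen_ball.inter_closure ⟨hyb, hyΩ⟩)
  set σ := s - ε n • e with hσ
  have hs' : s = ε n • e + σ := by rw [hσ]; abel
  have hin : |⟪e, σ⟫| ≤ δ := (abs_real_inner_le_norm e σ).trans (by rw [he, one_mul]; exact hs)
  have hes : ⟪e, s + y⟫ = ⟪e, y⟫ + ε n + ⟪e, σ⟫ := by
    rw [hs', inner_add_right, inner_add_right, real_inner_smul_right, hee]; ring
  have hball : s + y ∈ Metric.ball x r := by
    rw [mem_ball_iff_norm]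
    have h1 : ‖s + y - x‖ ≤ ‖s‖ + ‖y - x‖ := by
      rw [add_sub_assoc]; exact norm_add_le _ _
    have h2 : ‖s‖ ≤ ε n + δ := by
      rw [hs']
      refine (norm_add_le _ _).trans (add_le_add ?_ hs)
      rw [norm_smul, he, mul_one, Real.norm_of_nonneg (hε0 n).le]
    have h3 : δ ≤ ε n := by nlinarith [L.coe_nonneg]
    linarith [hεr n]
  rw [h _ hball]
  have hd : dist (s + y - ⟪e, s + y⟫ • e) (y - ⟪e, y⟫ • e) ≤ 2 * δ := by
    have : s + y - ⟪e, s + y⟫ • e - (y - ⟪e, y⟫ • e) = σ - ⟪e, σ⟫ • e := by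
      rw [hes, hs']; module
    rw [dist_eq_norm, this]
    refine (norm_sub_le _ _).trans ?_
    rw [norm_smul, he, mul_one, Real.norm_eq_abs]
    linarith
  have hgd := (hg.dist_le_mul (s + y - ⟪e, s + y⟫ • e) (y - ⟪e, y⟫ • e))
  rw [Real.dist_eq] at hgd
  have hgd' := (le_abs_self _).trans hgd
  have := abs_le.1 hin
  have hLd : (L : ℝ) * dist (s + y - ⟪e, s + y⟫ • e) (y - ⟪e, y⟫ • e) ≤ L * (2 * δ) := by gcongr
  have h4 : (2 * L + 2) * δ = L * (2 * δ) + 2 * δ := by ring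
  linarith

theorem IsBoundedLipschitzDomain.exists_shrinksInto {Ω : Set (Space d)}
    (hΩ : IsBoundedLipschitzDomain Ω) {x : Space d} (hx : x ∈ closure Ω) :
    ∃ r > 0, ShrinksInto (Metric.closedBall x r) Ω := by
  by_cases hxΩ : x ∈ Ω
  · obtain ⟨r, hr, h⟩ := Metric.isOpen_iff.1 hΩ.isOpen x hxΩ
    exact ⟨r / 2, half_pos hr, shrinksInto_of_closedBall_subset hr h⟩
  · have hf : x ∈ frontier Ω := by
      rw [hΩ.isOpen.frontier_eq]; exact ⟨hx, hxΩ⟩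
    obtain ⟨e, r, L, g, he, hr, hg, h⟩ := hΩ.lipschitz_boundary x hf
    exact ⟨r / 2, half_pos hr, shrinksInto_of_epigraph he hr hg h⟩

open scoped Manifold in
theorem IsBoundedLipschitzDomain.exists_partition {Ω : Set (Space d)}
    (hΩ : IsBoundedLipschitzDomain Ω) :
    ∃ (ι : Type) (_ : Fintype ι) (θ : ι → Space d → ℝ) (S : ι → Set (Space d)),
      (∀ i, IsClosed (S i) ∧ ShrinksInto (S i) Ω) ∧
      (∀ i, ContDiff ℝ ∞ (θ i) ∧ HasCompactSupport (θ i) ∧ tsupport (θ i) ⊆ S i) ∧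
      ∀ x ∈ Ω, ∑ i, θ i x = 1 := by
  choose! r hr hS using fun x (hx : x ∈ closure Ω) => hΩ.exists_shrinksInto hx
  obtain ⟨t, ht⟩ := hΩ.isBounded.isCompact_closure.elim_finite_subcover
    (fun x : closure Ω => Metric.ball (x : Space d) (r x)) (fun _ => Metric.isOpen_ball)
    fun x hx => mem_iUnion.2 ⟨⟨x, hx⟩, Metric.mem_ball_self (hr x hx)⟩
  obtain ⟨f, hf⟩ := SmoothPartitionOfUnity.exists_isSubordinate 𝓘(ℝ, Space d)
    (isClosed_closure (s := Ω)) (fun i : t => Metric.ball (i.1 : Space d) (r i.1))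
    (fun _ => Metric.isOpen_ball) (by simpa [iUnion_subtype] using ht)
  let e := t.equivFin
  refine ⟨Fin t.card, inferInstance, fun i => f (e.symm i),
    fun i => Metric.closedBall ((e.symm i).1 : Space d) (r (e.symm i).1), fun i =>
    ⟨Metric.isClosed_closedBall, hS _ (e.symm i).1.2⟩, fun i => ?_, fun x hx => ?_⟩
  · have hsub := (hf (e.symm i)).trans Metric.ball_subset_closedBall
    exact ⟨(f (e.symm i)).contMDiff.contDiff,
      (isCompact_closedBall _ _).of_isClosed_subset (isClosed_tsupport _) hsub, hsub⟩
  · have := f.sum_eq_one (subset_closure hx)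
    rw [finsum_eq_sum_of_fintype] at this
    rw [← this]
    exact e.symm.sum_comp fun i => f i x

theorem IsTestLimit.sum {ι : Type} (s : Finset ι) {Ω : Set (Space d)} {u : ι → Space d → ℝ}
    {G : ι → Space d → Space d} (hu : ∀ i, AEStronglyMeasurable (u i))
    (hG : ∀ i, AEStronglyMeasurable (G i)) (h : ∀ i, IsTestLimit Ω (u i) (G i)) :
    IsTestLimit Ω (∑ i ∈ s, u i) (∑ i ∈ s, G i) := by
  classical
  induction s using Finset.induction_on with
  | empty => simpa using IsTestLimit.zero Ω
  | insert a s ha ih =>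
    rw [Finset.sum_insert ha, Finset.sum_insert ha]
    exact (h a).add (hu a) (hG a) (Finset.aestronglyMeasurable_sum s fun i _ => hu i)
      (Finset.aestronglyMeasurable_sum s fun i _ => hG i) ih

/-- A function in `H¹(ℝ^d)` which vanishes off a bounded Lipschitz domain `Ω` is the limit of
functions in `C_c^∞(Ω)`. -/
theorem HasWeakGrad.isTestLimit {Ω : Set (Space d)} (hΩ : IsBoundedLipschitzDomain Ω)
    {u : Space d → ℝ} {G : Space d → Space d} (h : HasWeakGrad u G) (hu : ∀ x ∉ Ω, u x = 0)
    (hG : ∀ x ∉ Ω, G x = 0) : IsTestLimit Ω u G := by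
  obtain ⟨ι, _, θ, S, hS, hθ, hsum⟩ := hΩ.exists_partition
  have hw := fun i => h.smul (hθ i).1 (hθ i).2.1
  have key := IsTestLimit.sum Finset.univ (fun i => (hw i).memLp.1) (fun i => (hw i).memLp_grad.1)
    fun i => (hw i).isTestLimit_of_shrinksInto hΩ.isBounded (hS i).1 (hS i).2 fun x hx => by
      by_contra h0
      refine hx ⟨subset_closure (by_contra fun hxΩ => h0 (by simp [hu x hxΩ])),
        (hθ i).2.2 (subset_tsupport _ fun h1 => h0 (by simp [h1]))⟩
  -- The partition sums to one on the open set `Ω`, so its gradients cancel there and the terms `u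
  -- ∇θ_i` from the product rule disappear in the sum.
  have hgs : ∀ x ∈ Ω, ∑ i, grad (θ i) x = 0 := fun x hx => by
    have h1 : (fun y => ∑ i, θ i y) =ᶠ[𝓝 x] fun _ => 1 := by
      filter_upwards [hΩ.isOpen.mem_nhds hx] with y hy using hsum y hy
    have h2 := h1.fderiv_eq (𝕜 := ℝ)
    rw [fderiv_fun_sum fun i _ => (hθ i).1.differentiable (by simp) x] at h2
    ext j
    have h3 := congrArg (fun A : Space d →L[ℝ] ℝ => A (EuclideanSpace.single j 1)) h2
    simpa [grad] using h3
  convert key using 1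
  · funext x
    by_cases hx : x ∈ Ω
    · simp [← Finset.sum_mul, hsum x hx]
    · simp [hu x hx]
  · funext x
    by_cases hx : x ∈ Ω
    · simp [Finset.sum_add_distrib, ← Finset.sum_smul, hsum x hx, ← Finset.smul_sum, hgs x hx]
    · simp [hu x hx, hG x hx]

end

/-! ### Smooth evolutions -/

section

section Evolution

variable {H K : Type*} [NormedAddCommGroup H] [InnerProductSpace ℝ H] [CompleteSpace H]
  [NormedAddCommGroup K] [InnerProductSpace ℝ K] [CompleteSpace K]

/-- Lebesgue measure on `(0, T)`. -/
abbrev timeMeasure (T : ℝ) : Measure ℝ := volume.restrict (Ioo 0 T)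

theorem memLp_timeMeasure_of_continuous (T : ℝ) {f : ℝ → H} (hf : Continuous f) (p : ℝ≥0∞) :
    MemLp f p (timeMeasure T) := by
  obtain ⟨C, hC⟩ := (isCompact_Icc (a := (0 : ℝ)) (b := T)).exists_bound_of_continuousOn
    hf.continuousOn
  refine MemLp.of_bound hf.aestronglyMeasurable C ?_
  filter_upwards [ae_restrict_mem measurableSet_Ioo] with t ht using hC t (Ioo_subset_Icc_self ht)

/-- The class in `L²(0, T; H)` of a continuous function. -/
def toL2 (T : ℝ) (f : ℝ → H) (hf : Continuous f) : Lp H 2 (timeMeasure T) :=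
  (memLp_timeMeasure_of_continuous T hf 2).toLp f

theorem coeFn_toL2 (T : ℝ) {f : ℝ → H} (hf : Continuous f) : toL2 T f hf =ᵐ[timeMeasure T] f :=
  MemLp.coeFn_toLp _

theorem inner_toL2 (T : ℝ) {f g : ℝ → H} (hf : Continuous f) (hg : Continuous g) :
    ⟪toL2 T f hf, toL2 T g hg⟫ = ∫ t in Ioo 0 T, ⟪f t, g t⟫ := by
  rw [L2.inner_def]
  refine integral_congr_ae ?_
  filter_upwards [coeFn_toL2 T hf, coeFn_toL2 T hg] with t h1 h2
  rw [h1, h2]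

theorem norm_toL2_sq (T : ℝ) {f : ℝ → H} (hf : Continuous f) :
    ‖toL2 T f hf‖ ^ 2 = ∫ t in Ioo 0 T, ‖f t‖ ^ 2 := by
  rw [← real_inner_self_eq_norm_sq, inner_toL2]
  simp only [real_inner_self_eq_norm_sq]

theorem norm_toL2_norm (T : ℝ) {f : ℝ → H} (hf : Continuous f) :
    ‖toL2 T (fun t => ‖f t‖) hf.norm‖ = ‖toL2 T f hf‖ := by
  simp [toL2, Lp.norm_toLp, eLpNorm_norm]

theorem integral_norm_mul_norm_le (T : ℝ) {f : ℝ → H} {g : ℝ → K} (hf : Continuous f)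
    (hg : Continuous g) :
    ∫ t in Ioo 0 T, ‖f t‖ * ‖g t‖ ≤ ‖toL2 T f hf‖ * ‖toL2 T g hg‖ := by
  have h := real_inner_le_norm (toL2 T _ hf.norm) (toL2 T _ hg.norm)
  rw [norm_toL2_norm, norm_toL2_norm, inner_toL2] at h
  simpa [mul_comm] using h

theorem integrableOn_Ioo_of_continuous (T : ℝ) {f : ℝ → ℝ} (hf : Continuous f) :
    IntegrableOn f (Ioo 0 T) :=
  memLp_one_iff_integrable.1 (memLp_timeMeasure_of_continuous T hf 1)

/-- The end points may come in either order, so the majorant has to dominate the absolute value. -/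
theorem intervalIntegral_le_integral_Ioo {T s t : ℝ} (hs : s ∈ Icc 0 T) (ht : t ∈ Icc 0 T)
    {f g : ℝ → ℝ} (hf : Continuous f) (hg : Continuous g) (hfg : ∀ r, |f r| ≤ g r) :
    ∫ r in s..t, f r ≤ ∫ r in Ioo 0 T, g r := by
  refine (le_abs_self _).trans ?_
  rw [← Real.norm_eq_abs]
  refine (intervalIntegral.norm_integral_le_integral_norm_uIoc).trans ?_
  have hsub : Ioc (min s t) (max s t) ⊆ Ioc 0 T :=
    Ioc_subset_Ioc (le_min hs.1 ht.1) (max_le hs.2 ht.2)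
  have hgi : IntegrableOn g (Ioc 0 T) :=
    (hg.integrableOn_Icc).mono_set Ioc_subset_Icc_self
  calc ∫ r in uIoc s t, ‖f r‖ ≤ ∫ r in uIoc s t, g r :=
        setIntegral_mono ((hf.norm.integrableOn_Icc).mono_set Ioc_subset_Icc_self)
          ((hg.integrableOn_Icc).mono_set Ioc_subset_Icc_self) hfg
    _ ≤ ∫ r in Ioc 0 T, g r :=
        setIntegral_mono_set hgi (ae_of_all _ fun r => (abs_nonneg _).trans (hfg r))
          (LE.le.eventuallyLE hsub)
    _ = _ := integral_Ioc_eq_integral_Ioo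

/-- A classical solution on `[0, T]` of `v' = h + D'τ`, where `W` is the graph of an operator `D`,
`D'` is the negative adjoint in the sense that `⟪D'τ, w⟫ = ⟪τ, D w⟫`, and `G = D v`. -/
structure IsSmoothEvolution (T : ℝ) (W : Submodule ℝ (H × K)) (v h : ℝ → H) (G τ : ℝ → K) :
    Prop where
  contDiff : ContDiff ℝ 1 v
  continuous_h : Continuous h
  continuous_G : Continuous G
  continuous_τ : Continuous τ
  mem : ∀ t ∈ Icc 0 T, (v t, G t) ∈ W
  eq : ∀ t ∈ Icc 0 T, ∀ p ∈ W, ⟪deriv v t, p.1⟫ = ⟪h t, p.1⟫ + ⟪τ t, p.2⟫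

namespace IsSmoothEvolution

variable {T : ℝ} {W : Submodule ℝ (H × K)} {v h v₁ h₁ : ℝ → H} {G τ G₁ τ₁ : ℝ → K}

theorem hasDerivAt (S : IsSmoothEvolution T W v h G τ) (t : ℝ) : HasDerivAt v (deriv v t) t :=
  (S.contDiff.differentiable (by norm_num) t).hasDerivAt

theorem add (S : IsSmoothEvolution T W v h G τ) (S₁ : IsSmoothEvolution T W v₁ h₁ G₁ τ₁) :
    IsSmoothEvolution T W (v + v₁) (h + h₁) (G + G₁) (τ + τ₁) where
  contDiff := S.contDiff.add S₁.contDiff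
  continuous_h := S.continuous_h.add S₁.continuous_h
  continuous_G := S.continuous_G.add S₁.continuous_G
  continuous_τ := S.continuous_τ.add S₁.continuous_τ
  mem t ht := W.add_mem (S.mem t ht) (S₁.mem t ht)
  eq t ht p hp := by
    rw [((S.hasDerivAt t).add (S₁.hasDerivAt t)).deriv]
    simp only [Pi.add_apply, inner_add_left]
    linarith [S.eq t ht p hp, S₁.eq t ht p hp]

theorem sub (S : IsSmoothEvolution T W v h G τ) (S₁ : IsSmoothEvolution T W v₁ h₁ G₁ τ₁) :
    IsSmoothEvolution T W (v - v₁) (h - h₁) (G - G₁) (τ - τ₁) where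
  contDiff := S.contDiff.sub S₁.contDiff
  continuous_h := S.continuous_h.sub S₁.continuous_h
  continuous_G := S.continuous_G.sub S₁.continuous_G
  continuous_τ := S.continuous_τ.sub S₁.continuous_τ
  mem t ht := W.sub_mem (S.mem t ht) (S₁.mem t ht)
  eq t ht p hp := by
    rw [((S.hasDerivAt t).sub (S₁.hasDerivAt t)).deriv]
    simp only [Pi.sub_apply, inner_sub_left]
    linarith [S.eq t ht p hp, S₁.eq t ht p hp]

/-- The energy identity: `(v(r), G(r))` belongs to the graph, hence is an admissible test pair in
the equation at time `r`, and the derivative of `‖v‖²` is `2⟪v', v⟫`. -/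
theorem norm_sq_sub (S : IsSmoothEvolution T W v h G τ) {s t : ℝ} (hs : s ∈ Icc 0 T)
    (ht : t ∈ Icc 0 T) :
    ‖v t‖ ^ 2 - ‖v s‖ ^ 2 = ∫ r in s..t, (2 * ⟪h r, v r⟫ + 2 * ⟪τ r, G r⟫) := by
  have hc := S.contDiff.continuous
  refine (intervalIntegral.integral_eq_sub_of_hasDerivAt (f := fun r => ‖v r‖ ^ 2)
    (fun r hr => ?_) ?_).symm
  · have hr' : r ∈ Icc 0 T := (uIcc_subset_Icc hs ht) hr
    have := (S.hasDerivAt r).norm_sq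
    rw [real_inner_comm, S.eq r hr' _ (S.mem r hr'), mul_add] at this
    exact this
  · exact (((S.continuous_h.inner hc).const_mul 2).add
      ((S.continuous_τ.inner S.continuous_G).const_mul 2)).intervalIntegrable _ _

/-- By polarisation `4⟪τ, G⟫ = ‖τ + G‖² - ‖τ - G‖²`, so the flux term is controlled by `τ + G`
alone. That sum is the second component of `A`, and no separate bound on the gradient is needed. -/
theorem norm_sq_le (S : IsSmoothEvolution T W v h G τ) (hT : 0 ≤ T) {t : ℝ} (ht : t ∈ Icc 0 T) :
    ‖v t‖ ^ 2 ≤ ‖v 0‖ ^ 2 + 2 * (‖toL2 T h S.continuous_h‖ * ‖toL2 T v S.contDiff.continuous‖)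
      + 1 / 2 * ‖toL2 T τ S.continuous_τ + toL2 T G S.continuous_G‖ ^ 2 := by
  have hv := S.contDiff.continuous
  have e : toL2 T τ S.continuous_τ + toL2 T G S.continuous_G
      = toL2 T (τ + G) (S.continuous_τ.add S.continuous_G) := rfl
  have h0 : (0 : ℝ) ∈ Icc 0 T := ⟨le_rfl, hT⟩
  have c1 : Continuous fun r => 2 * ⟪h r, v r⟫ + 2 * ⟪τ r, G r⟫ :=
    ((S.continuous_h.inner hv).const_mul 2).add
      ((S.continuous_τ.inner S.continuous_G).const_mul 2)
  have c2 : Continuous fun r => 2 * (‖h r‖ * ‖v r‖) :=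
    (S.continuous_h.norm.mul hv.norm).const_mul 2
  have c3 : Continuous fun r => 1 / 2 * ‖(τ + G) r‖ ^ 2 :=
    ((S.continuous_τ.add S.continuous_G).norm.pow 2).const_mul _
  have c23 : Continuous fun r => 2 * (‖h r‖ * ‖v r‖) + 1 / 2 * ‖(τ + G) r‖ ^ 2 := c2.add c3
  have key := S.norm_sq_sub h0 ht
  have hle : ∫ r in (0 : ℝ)..t, (2 * ⟪h r, v r⟫ + 2 * ⟪τ r, G r⟫)
      ≤ ∫ r in (0 : ℝ)..t, (2 * (‖h r‖ * ‖v r‖) + 1 / 2 * ‖(τ + G) r‖ ^ 2) := by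
    refine intervalIntegral.integral_mono ht.1 (c1.intervalIntegrable _ _)
      (c23.intervalIntegrable _ _) fun r => ?_
    have h1 := real_inner_le_norm (h r) (v r)
    have h2 := norm_add_sq_real (τ r) (G r)
    have h3 := norm_sub_sq_real (τ r) (G r)
    have h4 := sq_nonneg ‖τ r - G r‖
    simp only [Pi.add_apply]
    linarith
  have hle2 := intervalIntegral_le_integral_Ioo h0 ht c23 c23
    fun r => (abs_of_nonneg (by positivity)).le
  rw [integral_add (integrableOn_Ioo_of_continuous T c2) (integrableOn_Ioo_of_continuous T c3),
    integral_const_mul, integral_const_mul] at hle2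
  have hcs := integral_norm_mul_norm_le T S.continuous_h hv
  rw [e, norm_toL2_sq]
  linarith

/-- Integrating the energy identity over the starting time `s ∈ (0, T)` removes the initial value,
so the supremum in time is bounded by `L²` norms only. Applied to differences, this turns `L²`
convergence into uniform convergence. -/
theorem norm_sq_sup_le (S : IsSmoothEvolution T W v h G τ) (hT : 0 ≤ T) {t : ℝ}
    (ht : t ∈ Icc 0 T) :
    T * ‖v t‖ ^ 2 ≤ ‖toL2 T v S.contDiff.continuous‖ ^ 2 +
      T * (2 * (‖toL2 T h S.continuous_h‖ * ‖toL2 T v S.contDiff.continuous‖) +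
        2 * (‖toL2 T τ S.continuous_τ‖ * ‖toL2 T G S.continuous_G‖)) := by
  have hv := S.contDiff.continuous
  set B := 2 * (‖toL2 T h S.continuous_h‖ * ‖toL2 T v S.contDiff.continuous‖) +
        2 * (‖toL2 T τ S.continuous_τ‖ * ‖toL2 T G S.continuous_G‖) with hB
  have c1 : Continuous fun r => 2 * ⟪h r, v r⟫ + 2 * ⟪τ r, G r⟫ :=
    ((S.continuous_h.inner hv).const_mul 2).add
      ((S.continuous_τ.inner S.continuous_G).const_mul 2)
  have c2 : Continuous fun r => 2 * (‖h r‖ * ‖v r‖) :=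
    (S.continuous_h.norm.mul hv.norm).const_mul 2
  have c3 : Continuous fun r => 2 * (‖τ r‖ * ‖G r‖) :=
    (S.continuous_τ.norm.mul S.continuous_G.norm).const_mul 2
  have c23 : Continuous fun r => 2 * (‖h r‖ * ‖v r‖) + 2 * (‖τ r‖ * ‖G r‖) := c2.add c3
  have c4 : Continuous fun r => ‖v r‖ ^ 2 := hv.norm.pow 2
  have c5 : Continuous fun r => ‖v r‖ ^ 2 + B := c4.add continuous_const
  have hp : ∀ s ∈ Ioo 0 T, ‖v t‖ ^ 2 ≤ ‖v s‖ ^ 2 + B := fun s hs => by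
    have key := S.norm_sq_sub (Ioo_subset_Icc_self hs) ht
    have hle := intervalIntegral_le_integral_Ioo (Ioo_subset_Icc_self hs) ht c1 c23
      fun r => by
        have h1 := abs_le.1 (abs_real_inner_le_norm (h r) (v r))
        have h2 := abs_le.1 (abs_real_inner_le_norm (τ r) (G r))
        exact abs_le.2 ⟨by linarith, by linarith⟩
    rw [integral_add (integrableOn_Ioo_of_continuous T c2) (integrableOn_Ioo_of_continuous T c3),
      integral_const_mul, integral_const_mul] at hle
    have hcs := integral_norm_mul_norm_le T S.continuous_h hv
    have hcs' := integral_norm_mul_norm_le T S.continuous_τ S.continuous_G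
    linarith
  have hi := setIntegral_mono_on (integrableOn_Ioo_of_continuous T
    (continuous_const (y := ‖v t‖ ^ 2))) (integrableOn_Ioo_of_continuous T c5)
    measurableSet_Ioo hp
  rw [integral_add (integrableOn_Ioo_of_continuous T c4)
    (integrableOn_Ioo_of_continuous T continuous_const), ← norm_toL2_sq T hv] at hi
  simpa [hT] using hi

/-- The fundamental theorem of calculus for `η(t) ⟪v(t), p.1⟫`. The function `η` is free at both
ends, so the identity sees the values at `0` and at `T`. -/
theorem integral_deriv_mul (S : IsSmoothEvolution T W v h G τ) (hT : 0 ≤ T) {η : ℝ → ℝ}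
    (hη : ContDiff ℝ 1 η) {p : H × K} (hp : p ∈ W) :
    η T * ⟪v T, p.1⟫ - η 0 * ⟪v 0, p.1⟫
      = ⟪toL2 T v S.contDiff.continuous,
          toL2 T (fun t => deriv η t • p.1) ((hη.continuous_deriv le_rfl).smul continuous_const)⟫
        + ⟪toL2 T h S.continuous_h,
          toL2 T (fun t => η t • p.1) (hη.continuous.smul continuous_const)⟫
        + ⟪toL2 T τ S.continuous_τ,
          toL2 T (fun t => η t • p.2) (hη.continuous.smul continuous_const)⟫ := by
  have hv := S.contDiff.continuous
  have c1 : Continuous fun t => ⟪v t, deriv η t • p.1⟫ :=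
    hv.inner ((hη.continuous_deriv le_rfl).smul continuous_const)
  have c2 : Continuous fun t => ⟪h t, η t • p.1⟫ :=
    S.continuous_h.inner (hη.continuous.smul continuous_const)
  have c3 : Continuous fun t => ⟪τ t, η t • p.2⟫ :=
    S.continuous_τ.inner (hη.continuous.smul continuous_const)
  have c12 : Continuous fun t => ⟪v t, deriv η t • p.1⟫ + ⟪h t, η t • p.1⟫ := c1.add c2
  rw [inner_toL2, inner_toL2, inner_toL2,
    ← integral_add (integrableOn_Ioo_of_continuous T c1) (integrableOn_Ioo_of_continuous T c2),
    ← integral_add (integrableOn_Ioo_of_continuous T c12)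
      (integrableOn_Ioo_of_continuous T c3), ← integral_Ioc_eq_integral_Ioo,
    ← intervalIntegral.integral_of_le hT]
  refine (intervalIntegral.integral_eq_sub_of_hasDerivAt (f := fun t => η t * ⟪v t, p.1⟫)
    (fun t ht => ?_) ((c12.add c3).intervalIntegrable _ _)).symm
  rw [uIcc_of_le hT] at ht
  have h1 := ((hη.differentiable (by norm_num) t).hasDerivAt).mul
    ((S.hasDerivAt t).inner ℝ (hasDerivAt_const t p.1))
  rw [inner_zero_right, zero_add, S.eq t ht p hp] at h1
  refine h1.congr_deriv ?_
  simp only [real_inner_smul_right, Pi.add_apply]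
  ring

end IsSmoothEvolution
end Evolution

end

/-! ### Limits of smooth evolutions -/

section

section Evolution

variable {H K : Type*} [NormedAddCommGroup H] [InnerProductSpace ℝ H] [CompleteSpace H]
  [NormedAddCommGroup K] [InnerProductSpace ℝ K] [CompleteSpace K]

/-- A limit of classical solutions in `L²(0, T)`. -/
def IsEvolutionLimit (T : ℝ) (W : Submodule ℝ (H × K)) (v h : Lp H 2 (timeMeasure T))
    (G τ : Lp K 2 (timeMeasure T)) : Prop :=
  ∃ (vn hn : ℕ → ℝ → H) (Gn τn : ℕ → ℝ → K)
    (S : ∀ n, IsSmoothEvolution T W (vn n) (hn n) (Gn n) (τn n)),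
    Tendsto (fun n => toL2 T (vn n) (S n).contDiff.continuous) atTop (𝓝 v) ∧
    Tendsto (fun n => toL2 T (hn n) (S n).continuous_h) atTop (𝓝 h) ∧
    Tendsto (fun n => toL2 T (Gn n) (S n).continuous_G) atTop (𝓝 G) ∧
    Tendsto (fun n => toL2 T (τn n) (S n).continuous_τ) atTop (𝓝 τ)

theorem IsEvolutionLimit.add {T : ℝ} {W : Submodule ℝ (H × K)} {v h v' h' : Lp H 2 (timeMeasure T)}
    {G τ G' τ' : Lp K 2 (timeMeasure T)} (A : IsEvolutionLimit T W v h G τ)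
    (B : IsEvolutionLimit T W v' h' G' τ') :
    IsEvolutionLimit T W (v + v') (h + h') (G + G') (τ + τ') := by
  obtain ⟨vn, hn, Gn, τn, S, t1, t2, t3, t4⟩ := A
  obtain ⟨vn', hn', Gn', τn', S', t1', t2', t3', t4'⟩ := B
  exact ⟨_, _, _, _, fun n => (S n).add (S' n), t1.add t1', t2.add t2', t3.add t3', t4.add t4'⟩

/-- Limits of classical solutions have a continuous representative which satisfies the energy
identity and the equation in its integrated form. -/
theorem IsEvolutionLimit.exists_continuous {T : ℝ} (hT : 0 < T) {W : Submodule ℝ (H × K)}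
    {v h : Lp H 2 (timeMeasure T)} {G τ : Lp K 2 (timeMeasure T)}
    (A : IsEvolutionLimit T W v h G τ) :
    ∃ V : ℝ → H, ContinuousOn V (Icc 0 T) ∧ (∀ᵐ t ∂(timeMeasure T), V t = v t) ∧
      (∀ t ∈ Icc 0 T, ‖V t‖ ^ 2 ≤ ‖V 0‖ ^ 2 + 2 * (‖h‖ * ‖v‖) + 1 / 2 * ‖τ + G‖ ^ 2) ∧
      (‖V T‖ ^ 2 - ‖V 0‖ ^ 2 = 2 * ⟪h, v⟫ + 2 * ⟪τ, G⟫) ∧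
      ∀ (η : ℝ → ℝ) (hη : ContDiff ℝ 1 η), ∀ p ∈ W,
        η T * ⟪V T, p.1⟫ - η 0 * ⟪V 0, p.1⟫
          = ⟪v, toL2 T (fun t => deriv η t • p.1)
              ((hη.continuous_deriv le_rfl).smul continuous_const)⟫
            + ⟪h, toL2 T (fun t => η t • p.1) (hη.continuous.smul continuous_const)⟫
            + ⟪τ, toL2 T (fun t => η t • p.2) (hη.continuous.smul continuous_const)⟫ := by
  obtain ⟨vn, hn, Gn, τn, S, t1, t2, t3, t4⟩ := A
  have h0 : (0 : ℝ) ∈ Icc 0 T := ⟨le_rfl, hT.le⟩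
  have hTT : T ∈ Icc 0 T := ⟨hT.le, le_rfl⟩
  -- The difference of two members of the sequence is again a smooth evolution, so `norm_sq_sup_le`
  -- bounds it uniformly by quantities that tend to zero.
  have hcau : UniformCauchySeqOn vn atTop (Icc 0 T) := by
    have hz : Tendsto (fun p : ℕ × ℕ =>
        ‖toL2 T (vn p.1) (S p.1).contDiff.continuous
            - toL2 T (vn p.2) (S p.2).contDiff.continuous‖ ^ 2 +
        T * (2 * (‖toL2 T (hn p.1) (S p.1).continuous_h - toL2 T (hn p.2) (S p.2).continuous_h‖ *
          ‖toL2 T (vn p.1) (S p.1).contDiff.continuous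
            - toL2 T (vn p.2) (S p.2).contDiff.continuous‖) +
        2 * (‖toL2 T (τn p.1) (S p.1).continuous_τ - toL2 T (τn p.2) (S p.2).continuous_τ‖ *
          ‖toL2 T (Gn p.1) (S p.1).continuous_G - toL2 T (Gn p.2) (S p.2).continuous_G‖)))
        (atTop ×ˢ atTop) (𝓝 0) := by
      have d1 := ((t1.comp tendsto_fst).sub (t1.comp tendsto_snd) : Tendsto _ (atTop ×ˢ atTop) _).norm
      have d2 := ((t2.comp tendsto_fst).sub (t2.comp tendsto_snd) : Tendsto _ (atTop ×ˢ atTop) _).norm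
      have d3 := ((t3.comp tendsto_fst).sub (t3.comp tendsto_snd) : Tendsto _ (atTop ×ˢ atTop) _).norm
      have d4 := ((t4.comp tendsto_fst).sub (t4.comp tendsto_snd) : Tendsto _ (atTop ×ˢ atTop) _).norm
      simp only [sub_self, norm_zero] at d1 d2 d3 d4
      have := (d1.pow 2).add
        ((((d2.mul d1).const_mul 2).add ((d4.mul d3).const_mul 2)).const_mul T)
      simpa using this
    rw [Metric.uniformCauchySeqOn_iff]
    intro ε hε
    have hev := hz.eventually_lt_const (show (0 : ℝ) < T * ε ^ 2 by positivity)
    rw [prod_atTop_atTop_eq, eventually_atTop] at hev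
    obtain ⟨⟨N, M⟩, hN⟩ := hev
    refine ⟨max N M, fun m hm n hn t ht => ?_⟩
    have h1 := hN (m, n) ⟨(le_max_left _ _).trans hm, (le_max_right _ _).trans hn⟩
    have h2 := ((S m).sub (S n)).norm_sq_sup_le hT.le ht
    have h3 : T * ‖(vn m - vn n) t‖ ^ 2 < T * ε ^ 2 := h2.trans_lt h1
    rw [dist_eq_norm]
    exact lt_of_pow_lt_pow_left₀ 2 hε.le (lt_of_mul_lt_mul_left h3 hT.le)
  choose! V hV using fun t (ht : t ∈ Icc 0 T) => cauchySeq_tendsto_of_complete (hcau.cauchySeq ht)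
  have hunif : TendstoUniformlyOn vn V atTop (Icc 0 T) := hcau.tendstoUniformlyOn_of_tendsto hV
  refine ⟨V, ?_, ?_, ?_, ?_, ?_⟩
  · exact hunif.continuousOn (Frequently.of_forall fun n => (S n).contDiff.continuous.continuousOn)
  -- A subsequence converges almost everywhere to `v`, which identifies the uniform limit with `v`.
  · have m1 : TendstoInMeasure (timeMeasure T)
        (fun n => (toL2 T (vn n) (S n).contDiff.continuous : ℝ → H)) atTop v :=
      tendstoInMeasure_of_tendsto_Lp t1
    obtain ⟨ns, hns, hae⟩ := m1.exists_seq_tendsto_ae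
    have hall : ∀ᵐ t ∂(timeMeasure T), ∀ n, toL2 T (vn n) (S n).contDiff.continuous t = vn n t :=
      ae_all_iff.2 fun n => coeFn_toL2 T _
    filter_upwards [hae, hall, ae_restrict_mem measurableSet_Ioo] with t h1 h2 h3
    simp only [h2] at h1
    exact tendsto_nhds_unique ((hV t (Ioo_subset_Icc_self h3)).comp hns.tendsto_atTop) h1
  · intro t ht
    refine le_of_tendsto_of_tendsto' ((hV t ht).norm.pow 2) ?_ fun n => (S n).norm_sq_le hT.le ht
    exact ((((hV 0 h0).norm.pow 2).add ((t2.norm.mul t1.norm).const_mul 2)).add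
      (((t4.add t3).norm.pow 2).const_mul (1 / 2)))
  · refine tendsto_nhds_unique (((hV T hTT).norm.pow 2).sub ((hV 0 h0).norm.pow 2)) ?_
    refine (((t2.inner t1).const_mul 2).add ((t4.inner t3).const_mul 2)).congr fun n => ?_
    have hv := (S n).contDiff.continuous
    rw [(S n).norm_sq_sub h0 hTT, intervalIntegral.integral_of_le hT.le,
      integral_Ioc_eq_integral_Ioo, integral_add, integral_const_mul, integral_const_mul,
      ← inner_toL2 T (S n).continuous_h hv, ← inner_toL2 T (S n).continuous_τ (S n).continuous_G]
    · exact integrableOn_Ioo_of_continuous T (((S n).continuous_h.inner hv).const_mul 2)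
    · exact integrableOn_Ioo_of_continuous T
        (((S n).continuous_τ.inner (S n).continuous_G).const_mul 2)
  · intro η hη p hp
    have e := fun n => (S n).integral_deriv_mul hT.le hη hp
    refine tendsto_nhds_unique ((((hV T hTT).inner tendsto_const_nhds).const_mul _).sub
      (((hV 0 h0).inner tendsto_const_nhds).const_mul _)) ?_
    refine Tendsto.congr (fun n => (e n).symm) ?_
    exact ((t1.inner tendsto_const_nhds).add (t2.inner tendsto_const_nhds)).add
      (t4.inner tendsto_const_nhds)

/-- A weak solution on `(0, T)` of `v' = h + D'τ` with `G = D v`, where `W` is the graph of `D`. -/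
structure IsWeakEvolution (T : ℝ) (W : Submodule ℝ (H × K)) (v h : Lp H 2 (timeMeasure T))
    (G τ : Lp K 2 (timeMeasure T)) : Prop where
  mem : ∀ η : ℝ → ℝ, ContDiff ℝ ∞ η → (∫ t in Ioo 0 T, η t • v t, ∫ t in Ioo 0 T, η t • G t) ∈ W
  eq : ∀ p ∈ W, ∀ η : ℝ → ℝ, ContDiff ℝ ∞ η → HasCompactSupport η → tsupport η ⊆ Ioo 0 T →
    ∫ t in Ioo 0 T, (deriv η t * ⟪v t, p.1⟫ + η t * (⟪h t, p.1⟫ + ⟪τ t, p.2⟫)) = 0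

end Evolution

end

/-! ### Weak evolutions -/

section

section Evolution

variable {H K : Type*} [NormedAddCommGroup H] [InnerProductSpace ℝ H] [CompleteSpace H]
  [NormedAddCommGroup K] [InnerProductSpace ℝ K] [CompleteSpace K]

theorem memLp_continuous_smul {T : ℝ} {θ : ℝ → ℝ} (hθ : Continuous θ) {f : ℝ → H}
    (hf : MemLp f 2 (timeMeasure T)) : MemLp (fun t => θ t • f t) 2 (timeMeasure T) := by
  obtain ⟨C, hC⟩ := (isCompact_Icc (a := (0 : ℝ)) (b := T)).exists_bound_of_continuousOn
    hθ.continuousOn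
  refine hf.of_le_mul (c := C) (hθ.aestronglyMeasurable.smul hf.1) ?_
  filter_upwards [ae_restrict_mem measurableSet_Ioo] with t ht
  rw [norm_smul]
  exact mul_le_mul_of_nonneg_right (hC t (Ioo_subset_Icc_self ht)) (norm_nonneg _)

theorem integrableOn_continuous_smul {T : ℝ} {θ : ℝ → ℝ} (hθ : Continuous θ) {f : ℝ → H}
    (hf : MemLp f 2 (timeMeasure T)) : IntegrableOn (fun t => θ t • f t) (Ioo 0 T) :=
  (memLp_continuous_smul hθ hf).integrable (by norm_num)

theorem inner_integral_left {α : Type*} [MeasurableSpace α] {μ : Measure α} {f : α → H}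
    (hf : Integrable f μ) (c : H) : ⟪∫ x, f x ∂μ, c⟫ = ∫ x, ⟪f x, c⟫ ∂μ := by
  rw [real_inner_comm, ← integral_inner hf]
  simp only [real_inner_comm]

theorem convolution_indicator_eq {S : Set ℝ} (hS : MeasurableSet S) (k : ℝ → ℝ) (f : ℝ → H)
    (t : ℝ) : (k ⋆[ContinuousLinearMap.lsmul ℝ ℝ, volume] S.indicator f) t
      = ∫ s in S, k (t - s) • f s := by
  rw [convolution_eq_swap, ← integral_indicator hS]
  refine integral_congr_ae (ae_of_all _ fun s => ?_)
  by_cases hs : s ∈ S <;> simp [hs]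

theorem tendsto_toL2_convolution {T : ℝ} {k : ℕ → ℝ → ℝ} (hk : ∀ n, IsMollifier volume (k n))
    {r : ℕ → ℝ} (hr : Tendsto r atTop (𝓝 0))
    (hkr : ∀ n, Function.support (k n) ⊆ Metric.ball 0 (r n)) {f : ℝ → H}
    (hf : MemLp f 2 (timeMeasure T)) {f₁ : Lp H 2 (timeMeasure T)} (hf₁ : f₁ =ᵐ[timeMeasure T] f)
    (hc : ∀ n, Continuous
      (k n ⋆[ContinuousLinearMap.lsmul ℝ ℝ, volume] (Ioo 0 T).indicator f)) :
    Tendsto (fun n => toL2 T _ (hc n)) atTop (𝓝 f₁) := by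
  have hi : MemLp ((Ioo 0 T).indicator f) 2 := (memLp_indicator_iff_restrict measurableSet_Ioo).2 hf
  rw [Lp.tendsto_Lp_iff_tendsto_eLpNorm']
  refine tendsto_of_tendsto_of_tendsto_of_le_of_le tendsto_const_nhds
    (tendsto_eLpNorm_convolution_sub hk hr hkr hi) (fun _ => zero_le) fun n => ?_
  refine (eLpNorm_congr_ae ?_).trans_le (eLpNorm_mono_measure _ Measure.restrict_le_self)
  filter_upwards [coeFn_toL2 T (hc n), hf₁, ae_restrict_mem measurableSet_Ioo] with t h1 h2 h3
  simp [h1, h2, h3]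

/-- The cut-off function `θ v` solves the same equation with source `θ h + θ' v`. Its mollification
at time `t` is an average of `v` with weight `s ↦ k(t - s) θ(s)`: the graph condition holds for any
smooth weight, and the equation holds because this weight is itself a test function. Hence `hsupp`
is required for every `t` up to and including both end points. -/
theorem IsWeakEvolution.isEvolutionLimit_of_kernels {T : ℝ} {W : Submodule ℝ (H × K)}
    {v h : Lp H 2 (timeMeasure T)} {G τ : Lp K 2 (timeMeasure T)} (A : IsWeakEvolution T W v h G τ)
    {k : ℕ → ℝ → ℝ} (hk : ∀ n, IsMollifier volume (k n)) (hks : ∀ n, ContDiff ℝ ∞ (k n))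
    {r : ℕ → ℝ} (hr : Tendsto r atTop (𝓝 0))
    (hkr : ∀ n, Function.support (k n) ⊆ Metric.ball 0 (r n)) {θ : ℝ → ℝ} (hθ : ContDiff ℝ ∞ θ)
    (hsupp : ∀ n, ∀ t ∈ Icc 0 T, tsupport (fun s => k n (t - s) * θ s) ⊆ Ioo 0 T)
    {v₁ h₁ : Lp H 2 (timeMeasure T)} {G₁ τ₁ : Lp K 2 (timeMeasure T)}
    (hv₁ : v₁ =ᵐ[timeMeasure T] fun t => θ t • v t)
    (hh₁ : h₁ =ᵐ[timeMeasure T] fun t => θ t • h t + deriv θ t • v t)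
    (hG₁ : G₁ =ᵐ[timeMeasure T] fun t => θ t • G t)
    (hτ₁ : τ₁ =ᵐ[timeMeasure T] fun t => θ t • τ t) : IsEvolutionLimit T W v₁ h₁ G₁ τ₁ := by
  have hθ' : Continuous (deriv θ) := hθ.continuous_deriv (by simp)
  have mv := memLp_continuous_smul hθ.continuous (Lp.memLp v)
  have mh : MemLp (fun t => θ t • h t + deriv θ t • v t) 2 (timeMeasure T) :=
    (memLp_continuous_smul hθ.continuous (Lp.memLp h)).add (memLp_continuous_smul hθ' (Lp.memLp v))
  have mG := memLp_continuous_smul hθ.continuous (Lp.memLp G)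
  have mτ := memLp_continuous_smul hθ.continuous (Lp.memLp τ)
  have hloc : ∀ {F : Type _} [NormedAddCommGroup F] {f : ℝ → F}, MemLp f 2 (timeMeasure T) →
      LocallyIntegrable ((Ioo 0 T).indicator f) := fun hf =>
    ((memLp_indicator_iff_restrict measurableSet_Ioo).2 hf).locallyIntegrable (by norm_num)
  have hlocK : ∀ {f : ℝ → K}, MemLp f 2 (timeMeasure T) →
      LocallyIntegrable ((Ioo 0 T).indicator f) := fun hf =>
    ((memLp_indicator_iff_restrict measurableSet_Ioo).2 hf).locallyIntegrable (by norm_num)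
  have hcd : ∀ n {f : ℝ → H}, MemLp f 2 (timeMeasure T) → ContDiff ℝ 1
      (k n ⋆[ContinuousLinearMap.lsmul ℝ ℝ, volume] (Ioo 0 T).indicator f) := fun n f hf =>
    (hk n).hasCompactSupport.contDiff_convolution_left (n := 1) _ ((hks n).of_le (by simp))
      (hloc hf)
  have hcK : ∀ n {f : ℝ → K}, MemLp f 2 (timeMeasure T) → Continuous
      (k n ⋆[ContinuousLinearMap.lsmul ℝ ℝ, volume] (Ioo 0 T).indicator f) := fun n f hf =>
    (hk n).hasCompactSupport.continuous_convolution_left _ (hk n).continuous (hlocK hf)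
  refine ⟨fun n => k n ⋆[ContinuousLinearMap.lsmul ℝ ℝ, volume] (Ioo 0 T).indicator _,
    fun n => k n ⋆[ContinuousLinearMap.lsmul ℝ ℝ, volume] (Ioo 0 T).indicator _,
    fun n => k n ⋆[ContinuousLinearMap.lsmul ℝ ℝ, volume] (Ioo 0 T).indicator _,
    fun n => k n ⋆[ContinuousLinearMap.lsmul ℝ ℝ, volume] (Ioo 0 T).indicator _,
    fun n => ⟨hcd n mv, (hcd n mh).continuous, hcK n mG, hcK n mτ, fun t ht => ?_,
      fun t ht p hp => ?_⟩,
    tendsto_toL2_convolution hk hr hkr mv hv₁ _, tendsto_toL2_convolution hk hr hkr mh hh₁ _,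
    tendsto_toL2_convolution hk hr hkr mG hG₁ _, tendsto_toL2_convolution hk hr hkr mτ hτ₁ _⟩
  · have := A.mem (fun s => k n (t - s) * θ s)
      (((hks n).comp (contDiff_const.sub contDiff_id)).mul hθ)
    simpa only [convolution_indicator_eq measurableSet_Ioo, smul_smul] using this
  · have hkc : ContDiff ℝ ∞ fun s => k n (t - s) := (hks n).comp (contDiff_const.sub contDiff_id)
    have hder : ∀ s, HasDerivAt (fun s => k n (t - s) * θ s)
        (-deriv (k n) (t - s) * θ s + k n (t - s) * deriv θ s) s := fun s => by
      have h1 := (((hks n).differentiable (by simp) (t - s)).hasDerivAt).comp_const_sub t s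
      exact h1.mul ((hθ.differentiable (by simp) s).hasDerivAt)
    have key := A.eq p hp (fun s => k n (t - s) * θ s) (hkc.mul hθ)
      (isCompact_Icc.of_isClosed_subset (isClosed_tsupport _)
        ((hsupp n t ht).trans Ioo_subset_Icc_self)) (hsupp n t ht)
    simp only [(hder _).deriv] at key
    have hd := (hk n).hasCompactSupport.hasDerivAt_convolution_left
      (ContinuousLinearMap.lsmul ℝ ℝ) ((hks n).of_le (by simp)) (hloc mv) t
    have hk' : Continuous fun s => k n (t - s) := hkc.continuous
    have hdk' : Continuous fun s => deriv (k n) (t - s) :=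
      ((hks n).continuous_deriv (by simp)).comp (continuous_const.sub continuous_id)
    have i1 := integrableOn_continuous_smul hdk' mv
    have i2 := integrableOn_continuous_smul hk' mh
    have i3 := integrableOn_continuous_smul hk' mτ
    beta_reduce
    rw [hd.deriv, convolution_indicator_eq measurableSet_Ioo,
      convolution_indicator_eq measurableSet_Ioo, convolution_indicator_eq measurableSet_Ioo,
      inner_integral_left i1, inner_integral_left i2, inner_integral_left i3,
      ← integral_add (i2.inner_const p.1) (i3.inner_const p.2), ← sub_eq_zero,
      ← integral_sub (i1.inner_const p.1) ((i2.inner_const p.1).add (i3.inner_const p.2)),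
      ← neg_eq_zero, ← integral_neg]
    refine Eq.trans ?_ key
    refine integral_congr_ae (ae_of_all _ fun s => ?_)
    simp only [inner_add_left (𝕜 := ℝ) (E := H), real_inner_smul_left]
    ring

/-- Split `v = θ v + (1 - θ) v`. The first part vanishes near `0` and is averaged over the past, the
second vanishes near `T` and is averaged over the future, so neither average reaches the end point
where nothing is known. -/
theorem IsWeakEvolution.isEvolutionLimit {T : ℝ} (hT : 0 < T) {W : Submodule ℝ (H × K)}
    {v h : Lp H 2 (timeMeasure T)} {G τ : Lp K 2 (timeMeasure T)}
    (A : IsWeakEvolution T W v h G τ) : IsEvolutionLimit T W v h G τ := by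
  set δ : ℕ → ℝ := fun n => 1 / ((n : ℝ) + 1) with hδ
  have hδ0 : ∀ n, 0 < δ n := fun n => by positivity
  have hδt : Tendsto (fun n => 4 * δ n) atTop (𝓝 0) := by
    simpa [hδ] using tendsto_one_div_add_atTop_nhds_zero_nat.const_mul (4 : ℝ)
  -- Zero for `t ≤ T/3` and one for `t ≥ 2T/3`.
  set θ : ℝ → ℝ := fun t => Real.smoothTransition (3 * t / T - 1) with hθdef
  have hθ : ContDiff ℝ ∞ θ := Real.smoothTransition.contDiff.comp
    (((contDiff_const.mul contDiff_id).div_const T).sub contDiff_const)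
  have hθ' : ContDiff ℝ ∞ fun t => 1 - θ t := contDiff_const.sub hθ
  have hθ0 : ∀ t, θ t ≠ 0 → T / 3 ≤ t := fun t ht => by
    by_contra hlt
    refine ht (Real.smoothTransition.zero_of_nonpos ?_)
    rw [sub_nonpos, div_le_one hT]; linarith
  have hθ1 : ∀ t, 1 - θ t ≠ 0 → t ≤ 2 * T / 3 := fun t ht => by
    by_contra hlt
    refine ht (sub_eq_zero.2 (Real.smoothTransition.one_of_one_le ?_).symm)
    rw [le_sub_iff_add_le, le_div_iff₀ hT]; linarith
  have hd : ∀ t, deriv (fun t => 1 - θ t) t = -deriv θ t := fun t => by simp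
  -- Kernels on `[δ, 3δ]` for `σ = 1` and on `[-3δ, -δ]` for `σ = -1`: the argument `s` of the
  -- averaged function satisfies `s ≤ t - δ` or `s ≥ t + δ` respectively.
  have hker : ∀ σ : ℝ, |σ| = 1 → ∃ k : ℕ → ℝ → ℝ, (∀ n, IsMollifier volume (k n)) ∧
      (∀ n, ContDiff ℝ ∞ (k n)) ∧
      (∀ n, Function.support (k n) ⊆ Metric.ball 0 (4 * δ n)) ∧
      ∀ n, Function.support (k n) ⊆ Metric.closedBall (σ * (2 * δ n)) (δ n) := by
    intro σ hσ
    choose k h1 h2 h3 using fun n => exists_isMollifier (volume : Measure ℝ) (σ * (2 * δ n)) (hδ0 n)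
    refine ⟨k, h1, h2, fun n s hs => ?_, h3⟩
    have h4 := h3 n hs
    rw [mem_closedBall_iff_norm] at h4
    rw [mem_ball_zero_iff]
    have h5 : ‖s‖ ≤ ‖s - σ * (2 * δ n)‖ + ‖σ * (2 * δ n)‖ := by
      simpa using norm_add_le (s - σ * (2 * δ n)) (σ * (2 * δ n))
    rw [norm_mul, Real.norm_eq_abs σ, hσ, one_mul,
      Real.norm_of_nonneg (by linarith [hδ0 n] : 0 ≤ 2 * δ n)] at h5
    linarith [hδ0 n]
  obtain ⟨k, hk1, hk2, hk3, hk4⟩ := hker 1 (by simp)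
  obtain ⟨l, hl1, hl2, hl3, hl4⟩ := hker (-1) (by simp)
  have hθc := hθ.continuous
  have hθc' := hθ'.continuous
  have hdc : Continuous (deriv θ) := hθ.continuous_deriv (by simp)
  have hdc' : Continuous (deriv fun t => 1 - θ t) := hθ'.continuous_deriv (by simp)
  have B1 := A.isEvolutionLimit_of_kernels hk1 hk2 hδt hk3 hθ (fun n t ht => by
    refine (closure_minimal (t := Icc (T / 3) (T - δ n)) (fun s hs => ?_) isClosed_Icc).trans
      (Icc_subset_Ioo (by positivity) (by linarith [hδ0 n]))
    have h1 := hk4 n (left_ne_zero_of_mul hs)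
    rw [Real.closedBall_eq_Icc, mem_Icc] at h1
    exact ⟨hθ0 s (right_ne_zero_of_mul hs), by linarith [ht.2]⟩)
    (memLp_continuous_smul hθc (Lp.memLp v)).coeFn_toLp
    ((memLp_continuous_smul hθc (Lp.memLp h)).add
      (memLp_continuous_smul hdc (Lp.memLp v))).coeFn_toLp
    (memLp_continuous_smul hθc (Lp.memLp G)).coeFn_toLp
    (memLp_continuous_smul hθc (Lp.memLp τ)).coeFn_toLp
  have B2 := A.isEvolutionLimit_of_kernels hl1 hl2 hδt hl3 hθ' (fun n t ht => by
    refine (closure_minimal (t := Icc (δ n) (2 * T / 3)) (fun s hs => ?_) isClosed_Icc).trans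
      (Icc_subset_Ioo (hδ0 n) (by linarith))
    have h1 := hl4 n (left_ne_zero_of_mul hs)
    rw [Real.closedBall_eq_Icc, mem_Icc] at h1
    exact ⟨by linarith [ht.1], hθ1 s (right_ne_zero_of_mul hs)⟩)
    (memLp_continuous_smul hθc' (Lp.memLp v)).coeFn_toLp
    ((memLp_continuous_smul hθc' (Lp.memLp h)).add
      (memLp_continuous_smul hdc' (Lp.memLp v))).coeFn_toLp
    (memLp_continuous_smul hθc' (Lp.memLp G)).coeFn_toLp
    (memLp_continuous_smul hθc' (Lp.memLp τ)).coeFn_toLp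
  convert B1.add B2 using 1 <;> rw [← MemLp.toLp_add]
  · refine Lp.ext ((MemLp.coeFn_toLp _).trans (ae_of_all _ fun t => ?_)).symm
    simp only [Pi.add_apply]; module
  · refine Lp.ext ((MemLp.coeFn_toLp _).trans (ae_of_all _ fun t => ?_)).symm
    simp only [Pi.add_apply, hd]; module
  · refine Lp.ext ((MemLp.coeFn_toLp _).trans (ae_of_all _ fun t => ?_)).symm
    simp only [Pi.add_apply]; module
  · refine Lp.ext ((MemLp.coeFn_toLp _).trans (ae_of_all _ fun t => ?_)).symm
    simp only [Pi.add_apply]; module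

end Evolution

end

/-! ### Functions on products as vector valued functions -/

section

/-- By second countability every open set is a countable union of balls, and preimages of balls are
sublevel sets of distance functions. -/
theorem measurable_of_measurable_edist {α X : Type*} [MeasurableSpace α] [PseudoEMetricSpace X]
    [SecondCountableTopology X] [MeasurableSpace X] [BorelSpace X] {f : α → X}
    (h : ∀ c, Measurable fun a => edist (f a) c) : Measurable f := by
  refine measurable_of_isOpen fun U hU => ?_
  have hr : ∀ x : U, ∃ r : ℝ≥0∞, 0 < r ∧ Metric.eball (x : X) r ⊆ U := fun x => by
    obtain ⟨r, hr, hsub⟩ := EMetric.isOpen_iff.1 hU x x.2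
    exact ⟨r, hr, hsub⟩
  choose r hr0 hrU using hr
  obtain ⟨S, hS, hSU⟩ := TopologicalSpace.isOpen_iUnion_countable
    (fun x : U => Metric.eball (x : X) (r x)) fun x => Metric.isOpen_eball
  have hUeq : U = ⋃ x ∈ S, Metric.eball (x : X) (r x) := by
    rw [hSU]
    refine Subset.antisymm (fun x hx => mem_iUnion.2 ⟨⟨x, hx⟩, ?_⟩) (iUnion_subset hrU)
    exact Metric.mem_eball_self (hr0 _)
  rw [hUeq, preimage_iUnion₂]
  exact MeasurableSet.biUnion hS fun x _ => measurableSet_lt (h x) measurable_const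

section Curry

variable {α β : Type*} [MeasurableSpace α] [MeasurableSpace β] [MeasurableSpace.CountablyGenerated β]
  {μ : Measure α} {ν : Measure β} [SFinite μ] [SFinite ν] {ρ : Measure (α × β)}

/-- `F : α → L²(ν)` is the curried form of `f`. -/
def IsCurry {E : Type*} [NormedAddCommGroup E] (μ : Measure α) (ν : Measure β) (f : α × β → E)
    (F : α → Lp E 2 ν) : Prop :=
  ∀ᵐ t ∂μ, ∀ᵐ x ∂ν, F t x = f (t, x)

/-- Tonelli makes almost every slice square integrable. Measurability of the slice map into the
separable space `L²(ν)` follows from that of its distances to fixed elements, which are parameter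
integrals. -/
theorem exists_isCurry {E : Type*} [NormedAddCommGroup E] [SecondCountableTopology E]
    (hρ : ρ = μ.prod ν) (f : Lp E 2 ρ) : ∃ F : Lp (Lp E 2 ν) 2 μ, IsCurry μ ν f F := by
  classical
  subst hρ
  let g : α × β → E := f
  have hg : StronglyMeasurable g := Lp.stronglyMeasurable f
  have hsl : ∀ t, StronglyMeasurable fun x => g (t, x) := fun t =>
    hg.comp_measurable measurable_prodMk_left
  let N : α → ℝ≥0∞ := fun t => eLpNorm (fun x => g (t, x)) 2 ν
  have hmN : ∀ c : β → E, StronglyMeasurable c →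
      Measurable fun t => eLpNorm (fun x => g (t, x) - c x) 2 ν := fun c hc => by
    simp only [eLpNorm_eq_lintegral_rpow_enorm_toReal (two_ne_zero) (ENNReal.ofNat_ne_top)]
    exact (((hg.sub (hc.comp_measurable measurable_snd)).enorm.pow_const
      _).lintegral_prod_right').pow_const _
  have hN : Measurable N := by
    have := hmN 0 stronglyMeasurable_zero
    simpa using this
  have hNsq : ∫⁻ t, N t ^ 2 ∂μ = eLpNorm g 2 (μ.prod ν) ^ 2 := by
    simp only [N, eLpNorm_two_sq]
    rw [lintegral_prod _ (hg.enorm.pow_const 2).aemeasurable]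
  have hfin : ∫⁻ t, N t ^ 2 ∂μ < ⊤ := by
    rw [hNsq]; exact ENNReal.pow_lt_top (Lp.memLp f).2
  have hM : ∀ t, N t < ⊤ → MemLp (fun x => g (t, x)) 2 ν := fun t h =>
    ⟨(hsl t).aestronglyMeasurable, h⟩
  -- The default `0` is used only on the null set of slices with infinite norm.
  let F : α → Lp E 2 ν := fun t => if h : N t < ⊤ then (hM t h).toLp else 0
  have hset : MeasurableSet {t | N t < ⊤} := measurableSet_lt hN measurable_const
  have hF : StronglyMeasurable F := by
    borelize ↥(Lp E 2 ν)
    have : Fact ((2 : ℝ≥0∞) ≠ ⊤) := ⟨by norm_num⟩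
    refine (measurable_of_measurable_edist fun c => ?_).stronglyMeasurable
    have : (fun t => edist (F t) c) = fun t => if N t < ⊤ then
        eLpNorm (fun x => g (t, x) - c x) 2 ν else edist 0 c := by
      funext t
      by_cases h : N t < ⊤
      · simp only [F, h, dif_pos, if_true]
        rw [Lp.edist_def]
        refine eLpNorm_congr_ae ?_
        filter_upwards [(hM t h).coeFn_toLp] with x hx
        simp [hx]
      · simp only [F, h, dif_neg, not_false_eq_true, if_false]
    rw [this]
    exact Measurable.ite hset (hmN c (Lp.stronglyMeasurable c)) measurable_const
  have hae : ∀ᵐ t ∂μ, N t < ⊤ := by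
    filter_upwards [ae_lt_top (hN.pow_const 2) hfin.ne] with t ht
    by_contra h
    rw [not_lt, top_le_iff] at h
    simp [h] at ht
  have hmem : MemLp F 2 μ := by
    refine ⟨hF.aestronglyMeasurable, ?_⟩
    have h2 : eLpNorm F 2 μ ^ 2 ≤ ∫⁻ t, N t ^ 2 ∂μ := by
      rw [eLpNorm_two_sq]
      refine lintegral_mono fun t => ?_
      gcongr
      by_cases h : N t < ⊤
      · simp only [F, h, dif_pos]
        rw [Lp.enorm_toLp]
      · simp only [F, h, dif_neg, not_false_eq_true, enorm_zero, zero_le]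
    by_contra h
    rw [not_lt, top_le_iff] at h
    rw [h] at h2
    exact absurd (h2.trans_lt hfin) (by simp)
  refine ⟨hmem.toLp, ?_⟩
  filter_upwards [hmem.coeFn_toLp, hae] with t h1 h2
  rw [h1]
  simp only [F, h2, dif_pos]
  exact MemLp.coeFn_toLp _

variable {E : Type*} [NormedAddCommGroup E] [InnerProductSpace ℝ E]

theorem IsCurry.inner_eq (hρ : ρ = μ.prod ν) {f g : Lp E 2 ρ} {F G : Lp (Lp E 2 ν) 2 μ}
    (hF : IsCurry μ ν f F) (hG : IsCurry μ ν g G) : ⟪F, G⟫ = ⟪f, g⟫ := by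
  subst hρ
  rw [L2.inner_def, L2.inner_def, integral_prod _ (L2.integrable_inner f g)]
  refine integral_congr_ae ?_
  filter_upwards [hF, hG] with t h1 h2
  rw [L2.inner_def]
  refine integral_congr_ae ?_
  filter_upwards [h1, h2] with x h3 h4
  rw [h3, h4]

theorem IsCurry.norm_eq (hρ : ρ = μ.prod ν) {f : Lp E 2 ρ} {F : Lp (Lp E 2 ν) 2 μ}
    (hF : IsCurry μ ν f F) : ‖F‖ = ‖f‖ := by
  have := hF.inner_eq hρ hF
  rw [real_inner_self_eq_norm_sq, real_inner_self_eq_norm_sq] at this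
  exact (pow_left_inj₀ (norm_nonneg _) (norm_nonneg _) two_ne_zero).1 this

theorem IsCurry.add (hρ : ρ = μ.prod ν) {f g : Lp E 2 ρ} {F G : Lp (Lp E 2 ν) 2 μ}
    (hF : IsCurry μ ν f F) (hG : IsCurry μ ν g G) : IsCurry μ ν (f + g : Lp E 2 ρ) (F + G : Lp (Lp E 2 ν) 2 μ) := by
  subst hρ
  filter_upwards [hF, hG, Measure.ae_ae_of_ae_prod (Lp.coeFn_add f g), Lp.coeFn_add F G]
    with t h1 h2 h3 h4
  rw [h4]
  filter_upwards [h1, h2, h3, Lp.coeFn_add (F t) (G t)] with x h5 h6 h7 h8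
  rw [h7, Pi.add_apply, Pi.add_apply, h8, Pi.add_apply, h5, h6]

theorem memLp_prod_smul {η : α → ℝ} (hη : MemLp η 2 μ) {ψ : β → E} (hψ : MemLp ψ 2 ν) :
    MemLp (fun z : α × β => η z.1 • ψ z.2) 2 (μ.prod ν) := by
  have hm : AEStronglyMeasurable (fun z : α × β => η z.1 • ψ z.2) (μ.prod ν) :=
    (hη.1.comp_quasiMeasurePreserving Measure.quasiMeasurePreserving_fst).smul
      (hψ.1.comp_quasiMeasurePreserving Measure.quasiMeasurePreserving_snd)
  rw [memLp_two_iff_integrable_sq_norm hm]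
  have h1 := (memLp_two_iff_integrable_sq_norm hη.1).1 hη
  have h2 := (memLp_two_iff_integrable_sq_norm hψ.1).1 hψ
  refine (h1.mul_prod h2).congr (ae_of_all _ fun z => ?_)
  simp [norm_smul, mul_pow]

theorem IsCurry.integral_mul_inner (hρ : ρ = μ.prod ν) {f : Lp E 2 ρ} {F : α → Lp E 2 ν}
    (hF : IsCurry μ ν f F) {η : α → ℝ} (hη : MemLp η 2 μ) (ψ : Lp E 2 ν) :
    ∫ t, η t * ⟪F t, ψ⟫ ∂μ = ∫ z, ⟪f z, η z.1 • ψ z.2⟫ ∂ρ := by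
  subst hρ
  have hm := memLp_prod_smul hη (Lp.memLp ψ)
  have hi : Integrable (fun z : α × β => ⟪f z, η z.1 • ψ z.2⟫) (μ.prod ν) := by
    refine (L2.integrable_inner (𝕜 := ℝ) f hm.toLp).congr ?_
    filter_upwards [hm.coeFn_toLp] with z hz
    rw [hz]
  rw [integral_prod _ hi]
  refine integral_congr_ae ?_
  filter_upwards [hF] with t ht
  rw [L2.inner_def, ← integral_const_mul]
  refine integral_congr_ae ?_
  filter_upwards [ht] with x hx
  rw [hx, real_inner_smul_right]

end Curry

end

/-! ### From the differential equation to an abstract evolution -/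

section

variable {d : ℕ} {T : ℝ} {Ω : Set (Space d)}

theorem volume_restrict_cylinder (T : ℝ) (Ω : Set (Space d)) :
    (volume.restrict (cylinder T Ω) : Measure (TimeSpace d))
      = (timeMeasure T).prod (volume.restrict Ω) := by
  rw [cylinder, Measure.volume_eq_prod, Measure.prod_restrict]

/-- `C_c^∞(Ω)`. -/
structure IsSpaceTest (Ω : Set (Space d)) (ψ : Space d → ℝ) : Prop where
  contDiff : ContDiff ℝ ∞ ψ
  hasCompactSupport : HasCompactSupport ψ
  tsupport_subset : tsupport ψ ⊆ Ω

/-- The graph of the gradient on `C_c^∞(Ω)`. -/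
def testGraph (Ω : Set (Space d)) :
    Submodule ℝ (L2Ω Ω × Lp (Space d) 2 (volume.restrict Ω)) where
  carrier := {p | ∃ ψ, IsSpaceTest Ω ψ ∧ p.1 =ᵐ[volume.restrict Ω] ψ ∧
    p.2 =ᵐ[volume.restrict Ω] grad ψ}
  zero_mem' := by
    refine ⟨0, ⟨contDiff_const, HasCompactSupport.zero, by simp⟩, Lp.coeFn_zero _ _ _, ?_⟩
    have : grad (0 : Space d → ℝ) = 0 := by funext x; ext i; simp [grad]
    rw [this]
    exact Lp.coeFn_zero _ _ _
  add_mem' := by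
    rintro p q ⟨ψ, h, h1, h2⟩ ⟨φ, h', h1', h2'⟩
    refine ⟨ψ + φ, ⟨h.1.add h'.1, h.2.add h'.2,
      (tsupport_add _ _).trans (union_subset h.3 h'.3)⟩, ?_, ?_⟩
    · exact (Lp.coeFn_add _ _).trans (h1.add h1')
    · rw [grad_add h.1 h'.1]
      exact (Lp.coeFn_add _ _).trans (h2.add h2')
  smul_mem' := by
    rintro c p ⟨ψ, h, h1, h2⟩
    refine ⟨c • ψ, ⟨h.1.const_smul c, h.2.mono' fun x hx => subset_tsupport _ fun h0 => hx
      (by simp [h0]), (closure_mono (Function.support_const_smul_subset c ψ)).trans h.3⟩, ?_, ?_⟩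
    · exact (Lp.coeFn_smul _ _).trans (h1.const_smul c)
    · have : grad (c • ψ) = c • grad ψ := by
        funext x; ext i
        simp [grad, fderiv_const_smul (h.1.differentiable (by simp) x)]
      rw [this]
      exact (Lp.coeFn_smul _ _).trans (h2.const_smul c)

/-- The graph of the gradient on `H¹₀(Ω)`. -/
def gradGraph (Ω : Set (Space d)) :
    Submodule ℝ (L2Ω Ω × Lp (Space d) 2 (volume.restrict Ω)) :=
  (testGraph Ω).topologicalClosure

theorem tendsto_toLp_restrict {F : Type*} [NormedAddCommGroup F] {E : Type*} [MeasurableSpace E]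
    {μ : Measure E} {S : Set E} (hS : MeasurableSet S)
    {u : Lp F 2 (μ.restrict S)} {f : ℕ → E → F} (hf : ∀ n, MemLp (f n) 2 (μ.restrict S))
    (h : Tendsto (fun n => eLpNorm (f n - S.indicator u) 2 μ) atTop (𝓝 0)) :
    Tendsto (fun n => (hf n).toLp) atTop (𝓝 u) := by
  rw [Lp.tendsto_Lp_iff_tendsto_eLpNorm']
  refine tendsto_of_tendsto_of_tendsto_of_le_of_le tendsto_const_nhds h (fun _ => zero_le)
    fun n => ?_
  refine (eLpNorm_congr_ae ?_).trans_le (eLpNorm_mono_measure _ Measure.restrict_le_self)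
  filter_upwards [(hf n).coeFn_toLp, ae_restrict_mem hS] with x h1 h2
  simp [h1, h2]

/-- A pair in `L²(Ω)` satisfying the integration by parts formula up to the boundary belongs to the
graph of the gradient on `H¹₀(Ω)`. -/
theorem mem_gradGraph (hΩ : IsBoundedLipschitzDomain Ω) {u : L2Ω Ω}
    {G : Lp (Space d) 2 (volume.restrict Ω)}
    (h : ∀ χ : Space d → Space d, ContDiff ℝ ∞ χ → HasCompactSupport χ →
      ∫ x in Ω, ⟪G x, χ x⟫ = -∫ x in Ω, u x * sdiv χ x) : (u, G) ∈ gradGraph Ω := by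
  have hm := hΩ.isOpen.measurableSet
  -- The test fields in the hypothesis need not vanish on the boundary, so the extensions by zero
  -- satisfy the weak gradient identity on all of `ℝ^d`.
  have hw : HasWeakGrad (Ω.indicator u) (Ω.indicator G) := by
    refine ⟨(memLp_indicator_iff_restrict hm).2 (Lp.memLp u),
      (memLp_indicator_iff_restrict hm).2 (Lp.memLp G), fun χ hχ hc => ?_⟩
    have e1 : ∀ x, ⟪Ω.indicator G x, χ x⟫ = Ω.indicator (fun x => ⟪G x, χ x⟫) x := fun x => by
      by_cases hx : x ∈ Ω <;> simp [hx]
    have e2 : ∀ x, Ω.indicator u x * sdiv χ x = Ω.indicator (fun x => u x * sdiv χ x) x :=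
      fun x => by by_cases hx : x ∈ Ω <;> simp [hx]
    simp only [e1, e2]
    rw [integral_indicator hm, integral_indicator hm, h χ hχ hc]
  obtain ⟨ψ, hψ, t1, t2⟩ := hw.isTestLimit hΩ (fun x hx => by simp [hx]) (fun x hx => by simp [hx])
  have m1 : ∀ n, MemLp (ψ n) 2 (volume.restrict Ω) := fun n =>
    (hψ n).1.continuous.memLp_of_hasCompactSupport (hψ n).2.1
  have m2 : ∀ n, MemLp (grad (ψ n)) 2 (volume.restrict Ω) := fun n =>
    (continuous_grad (hψ n).1).memLp_of_hasCompactSupport (hasCompactSupport_grad (hψ n).2.1)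
  refine mem_closure_of_tendsto
    ((tendsto_toLp_restrict hm m1 t1).prodMk_nhds (tendsto_toLp_restrict hm m2 t2))
    (Eventually.of_forall fun n => ?_)
  exact ⟨ψ n, ⟨(hψ n).1, (hψ n).2.1, (hψ n).2.2⟩, (m1 n).coeFn_toLp, (m2 n).coeFn_toLp⟩

/-! ### Tensor products of test functions -/

theorem dt_tensor {η : ℝ → ℝ} {ψ : Space d → ℝ} (hη : ContDiff ℝ ∞ η) (hψ : ContDiff ℝ ∞ ψ)
    (z : TimeSpace d) : dt (fun z => η z.1 * ψ z.2) z = deriv η z.1 * ψ z.2 := by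
  have h1 := ((hη.differentiable (by simp) z.1).hasFDerivAt.comp z
    (hasFDerivAt_fst (𝕜 := ℝ) (p := z))).mul
    ((hψ.differentiable (by simp) z.2).hasFDerivAt.comp z (hasFDerivAt_snd (𝕜 := ℝ) (p := z)))
  have h2 : HasFDerivAt (fun z : TimeSpace d => η z.1 * ψ z.2) _ z := h1
  rw [dt, h2.fderiv]
  simp [mul_comm]

theorem gradx_tensor {η : ℝ → ℝ} {ψ : Space d → ℝ} (hη : ContDiff ℝ ∞ η) (hψ : ContDiff ℝ ∞ ψ)
    (z : TimeSpace d) : gradx (fun z => η z.1 * ψ z.2) z = η z.1 • grad ψ z.2 := by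
  have h1 := ((hη.differentiable (by simp) z.1).hasFDerivAt.comp z
    (hasFDerivAt_fst (𝕜 := ℝ) (p := z))).mul
    ((hψ.differentiable (by simp) z.2).hasFDerivAt.comp z (hasFDerivAt_snd (𝕜 := ℝ) (p := z)))
  have h2 : HasFDerivAt (fun z : TimeSpace d => η z.1 * ψ z.2) _ z := h1
  ext i
  simp only [gradx, h2.fderiv]
  simp [grad]

theorem divx_tensor {η : ℝ → ℝ} {χ : Space d → Space d} (hη : ContDiff ℝ ∞ η)
    (hχ : ContDiff ℝ ∞ χ) (z : TimeSpace d) :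
    divx (fun z => η z.1 • χ z.2) z = η z.1 * sdiv χ z.2 := by
  have h1 := ((hη.differentiable (by simp) z.1).hasFDerivAt.comp z
    (hasFDerivAt_fst (𝕜 := ℝ) (p := z))).smul
    ((hχ.differentiable (by simp) z.2).hasFDerivAt.comp z (hasFDerivAt_snd (𝕜 := ℝ) (p := z)))
  have h2 : HasFDerivAt (fun z : TimeSpace d => η z.1 • χ z.2) _ z := h1
  simp only [divx, h2.fderiv, sdiv, Finset.mul_sum]
  refine Finset.sum_congr rfl fun i _ => ?_
  simp

theorem contDiff_tensor {η : ℝ → ℝ} {ψ : Space d → ℝ} (hη : ContDiff ℝ ∞ η)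
    (hψ : ContDiff ℝ ∞ ψ) : ContDiff ℝ ∞ fun z : TimeSpace d => η z.1 * ψ z.2 :=
  (hη.comp contDiff_fst).mul (hψ.comp contDiff_snd)

theorem tsupport_tensor_subset (η : ℝ → ℝ) (ψ : Space d → ℝ) :
    tsupport (fun z : TimeSpace d => η z.1 * ψ z.2) ⊆ tsupport η ×ˢ tsupport ψ :=
  closure_minimal (fun _ hz => ⟨subset_tsupport _ (left_ne_zero_of_mul hz),
    subset_tsupport _ (right_ne_zero_of_mul hz)⟩)
    ((isClosed_tsupport η).prod (isClosed_tsupport ψ))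

theorem isTest_tensor {η : ℝ → ℝ} (hη : ContDiff ℝ ∞ η) (hc : HasCompactSupport η)
    (hs : tsupport η ⊆ Ioo 0 T) {ψ : Space d → ℝ} (hψ : IsSpaceTest Ω ψ) :
    IsTest (cylinder T Ω) fun z : TimeSpace d => η z.1 * ψ z.2 :=
  ⟨contDiff_tensor hη hψ.1,
    (hc.isCompact.prod hψ.2.isCompact).of_isClosed_subset (isClosed_tsupport _)
      (tsupport_tensor_subset η ψ),
    (tsupport_tensor_subset η ψ).trans (prod_mono hs hψ.3)⟩

/-- Pairing of the time average of a function with a function on `Ω`. -/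
theorem inner_integral_smul_eq {E : Type*} [NormedAddCommGroup E] [InnerProductSpace ℝ E]
    [CompleteSpace E] {f : Lp E 2 (volume.restrict (cylinder T Ω))}
    {F : Lp (Lp E 2 (volume.restrict Ω)) 2 (timeMeasure T)}
    (hF : IsCurry (timeMeasure T) (volume.restrict Ω) f F) {η : ℝ → ℝ} (hη : Continuous η)
    {w : Lp E 2 (volume.restrict Ω)} {ψ : Space d → E} (hw : w =ᵐ[volume.restrict Ω] ψ) :
    ⟪∫ t in Ioo 0 T, η t • F t, w⟫ = ∫ z in cylinder T Ω, ⟪f z, η z.1 • ψ z.2⟫ := by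
  rw [inner_integral_left (integrableOn_continuous_smul hη (Lp.memLp F))]
  simp only [real_inner_smul_left]
  rw [hF.integral_mul_inner (volume_restrict_cylinder T Ω)
    (memLp_timeMeasure_of_continuous T hη 2)]
  have hae : ∀ᵐ z ∂(volume.restrict (cylinder T Ω) : Measure (TimeSpace d)), w z.2 = ψ z.2 := by
    rw [volume_restrict_cylinder]
    exact Measure.quasiMeasurePreserving_snd.ae hw
  refine integral_congr_ae ?_
  filter_upwards [hae] with z hz
  rw [hz]

theorem inner_toL2_smul_eq {E : Type*} [NormedAddCommGroup E] [InnerProductSpace ℝ E]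
    [CompleteSpace E] {f : Lp E 2 (volume.restrict (cylinder T Ω))}
    {F : Lp (Lp E 2 (volume.restrict Ω)) 2 (timeMeasure T)}
    (hF : IsCurry (timeMeasure T) (volume.restrict Ω) f F) {η : ℝ → ℝ} (hη : Continuous η)
    {w : Lp E 2 (volume.restrict Ω)} {ψ : Space d → E} (hw : w =ᵐ[volume.restrict Ω] ψ)
    (hc : Continuous fun t => η t • w) :
    ⟪F, toL2 T (fun t => η t • w) hc⟫ = ∫ z in cylinder T Ω, ⟪f z, η z.1 • ψ z.2⟫ := by
  rw [← inner_integral_smul_eq hF hη hw, L2.inner_def,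
    inner_integral_left (integrableOn_continuous_smul hη (Lp.memLp F))]
  refine integral_congr_ae ?_
  filter_upwards [coeFn_toL2 T hc] with t ht
  rw [ht, real_inner_smul_left, real_inner_smul_right]

/-- `div (v, τ) = h`, tested with the products of a function of time and a function of space. -/
def IsTensorWeakDiv (v : L2Pair (cylinder T Ω)) (h : L2Q (cylinder T Ω)) : Prop :=
  ∀ (η : ℝ → ℝ) (ψ : Space d → ℝ), ContDiff ℝ ∞ η → HasCompactSupport η → tsupport η ⊆ Ioo 0 T →
    IsSpaceTest Ω ψ → ∫ z in cylinder T Ω, h z * (η z.1 * ψ z.2)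
      = -((∫ z in cylinder T Ω, v.fst z * (deriv η z.1 * ψ z.2))
        + ∫ z in cylinder T Ω, ⟪v.snd z, η z.1 • grad ψ z.2⟫)

theorem IsTensorWeakDiv.of_isWeakDiv {v : L2Pair (cylinder T Ω)} {h : L2Q (cylinder T Ω)}
    (H : IsWeakDiv (cylinder T Ω) v h) : IsTensorWeakDiv v h := fun η ψ hη hc hs hψ => by
  simpa only [dt_tensor hη hψ.1, gradx_tensor hη hψ.1] using H _ (isTest_tensor hη hc hs hψ)

/-- Fields `η(t) χ(x)` in the lateral condition show that each time average of `(v, G)` satisfies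
integration by parts up to the boundary of `Ω`, so `mem_gradGraph` applies. The equation is known
for pairs `(ψ, ∇ψ)` with `ψ` a test function and passes to the closure of these pairs. -/
theorem isWeakEvolution_of_isTensorWeakDiv (hΩ : IsBoundedLipschitzDomain Ω)
    {v : L2Pair (cylinder T Ω)} {h : L2Q (cylinder T Ω)} {G : L2QVec (cylinder T Ω)}
    (hdiv : IsTensorWeakDiv v h)
    (hlat : ∀ χ : TimeSpace d → Space d, ContDiff ℝ ∞ χ →
      ∫ z in cylinder T Ω, ⟪G z, χ z⟫ = -∫ z in cylinder T Ω, v.fst z * divx χ z)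
    {V H : Lp (L2Ω Ω) 2 (timeMeasure T)}
    {G' τ : Lp (Lp (Space d) 2 (volume.restrict Ω)) 2 (timeMeasure T)}
    (hV : IsCurry (timeMeasure T) (volume.restrict Ω) v.fst V)
    (hH : IsCurry (timeMeasure T) (volume.restrict Ω) h H)
    (hG : IsCurry (timeMeasure T) (volume.restrict Ω) G G')
    (hτ : IsCurry (timeMeasure T) (volume.restrict Ω) v.snd τ) :
    IsWeakEvolution T (gradGraph Ω) V H G' τ := by
  have key : ∀ a b : ℝ, ⟪a, b⟫ = a * b := fun a b => by simp [mul_comm]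
  refine ⟨fun η hη => mem_gradGraph hΩ fun χ hχ hc => ?_, fun p hp η hη hc hs => ?_⟩
  · have m1 : MemLp χ 2 (volume.restrict Ω) := hχ.continuous.memLp_of_hasCompactSupport hc
    have m2 : MemLp (sdiv χ) 2 (volume.restrict Ω) :=
      (continuous_sdiv hχ).memLp_of_hasCompactSupport (hasCompactSupport_sdiv hc)
    have e1 := inner_integral_smul_eq hG hη.continuous m1.coeFn_toLp
    have e2 := inner_integral_smul_eq hV hη.continuous m2.coeFn_toLp
    have e3 := hlat (fun z => η z.1 • χ z.2) ((hη.comp contDiff_fst).smul (hχ.comp contDiff_snd))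
    simp only [divx_tensor hη hχ] at e3
    simp only [key, smul_eq_mul] at e2
    rw [← e1, ← e2, L2.inner_def, L2.inner_def] at e3
    convert e3 using 1
    · refine integral_congr_ae ?_
      filter_upwards [m1.coeFn_toLp] with x hx
      rw [hx]
    · congr 1
      refine integral_congr_ae ?_
      filter_upwards [m2.coeFn_toLp] with x hx
      rw [hx, key]
  · have hd : Continuous (deriv η) := hη.continuous_deriv (by simp)
    have i1 := integrableOn_continuous_smul hd (Lp.memLp V)
    have i2 := integrableOn_continuous_smul hη.continuous (Lp.memLp H)
    have i3 := integrableOn_continuous_smul hη.continuous (Lp.memLp τ)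
    have e : ∀ p : L2Ω Ω × Lp (Space d) 2 (volume.restrict Ω),
        ∫ t in Ioo 0 T, (deriv η t * ⟪V t, p.1⟫ + η t * (⟪H t, p.1⟫ + ⟪τ t, p.2⟫))
        = ⟪∫ t in Ioo 0 T, deriv η t • V t, p.1⟫ + ⟪∫ t in Ioo 0 T, η t • H t, p.1⟫
          + ⟪∫ t in Ioo 0 T, η t • τ t, p.2⟫ := fun p => by
      have j12 : IntegrableOn (fun t => ⟪deriv η t • V t, p.1⟫ + ⟪η t • H t, p.1⟫) (Ioo 0 T) :=
        (i1.inner_const (𝕜 := ℝ) p.1).add (i2.inner_const (𝕜 := ℝ) p.1)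
      rw [inner_integral_left i1, inner_integral_left i2, inner_integral_left i3,
        ← integral_add (i1.inner_const (𝕜 := ℝ) p.1) (i2.inner_const (𝕜 := ℝ) p.1),
        ← integral_add j12 (i3.inner_const (𝕜 := ℝ) p.2)]
      refine integral_congr_ae (ae_of_all _ fun t => ?_)
      simp only [real_inner_smul_left]
      ring
    rw [e]
    -- With the time integrals taken first, the expression is a continuous function of `p`, so it
    -- suffices to treat the dense set of test functions.
    have hcl : IsClosed {p : L2Ω Ω × Lp (Space d) 2 (volume.restrict Ω) |
        ⟪∫ t in Ioo 0 T, deriv η t • V t, p.1⟫ + ⟪∫ t in Ioo 0 T, η t • H t, p.1⟫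
          + ⟪∫ t in Ioo 0 T, η t • τ t, p.2⟫ = 0} :=
      isClosed_eq (by fun_prop) continuous_const
    have hp' : p ∈ closure ((testGraph Ω : Submodule ℝ _) : Set _) := hp
    refine closure_minimal ?_ hcl hp'
    rintro p ⟨ψ, hψ, h1, h2⟩
    have hw := hdiv η ψ hη hc hs hψ
    have a1 := inner_integral_smul_eq hV hd h1
    have a2 := inner_integral_smul_eq hH hη.continuous h1
    have a3 := inner_integral_smul_eq hτ hη.continuous h2
    simp only [key, smul_eq_mul] at a1 a2
    exact (congrArg₂ (· + ·) (congrArg₂ (· + ·) a1 a2) a3).trans (by linarith)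

end

/-! ### Initial traces and stability -/

section

variable {d : ℕ} {T : ℝ} {Ω : Set (Space d)}

/-- Integration by parts against smooth fields up to the boundary: `G = ∇_x v` and `v` vanishes on
the lateral boundary. -/
def HasZeroLateralGrad {Q : Set (TimeSpace d)} (v : L2Q Q) (G : L2QVec Q) : Prop :=
  ∀ χ : TimeSpace d → Space d, ContDiff ℝ ∞ χ →
    ∫ z in Q, ⟪G z, χ z⟫ = -∫ z in Q, v z * divx χ z

theorem sq_norm_le_of_isCurry (hT : 0 ≤ T) {v : L2Q (cylinder T Ω)} {V : ℝ → L2Ω Ω}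
    (hV : ∀ᵐ t ∂(timeMeasure T), ∀ᵐ x ∂(volume.restrict Ω), V t x = v (t, x)) {M : ℝ}
    (hM : ∀ t ∈ Icc 0 T, ‖V t‖ ^ 2 ≤ M) : ‖v‖ ^ 2 ≤ T * M := by
  obtain ⟨F, hF⟩ := exists_isCurry (volume_restrict_cylinder T Ω) v
  rw [← hF.norm_eq (volume_restrict_cylinder T Ω), ← real_inner_self_eq_norm_sq, L2.inner_def]
  have hle : ∀ᵐ t ∂(timeMeasure T), ⟪F t, F t⟫ ≤ M := by
    filter_upwards [hF, hV, ae_restrict_mem measurableSet_Ioo] with t h1 h2 h3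
    have : F t = V t := Lp.ext (by filter_upwards [h1, h2] with x h4 h5; rw [h4, h5])
    rw [this, real_inner_self_eq_norm_sq]
    exact hM t (Ioo_subset_Icc_self h3)
  refine (integral_mono_ae (L2.integrable_inner (𝕜 := ℝ) F F) (integrable_const M) hle).trans ?_
  simp [hT]

/-- The regularity result behind every later step: existence of the trace, the stability estimate,
and the vanishing of the orthogonal complement. The divergence is tested with tensor products only,
since the duality argument supplies no other test functions. -/
theorem exists_trace_curve (hT : 0 < T) (hΩ : IsBoundedLipschitzDomain Ω)
    {v : L2Pair (cylinder T Ω)} {h : L2Q (cylinder T Ω)} {G : L2QVec (cylinder T Ω)}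
    (hdiv : IsTensorWeakDiv v h) (hlat : HasZeroLateralGrad v.fst G) :
    ∃ V : ℝ → L2Ω Ω, ContinuousOn V (Icc 0 T) ∧
      (∀ᵐ t ∂(volume.restrict (Ioo 0 T)), ∀ᵐ x ∂(volume.restrict Ω), V t x = v.fst (t, x)) ∧
      (∀ t ∈ Icc 0 T,
        ‖V t‖ ^ 2 ≤ ‖V 0‖ ^ 2 + 2 * (‖h‖ * ‖v.fst‖) + 1 / 2 * ‖v.snd + G‖ ^ 2) ∧
      (‖V T‖ ^ 2 - ‖V 0‖ ^ 2 = 2 * ⟪h, v.fst⟫ + 2 * ⟪v.snd, G⟫) ∧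
      ∀ (η : ℝ → ℝ), ContDiff ℝ ∞ η → ∀ ψ, IsSpaceTest Ω ψ → ∀ w : L2Ω Ω,
        w =ᵐ[volume.restrict Ω] ψ → η T * ⟪V T, w⟫ - η 0 * ⟪V 0, w⟫
          = (∫ z in cylinder T Ω, v.fst z * (deriv η z.1 * ψ z.2))
            + (∫ z in cylinder T Ω, h z * (η z.1 * ψ z.2))
            + ∫ z in cylinder T Ω, ⟪v.snd z, η z.1 • grad ψ z.2⟫ := by
  have hρ := volume_restrict_cylinder T Ω
  have key : ∀ a b : ℝ, ⟪a, b⟫ = a * b := fun a b => by simp [mul_comm]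
  obtain ⟨v', hv'⟩ := exists_isCurry hρ v.fst
  obtain ⟨h', hh'⟩ := exists_isCurry hρ h
  obtain ⟨G', hG'⟩ := exists_isCurry hρ G
  obtain ⟨τ', hτ'⟩ := exists_isCurry hρ v.snd
  have A := (isWeakEvolution_of_isTensorWeakDiv hΩ hdiv hlat hv' hh' hG' hτ').isEvolutionLimit hT
  obtain ⟨V, h1, h2, h3, h4, h5⟩ := A.exists_continuous hT
  refine ⟨V, h1, ?_, ?_, ?_, fun η hη ψ hψ w hw => ?_⟩
  · filter_upwards [h2, hv'] with t e1 e2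
    rw [e1]; exact e2
  · rw [hh'.norm_eq hρ, hv'.norm_eq hρ, (hτ'.add hρ hG').norm_eq hρ] at h3
    exact h3
  · rw [hh'.inner_eq hρ hv', hτ'.inner_eq hρ hG'] at h4
    exact h4
  · have m2 : MemLp (grad ψ) 2 (volume.restrict Ω) :=
      (continuous_grad hψ.1).memLp_of_hasCompactSupport (hasCompactSupport_grad hψ.2)
    have e := h5 η (hη.of_le (by simp)) (w, m2.toLp)
      (subset_closure ⟨ψ, hψ, hw, m2.coeFn_toLp⟩)
    have a1 := inner_toL2_smul_eq hv' (hη.continuous_deriv (by simp)) hw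
      ((hη.continuous_deriv (by simp)).smul continuous_const)
    have a2 := inner_toL2_smul_eq hh' hη.continuous hw (hη.continuous.smul continuous_const)
    have a3 := inner_toL2_smul_eq hτ' hη.continuous m2.coeFn_toLp
      (hη.continuous.smul continuous_const)
    simp only [key, smul_eq_mul] at a1 a2
    exact e.trans (congrArg₂ (· + ·) (congrArg₂ (· + ·) a1 a2) a3)

/-! ### Uniqueness of initial traces, weak divergences and weak gradients -/

theorem IsInitialTrace.unique {v : L2Q (cylinder T Ω)} (hT : 0 < T) {g g' : L2Ω Ω}
    (h : IsInitialTrace v g) (h' : IsInitialTrace v g') : g = g' := by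
  obtain ⟨V, h1, h2, rfl⟩ := h
  obtain ⟨V', h1', h2', rfl⟩ := h'
  have hae : V =ᵐ[volume.restrict (Ioo 0 T)] V' := by
    filter_upwards [h2, h2'] with t e1 e2
    exact Lp.ext (by filter_upwards [e1, e2] with x e3 e4; rw [e3, e4])
  rw [Measure.restrict_congr_set Ioo_ae_eq_Icc] at hae
  exact Measure.eqOn_Icc_of_ae_eq _ hT.ne hae h1 h1' ⟨le_rfl, hT.le⟩

theorem γ₀_eq {v : L2Pair (cylinder T Ω)} (hT : 0 < T) {g : L2Ω Ω}
    (h : IsInitialTrace v.fst g) : γ₀ v = g := by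
  have hex : ∃ g, IsInitialTrace v.fst g := ⟨g, h⟩
  rw [γ₀, dif_pos hex]
  exact hex.choose_spec.unique hT h

theorem ae_eq_zero_of_integral_test {E : Type*} [NormedAddCommGroup E] [NormedSpace ℝ E]
    [FiniteDimensional ℝ E] [MeasurableSpace E] [BorelSpace E] {μ : Measure E}
    [IsLocallyFiniteMeasure μ] {Q : Set E} (hQ : IsOpen Q) {f : E → ℝ}
    (hf : MemLp f 2 (μ.restrict Q))
    (h : ∀ φ : E → ℝ, ContDiff ℝ ∞ φ ∧ HasCompactSupport φ ∧ tsupport φ ⊆ Q →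
      ∫ z in Q, f z * φ z ∂μ = 0) :
    f =ᵐ[μ.restrict Q] 0 := by
  have hl : LocallyIntegrableOn f Q μ :=
    (locallyIntegrableOn_of_locallyIntegrable_restrict (hf.locallyIntegrable (by norm_num)))
  have := hQ.ae_eq_zero_of_integral_contDiff_smul_eq_zero hl fun φ h1 h2 h3 => by
    rw [← h φ ⟨h1, h2, h3⟩, ← integral_indicator hQ.measurableSet]
    refine integral_congr_ae (ae_of_all _ fun z => ?_)
    by_cases hz : z ∈ Q
    · simp [hz, mul_comm]
    · have : φ z = 0 := by_contra fun h0 => hz (h3 (subset_tsupport _ h0))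
      simp [hz, this]
  exact (ae_restrict_iff' hQ.measurableSet).2 this

theorem eq_of_inner_test_eq (hΩ : IsOpen Ω) {u u' : L2Ω Ω}
    (h : ∀ ψ, IsSpaceTest Ω ψ → ∀ w : L2Ω Ω, w =ᵐ[volume.restrict Ω] ψ → ⟪u, w⟫ = ⟪u', w⟫) :
    u = u' := by
  rw [← sub_eq_zero]
  refine Lp.ext ((ae_eq_zero_of_integral_test hΩ (Lp.memLp (u - u')) fun ψ hψ => ?_).trans
    (Lp.coeFn_zero _ _ _).symm)
  have m : MemLp ψ 2 (volume.restrict Ω) := hψ.1.continuous.memLp_of_hasCompactSupport hψ.2.1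
  have e := h ψ ⟨hψ.1, hψ.2.1, hψ.2.2⟩ m.toLp m.coeFn_toLp
  rw [← sub_eq_zero, ← inner_sub_left, L2.inner_def] at e
  rw [← e]
  refine integral_congr_ae ?_
  filter_upwards [m.coeFn_toLp] with x hx
  rw [hx]
  simp [mul_comm]

theorem integrable_mul_test {Q : Set (TimeSpace d)} {f φ : TimeSpace d → ℝ}
    (hf : MemLp f 2 (volume.restrict Q)) (hφ : Continuous φ) (hc : HasCompactSupport φ) :
    IntegrableOn (fun z => f z * φ z) Q :=
  hf.integrable_mul (hφ.memLp_of_hasCompactSupport hc : MemLp φ 2 (volume.restrict Q))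

theorem IsWeakDiv.unique {Q : Set (TimeSpace d)} (hQ : IsOpen Q) {v : L2Pair Q} {h h' : L2Q Q}
    (H : IsWeakDiv Q v h) (H' : IsWeakDiv Q v h') : h = h' := by
  refine Lp.ext (Filter.EventuallyEq.symm ?_)
  have := ae_eq_zero_of_integral_test hQ ((Lp.memLp h').sub (Lp.memLp h)) fun φ hφ => by
    simp only [Pi.sub_apply, sub_mul]
    rw [integral_sub (integrable_mul_test (Lp.memLp h') hφ.1.continuous hφ.2.1)
      (integrable_mul_test (Lp.memLp h) hφ.1.continuous hφ.2.1), H φ hφ, H' φ hφ, sub_self]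
  filter_upwards [this] with z hz
  exact sub_eq_zero.1 hz

theorem IsWeakGradx.unique {Q : Set (TimeSpace d)} (hQ : IsOpen Q) {v : L2Q Q} {G G' : L2QVec Q}
    (H : IsWeakGradx Q v G) (H' : IsWeakGradx Q v G') : G = G' := by
  have hm : ∀ (G : L2QVec Q) i, MemLp (fun z => G z i) 2 (volume.restrict Q) := fun G i =>
    (Lp.memLp G).continuousLinearMap_comp (EuclideanSpace.proj i : Space d →L[ℝ] ℝ)
  have hi : ∀ i, (fun z => G z i - G' z i) =ᵐ[volume.restrict Q] 0 := fun i => by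
    refine ae_eq_zero_of_integral_test hQ ((hm G i).sub (hm G' i)) fun φ hφ => ?_
    have ht : IsTest Q fun y => φ y • (EuclideanSpace.single i 1 : Space d) :=
      ⟨hφ.1.smul contDiff_const, hφ.2.1.smul_right,
        (tsupport_smul_subset_left φ _).trans hφ.2.2⟩
    have h1 := H _ ht
    rw [← H' _ ht] at h1
    simp only [real_inner_smul_right, EuclideanSpace.inner_single_right] at h1
    simp only [sub_mul]
    rw [integral_sub (integrable_mul_test (hm G i) hφ.1.continuous hφ.2.1)
      (integrable_mul_test (hm G' i) hφ.1.continuous hφ.2.1), sub_eq_zero]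
    simpa [mul_comm] using h1
  refine Lp.ext ?_
  filter_upwards [ae_all_iff.2 hi] with z hz
  ext i
  exact sub_eq_zero.1 (hz i)

theorem HasZeroLateralGrad.isWeakGradx {Q : Set (TimeSpace d)} {v : L2Q Q} {G : L2QVec Q}
    (h : HasZeroLateralGrad v G) : IsWeakGradx Q v G := fun χ hχ => h χ hχ.1

theorem weakGradx_eq {Q : Set (TimeSpace d)} (hQ : IsOpen Q) {v : L2Q Q} {G : L2QVec Q}
    (h : IsWeakGradx Q v G) : weakGradx v = G := by
  have hex : ∃ G, IsWeakGradx Q v G := ⟨G, h⟩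
  rw [weakGradx, dif_pos hex]
  exact hex.choose_spec.unique hQ h

theorem weakDiv_eq {Q : Set (TimeSpace d)} (hQ : IsOpen Q) {v : L2Pair Q} {h : L2Q Q}
    (H : IsWeakDiv Q v h) : weakDiv v = h := by
  have hex : ∃ h, IsWeakDiv Q v h := ⟨h, H⟩
  rw [weakDiv, dif_pos hex]
  exact hex.choose_spec.unique hQ H

theorem isWeakDiv_weakDiv {Q : Set (TimeSpace d)} {v : L2Pair Q} (hv : v ∈ U₀ Q) :
    IsWeakDiv Q v (weakDiv v) := by
  have hex := hv.1.2
  rw [weakDiv, dif_pos hex]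
  exact hex.choose_spec

theorem mem_U₀_of_weak {Q : Set (TimeSpace d)} (hQ : IsOpen Q) {v : L2Pair Q} {h : L2Q Q}
    {G : L2QVec Q} (H : IsWeakDiv Q v h) (hG : HasZeroLateralGrad v.fst G) : v ∈ U₀ Q := by
  refine ⟨⟨⟨G, hG.isWeakGradx⟩, ⟨h, H⟩⟩, ?_⟩
  rw [weakGradx_eq hQ hG.isWeakGradx]
  exact hG

theorem opA_eq {Q : Set (TimeSpace d)} (hQ : IsOpen Q) {v : L2Pair Q} {h : L2Q Q}
    {G : L2QVec Q} (H : IsWeakDiv Q v h) (hG : HasZeroLateralGrad v.fst G) :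
    opA v = WithLp.toLp 2 (h, G + v.snd) := by
  rw [opA, weakDiv_eq hQ H, weakGradx_eq hQ hG.isWeakGradx]

theorem isOpen_cylinder (T : ℝ) (hΩ : IsOpen Ω) : IsOpen (cylinder T Ω) := isOpen_Ioo.prod hΩ

theorem exists_isInitialTrace (hT : 0 < T) (hΩ : IsBoundedLipschitzDomain Ω)
    {v : L2Pair (cylinder T Ω)} (hv : v ∈ U₀ (cylinder T Ω)) :
    ∃ g, IsInitialTrace v.fst g := by
  obtain ⟨V, h1, h2, -⟩ := exists_trace_curve hT hΩ (.of_isWeakDiv (isWeakDiv_weakDiv hv)) hv.2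
  exact ⟨V 0, V, h1, h2, rfl⟩

/-- The stability estimate for the heat equation. -/
theorem exists_isStabilityConstant (hT : 0 < T) (hΩ : IsBoundedLipschitzDomain Ω) :
    ∃ c, IsStabilityConstant T Ω c := by
  -- The denominator dominates the three coefficients `6T + 2`, `3T + 4` and `12T² + 2` that appear
  -- in `q4`.
  refine ⟨(12 * T ^ 2 + 6 * T + 4)⁻¹, by positivity, fun v hv => ?_⟩
  obtain ⟨V, h1, h2, h3, h4, -⟩ := exists_trace_curve hT hΩ (.of_isWeakDiv (isWeakDiv_weakDiv hv)) hv.2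
  rw [γ₀_eq hT ⟨V, h1, h2, rfl⟩, WithLp.prod_norm_sq_eq_of_L2, WithLp.prod_norm_sq_eq_of_L2,
    inv_mul_le_iff₀ (by positivity)]
  have h5 := sq_norm_le_of_isCurry hT.le h2 h3
  simp only [opA, WithLp.toLp_fst, WithLp.toLp_snd]
  set G := weakGradx v.fst
  set h := weakDiv v
  have e1 : v.snd = (G + v.snd) - G := by abel
  -- Substituting `τ = (G + τ) - G` exposes the dissipation `-2‖G‖²` in the energy identity.
  have e2 : 2 * ⟪v.snd, G⟫ = 2 * ⟪G + v.snd, G⟫ - 2 * ‖G‖ ^ 2 := by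
    rw [inner_add_left, real_inner_self_eq_norm_sq]; ring
  have e3 : ‖v.snd‖ ≤ ‖G + v.snd‖ + ‖G‖ := by
    conv_lhs => rw [e1]
    exact norm_sub_le _ _
  rw [add_comm v.snd G] at h5
  have e4 := real_inner_le_norm (G + v.snd) G
  have e5 := real_inner_le_norm h v.fst
  have p1 := norm_nonneg (V 0)
  have p2 := norm_nonneg h
  have p3 := norm_nonneg v.fst
  have p4 := norm_nonneg (G + v.snd)
  have p5 := norm_nonneg G
  have p6 := norm_nonneg v.snd
  have p7 := sq_nonneg ‖V T‖
  rw [e2] at h4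
  generalize ‖V 0‖ = g at *
  generalize ‖h‖ = a at *
  generalize ‖v.fst‖ = x at *
  generalize ‖G + v.snd‖ = b at *
  generalize ‖G‖ = N at *
  generalize ‖v.snd‖ = y at *
  -- The pointwise bound integrated over `(0, T)`, with `2T a x ≤ x²/2 + 2T² a²` absorbed on the
  -- left.
  have q1 : x ^ 2 ≤ 2 * T * g ^ 2 + T * b ^ 2 + 4 * T ^ 2 * a ^ 2 := by
    nlinarith [sq_nonneg (x - 2 * T * a)]
  -- The energy identity after dropping `‖V T‖²`, with `2ax ≤ a² + x²` and `2bN ≤ b² + N²`; one of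
  -- the two `N²` is absorbed.
  have q2 : N ^ 2 ≤ g ^ 2 + a ^ 2 + x ^ 2 + b ^ 2 := by
    nlinarith [sq_nonneg (a - x), sq_nonneg (b - N)]
  have q3 : y ^ 2 ≤ 2 * b ^ 2 + 2 * N ^ 2 := by
    nlinarith [sq_nonneg (b - N), mul_self_le_mul_self p6 e3]
  have q4 : x ^ 2 + y ^ 2 ≤ (6 * T + 2) * g ^ 2 + (3 * T + 4) * b ^ 2
      + (12 * T ^ 2 + 2) * a ^ 2 := by linarith
  have r1 : 0 ≤ T ^ 2 * g ^ 2 := by positivity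
  have r2 : 0 ≤ T ^ 2 * b ^ 2 := by positivity
  have r3 : 0 ≤ T * a ^ 2 := by positivity
  have r4 : 0 ≤ T * b ^ 2 := by positivity
  have r5 := sq_nonneg a
  have r6 := sq_nonneg g
  refine q4.trans (le_of_sub_nonneg ?_)
  have : (12 * T ^ 2 + 6 * T + 4) * (a ^ 2 + b ^ 2 + g ^ 2) - ((6 * T + 2) * g ^ 2
      + (3 * T + 4) * b ^ 2 + (12 * T ^ 2 + 2) * a ^ 2) = 12 * (T ^ 2 * g ^ 2) + 2 * g ^ 2
      + 12 * (T ^ 2 * b ^ 2) + 3 * (T * b ^ 2) + 6 * (T * a ^ 2) + 2 * a ^ 2 := by ring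
  rw [this]
  positivity

end

section

/-! ### Integration by parts for smooth functions -/

section IntegrationByParts

variable {E : Type*} [NormedAddCommGroup E] [NormedSpace ℝ E] [FiniteDimensional ℝ E]
  [MeasurableSpace E] [BorelSpace E] {μ : Measure E} [μ.IsAddHaarMeasure]

theorem integral_fderiv_mul_eq {f g : E → ℝ} (hf : ContDiff ℝ ∞ f) (hg : ContDiff ℝ ∞ g)
    (hc : HasCompactSupport f ∨ HasCompactSupport g) (v : E) :
    Integrable (fun z => fderiv ℝ f z v * g z) μ ∧ Integrable (fun z => f z * fderiv ℝ g z v) μ ∧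
      ∫ z, fderiv ℝ f z v * g z ∂μ = -∫ z, f z * fderiv ℝ g z v ∂μ := by
  have c1 : Continuous fun z => fderiv ℝ f z v :=
    (hf.continuous_fderiv (by simp)).clm_apply continuous_const
  have c2 : Continuous fun z => fderiv ℝ g z v :=
    (hg.continuous_fderiv (by simp)).clm_apply continuous_const
  have i1 : Integrable (fun z => fderiv ℝ f z v * g z) μ :=
    (c1.mul hg.continuous).integrable_of_hasCompactSupport
      (hc.elim (fun h => (h.fderiv_apply ℝ v).mul_right) fun h => h.mul_left)
  have i2 : Integrable (fun z => f z * fderiv ℝ g z v) μ :=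
    (hf.continuous.mul c2).integrable_of_hasCompactSupport
      (hc.elim (fun h => h.mul_right) fun h => (h.fderiv_apply ℝ v).mul_left)
  have i3 : Integrable (fun z => f z * g z) μ :=
    (hf.continuous.mul hg.continuous).integrable_of_hasCompactSupport
      (hc.elim (fun h => h.mul_right) fun h => h.mul_left)
  refine ⟨i1, i2, ?_⟩
  rw [integral_mul_fderiv_eq_neg_fderiv_mul_of_integrable i1 i2 i3
    (fun x _ => hf.differentiable (by simp) x) fun x _ => hg.differentiable (by simp) x, neg_neg]

theorem fderiv_component {d : ℕ} {χ : E → Space d} (hχ : ContDiff ℝ ∞ χ) (i : Fin d) (z v : E) :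
    fderiv ℝ (fun z => χ z i) z v = fderiv ℝ χ z v i := by
  have h := (EuclideanSpace.proj i : Space d →L[ℝ] ℝ).hasFDerivAt.comp z
    (hχ.differentiable (by simp) z).hasFDerivAt
  have h' : HasFDerivAt (fun z => χ z i) _ z := h
  rw [h'.fderiv]
  rfl

theorem integral_sum_fderiv_mul_eq {d : ℕ} {f : E → ℝ} {χ : E → Space d} (hf : ContDiff ℝ ∞ f)
    (hχ : ContDiff ℝ ∞ χ) (hc : HasCompactSupport f ∨ HasCompactSupport χ) (e : Fin d → E) :
    ∫ z, ∑ i, fderiv ℝ f z (e i) * χ z i ∂μ = -∫ z, f z * ∑ i, fderiv ℝ χ z (e i) i ∂μ := by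
  have key := fun i => integral_fderiv_mul_eq (μ := μ) hf (g := fun z => χ z i)
    ((EuclideanSpace.proj i : Space d →L[ℝ] ℝ).contDiff.comp hχ)
    (hc.imp_right fun h => h.comp_left (g := fun y : Space d => y i) rfl) (e i)
  simp only [fderiv_component hχ] at key
  simp only [Finset.mul_sum]
  rw [integral_finsetSum _ fun i _ => (key i).1, integral_finsetSum _ fun i _ => (key i).2.1,
    ← Finset.sum_neg_distrib]
  exact Finset.sum_congr rfl fun i _ => (key i).2.2

end IntegrationByParts

variable {d : ℕ} {T : ℝ} {Ω : Set (Space d)}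

instance : (volume : Measure (TimeSpace d)).IsAddHaarMeasure := by
  rw [Measure.volume_eq_prod]; infer_instance

theorem setIntegral_dt_mul_eq {K : Set (TimeSpace d)} {f φ : TimeSpace d → ℝ}
    (hf : ContDiff ℝ ∞ f) (hφ : IsTest K φ) :
    ∫ z in K, dt f z * φ z = -∫ z in K, f z * dt φ z := by
  have h0 : ∀ z ∉ K, φ z = 0 := fun z hz => by_contra fun h => hz (hφ.2.2 (subset_tsupport _ h))
  have h1 : ∀ z ∉ K, dt φ z = 0 := fun z hz => by
    have : fderiv ℝ φ z = 0 := fderiv_of_notMem_tsupport ℝ fun h => hz (hφ.2.2 h)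
    simp [dt, this]
  rw [setIntegral_eq_integral_of_forall_compl_eq_zero fun z hz => by rw [h0 z hz, mul_zero],
    setIntegral_eq_integral_of_forall_compl_eq_zero fun z hz => by rw [h1 z hz, mul_zero]]
  exact (integral_fderiv_mul_eq hf hφ.1 (.inr hφ.2.1) (1, 0)).2.2

theorem inner_gradx (f : TimeSpace d → ℝ) (χ : TimeSpace d → Space d) (z : TimeSpace d) :
    ⟪gradx f z, χ z⟫ = ∑ i, fderiv ℝ f z (0, EuclideanSpace.single i 1) * χ z i := by
  rw [space_inner_eq]; rfl

theorem setIntegral_inner_gradx_eq {K : Set (TimeSpace d)} {f : TimeSpace d → ℝ}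
    {χ : TimeSpace d → Space d} (hf : ContDiff ℝ ∞ f) (hχ : ContDiff ℝ ∞ χ)
    (h : IsTest K f ∨ IsTest K χ) :
    ∫ z in K, ⟪gradx f z, χ z⟫ = -∫ z in K, f z * divx χ z := by
  have h0 : ∀ z ∉ K, ⟪gradx f z, χ z⟫ = 0 := fun z hz => by
    rcases h with h | h
    · have : fderiv ℝ f z = 0 := fderiv_of_notMem_tsupport ℝ fun hm => hz (h.2.2 hm)
      simp [inner_gradx, this]
    · have : χ z = 0 := by_contra fun hm => hz (h.2.2 (subset_tsupport _ hm))
      rw [this, inner_zero_right]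
  have h1 : ∀ z ∉ K, f z * divx χ z = 0 := fun z hz => by
    rcases h with h | h
    · have : f z = 0 := by_contra fun hm => hz (h.2.2 (subset_tsupport _ hm))
      rw [this, zero_mul]
    · have : fderiv ℝ χ z = 0 := fderiv_of_notMem_tsupport ℝ fun hm => hz (h.2.2 hm)
      simp [divx, this]
  rw [setIntegral_eq_integral_of_forall_compl_eq_zero h0,
    setIntegral_eq_integral_of_forall_compl_eq_zero h1]
  simp only [inner_gradx]
  exact integral_sum_fderiv_mul_eq hf hχ (h.imp (·.2.1) (·.2.1)) _

/-- Only spatial derivatives occur, so integration by parts is done on each time slice, where `ψ`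
has compact support in `Ω`. No condition on `η` at the ends of the time interval is needed. -/
theorem integral_inner_gradx_tensor (hΩ : IsBoundedLipschitzDomain Ω) {η : ℝ → ℝ}
    (hη : ContDiff ℝ ∞ η) {ψ : Space d → ℝ} (hψ : IsSpaceTest Ω ψ)
    {χ : TimeSpace d → Space d} (hχ : ContDiff ℝ ∞ χ) :
    ∫ z in cylinder T Ω, ⟪η z.1 • grad ψ z.2, χ z⟫
      = -∫ z in cylinder T Ω, (η z.1 * ψ z.2) * divx χ z := by
  have hb : Bornology.IsBounded (cylinder T Ω) := (Metric.isBounded_Ioo 0 T).prod hΩ.isBounded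
  have hi : ∀ f : TimeSpace d → ℝ, Continuous f → IntegrableOn f (cylinder T Ω) := fun f hf =>
    (hf.continuousOn.integrableOn_compact hb.isCompact_closure).mono_set subset_closure
  have c1 : Continuous fun z : TimeSpace d => η z.1 • grad ψ z.2 :=
    (hη.continuous.comp continuous_fst).smul ((continuous_grad hψ.1).comp continuous_snd)
  have c2 : Continuous fun z : TimeSpace d => (η z.1 * ψ z.2) * divx χ z :=
    (contDiff_tensor hη hψ.1).continuous.mul (continuous_divx hχ)
  rw [cylinder, Measure.volume_eq_prod, setIntegral_prod _ (hi _ (c1.inner hχ.continuous)),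
    setIntegral_prod _ (hi _ c2),
    ← integral_neg]
  refine integral_congr_ae (ae_of_all _ fun t => ?_)
  have hχt : ContDiff ℝ ∞ fun x => χ (t, x) := hχ.comp (contDiff_const.prodMk contDiff_id)
  have hd : ∀ x v, fderiv ℝ (fun x => χ (t, x)) x v = fderiv ℝ χ (t, x) (0, v) := fun x v => by
    have h := (hχ.differentiable (by simp) (t, x)).hasFDerivAt.comp x
      (hasFDerivAt_prodMk_right t x)
    have h' : HasFDerivAt (fun x => χ (t, x)) _ x := h
    rw [h'.fderiv]
    rfl
  have key := integral_sum_fderiv_mul_eq (μ := volume) hψ.1 hχt (.inl hψ.2)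
    fun i => EuclideanSpace.single i 1
  simp only [hd] at key
  have h0 : ∀ x ∉ Ω, ⟪η t • grad ψ x, χ (t, x)⟫ = 0 := fun x hx => by
    have : fderiv ℝ ψ x = 0 := fderiv_of_notMem_tsupport ℝ fun hm => hx (hψ.3 hm)
    simp [space_inner_eq, grad, this]
  have h1 : ∀ x ∉ Ω, (η t * ψ x) * divx χ (t, x) = 0 := fun x hx => by
    have : ψ x = 0 := by_contra fun hm => hx (hψ.3 (subset_tsupport _ hm))
    rw [this, mul_zero, zero_mul]
  simp only
  rw [setIntegral_eq_integral_of_forall_compl_eq_zero h0,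
    setIntegral_eq_integral_of_forall_compl_eq_zero h1]
  simp only [mul_assoc, real_inner_smul_left, integral_const_mul]
  rw [← mul_neg]
  congr 1
  simp only [space_inner_eq]
  exact key

/-! ### Smooth functions in `L²(Q)` -/

theorem isBounded_cylinder (T : ℝ) (hΩ : Bornology.IsBounded Ω) :
    Bornology.IsBounded (cylinder T Ω) := (Metric.isBounded_Ioo 0 T).prod hΩ

theorem exists_Lp_ae_eq {F : Type*} [NormedAddCommGroup F] {Q : Set (TimeSpace d)}
    [SecondCountableTopology F]
    (hQ : Bornology.IsBounded Q) (hm : MeasurableSet Q) {f : TimeSpace d → F} (hf : Continuous f) :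
    ∃ u : Lp F 2 (volume.restrict Q), u =ᵐ[volume.restrict Q] f := by
  obtain ⟨C, hC⟩ := hQ.isCompact_closure.exists_bound_of_continuousOn hf.continuousOn
  have : IsFiniteMeasure (volume.restrict Q) := ⟨by simpa using hQ.measure_lt_top⟩
  have h : MemLp f 2 (volume.restrict Q) := MemLp.of_bound hf.aestronglyMeasurable C (by
    filter_upwards [ae_restrict_mem hm] with z hz using hC z (subset_closure hz))
  exact ⟨h.toLp, h.coeFn_toLp⟩

theorem inner_eq_integral {F α : Type*} [MeasurableSpace α] {μ : Measure α} [NormedAddCommGroup F]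
    [InnerProductSpace ℝ F] {u w : Lp F 2 μ} {f : α → F} (hw : w =ᵐ[μ] f) :
    ⟪u, w⟫ = ∫ z, ⟪u z, f z⟫ ∂μ := by
  rw [L2.inner_def]
  refine integral_congr_ae ?_
  filter_upwards [hw] with z hz
  rw [hz]

theorem inner_eq_integral_mul {α : Type*} [MeasurableSpace α] {μ : Measure α}
    {u w : Lp ℝ 2 μ} {f : α → ℝ} (hw : w =ᵐ[μ] f) : ⟪u, w⟫ = ∫ z, u z * f z ∂μ := by
  rw [inner_eq_integral hw]
  simp [mul_comm]

end

section

variable {d : ℕ} {T : ℝ} {Ω : Set (Space d)}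

/-! ### Weak solutions of the initial-boundary value problem -/

/-- Scalar test functions `φ` together with their initial value `ξ = φ(0, ·)`. -/
def IsInitialTest (T : ℝ) (Ω : Set (Space d)) (φ : TimeSpace d → ℝ) (ξ : L2Ω Ω) : Prop :=
  (IsTest (cylinder T Ω) φ ∧ ξ = 0) ∨
    ∃ (η : ℝ → ℝ) (ψ : Space d → ℝ), ContDiff ℝ ∞ η ∧ η T = 0 ∧ IsSpaceTest Ω ψ ∧
      (φ = fun z => η z.1 * ψ z.2) ∧ ξ =ᵐ[volume.restrict Ω] fun x => η 0 * ψ x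

theorem IsInitialTest.contDiff {φ : TimeSpace d → ℝ} {ξ : L2Ω Ω} (h : IsInitialTest T Ω φ ξ) :
    ContDiff ℝ ∞ φ := by
  rcases h with ⟨h, -⟩ | ⟨η, ψ, hη, -, hψ, rfl, -⟩
  · exact h.1
  · exact contDiff_tensor hη hψ.1

/-- `z` is a weak solution of `A z = f`, `z.fst(0, ·) = g`. -/
structure IsWeakSolution (z f : L2Pair (cylinder T Ω)) (g : L2Ω Ω) : Prop where
  lateral : HasZeroLateralGrad z.fst (f.snd - z.snd)
  eq : ∀ φ ξ, IsInitialTest T Ω φ ξ → (∫ y in cylinder T Ω, f.fst y * φ y) + ⟪g, ξ⟫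
    = -((∫ y in cylinder T Ω, z.fst y * dt φ y) + ∫ y in cylinder T Ω, ⟪z.snd y, gradx φ y⟫)

theorem exists_space_ae_eq {ψ : Space d → ℝ} (hψ : IsSpaceTest Ω ψ) :
    ∃ w : L2Ω Ω, w =ᵐ[volume.restrict Ω] ψ :=
  have m : MemLp ψ 2 (volume.restrict Ω) := hψ.1.continuous.memLp_of_hasCompactSupport hψ.2
  ⟨m.toLp, m.coeFn_toLp⟩

/-- Interior test functions give the definition of the weak divergence. For tensor products the
integrated identity of `exists_trace_curve` applies; the contribution at time `T` drops out because
`η T = 0`. -/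
theorem isWeakSolution_opA (hT : 0 < T) (hΩ : IsBoundedLipschitzDomain Ω)
    {v : L2Pair (cylinder T Ω)} (hv : v ∈ U₀ (cylinder T Ω)) :
    IsWeakSolution v (opA v) (γ₀ v) := by
  have hdiv := isWeakDiv_weakDiv hv
  refine ⟨?_, ?_⟩
  · have e : (opA v).snd - v.snd = weakGradx v.fst := by simp [opA]
    rw [e]
    exact hv.2
  · rintro φ ξ (⟨hφ, rfl⟩ | ⟨η, ψ, hη, hηT, hψ, rfl, hξ⟩)
    · rw [inner_zero_right, add_zero]
      exact hdiv φ hφ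
    · obtain ⟨V, h1, h2, -, -, h5⟩ := exists_trace_curve hT hΩ (.of_isWeakDiv hdiv) hv.2
      obtain ⟨w, hw⟩ := exists_space_ae_eq hψ
      have e := h5 η hη ψ hψ w hw
      have hξw : ξ = η 0 • w := Lp.ext (by
        filter_upwards [hξ, hw, Lp.coeFn_smul (η 0) w] with x a1 a2 a3
        rw [a1, a3, Pi.smul_apply, a2, smul_eq_mul])
      rw [γ₀_eq hT ⟨V, h1, h2, rfl⟩, hξw, real_inner_smul_right]
      simp only [dt_tensor hη hψ.1, gradx_tensor hη hψ.1]
      rw [hηT] at e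
      change (∫ z in cylinder T Ω, weakDiv v z * (η z.1 * ψ z.2)) + _ = _
      linarith

namespace IsWeakSolution

variable {z f : L2Pair (cylinder T Ω)} {g : L2Ω Ω}

theorem isWeakDiv (h : IsWeakSolution z f g) : IsWeakDiv (cylinder T Ω) z f.fst := fun φ hφ => by
  simpa using h.eq φ 0 (.inl ⟨hφ, rfl⟩)

theorem mem_U₀ (hΩ : IsBoundedLipschitzDomain Ω) (h : IsWeakSolution z f g) :
    z ∈ U₀ (cylinder T Ω) :=
  mem_U₀_of_weak (isOpen_cylinder T hΩ.isOpen) h.isWeakDiv h.lateral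

theorem opA_eq (hΩ : IsBoundedLipschitzDomain Ω) (h : IsWeakSolution z f g) : opA z = f := by
  rw [HeatDPG.opA_eq (isOpen_cylinder T hΩ.isOpen) h.isWeakDiv h.lateral, sub_add_cancel]
  rfl

theorem γ₀_eq (hT : 0 < T) (hΩ : IsBoundedLipschitzDomain Ω) (h : IsWeakSolution z f g) :
    γ₀ z = g := by
  obtain ⟨V, h1, h2, -, -, h5⟩ := exists_trace_curve hT hΩ (.of_isWeakDiv h.isWeakDiv) h.lateral
  rw [HeatDPG.γ₀_eq hT ⟨V, h1, h2, rfl⟩]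
  refine eq_of_inner_test_eq hΩ.isOpen fun ψ hψ w hw => ?_
  -- A weight that vanishes at `T` and equals `T ≠ 0` at the initial time, so comparing the two
  -- identities isolates the initial value.
  have hη : ContDiff ℝ ∞ fun t : ℝ => T - t := contDiff_const.sub contDiff_id
  have e := h5 _ hη ψ hψ w hw
  have e' := h.eq (fun z => (T - z.1) * ψ z.2) (T • w) (.inr ⟨_, ψ, hη, sub_self T, hψ, rfl, by
    filter_upwards [hw, Lp.coeFn_smul T w] with x a1 a2
    rw [a2, Pi.smul_apply, a1, smul_eq_mul, sub_zero]⟩)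
  simp only [dt_tensor hη hψ.1, gradx_tensor hη hψ.1] at e'
  rw [real_inner_smul_right] at e'
  simp only [sub_self, zero_mul, sub_zero] at e
  refine mul_left_cancel₀ hT.ne' ?_
  linarith

end IsWeakSolution

/-! ### Smooth test triples -/

/-- The triples `((0, χ), A* (0, χ), 0)` for smooth `χ`. -/
def fieldTests (T : ℝ) (Ω : Set (Space d)) : Set (Triple T Ω) :=
  {s | ∃ χ : TimeSpace d → Space d, ContDiff ℝ ∞ χ ∧
    ∃ (p : L2QVec (cylinder T Ω)) (q : L2Q (cylinder T Ω)),
      p =ᵐ[volume.restrict (cylinder T Ω)] χ ∧ q =ᵐ[volume.restrict (cylinder T Ω)] divx χ ∧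
      s = WithLp.toLp 2 (WithLp.toLp 2 (0, p), WithLp.toLp 2 (WithLp.toLp 2 (-q, p), 0))}

/-- The triples `((φ, 0), A* (φ, 0), φ(0, ·))`. -/
def scalarTests (T : ℝ) (Ω : Set (Space d)) : Set (Triple T Ω) :=
  {s | ∃ φ ξ, IsInitialTest T Ω φ ξ ∧
    ∃ (p q : L2Q (cylinder T Ω)) (r : L2QVec (cylinder T Ω)),
      p =ᵐ[volume.restrict (cylinder T Ω)] φ ∧ q =ᵐ[volume.restrict (cylinder T Ω)] dt φ ∧
      r =ᵐ[volume.restrict (cylinder T Ω)] gradx φ ∧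
      s = WithLp.toLp 2 (WithLp.toLp 2 (p, 0), WithLp.toLp 2 (WithLp.toLp 2 (-q, -r), ξ))}

theorem inner_toLp {Q : Set (TimeSpace d)} (z : L2Pair Q) (p : L2Q Q) (q : L2QVec Q) :
    ⟪z, WithLp.toLp 2 (p, q)⟫ = ⟪z.fst, p⟫ + ⟪z.snd, q⟫ := by
  rw [WithLp.prod_inner_apply]
  rfl

/-- The lateral condition and the equation are one family of identities `⟨z, A* s⟩ = ⟨f, s⟩ + ⟨g,
ξ⟩`, linear and continuous in `(z, f, g)`. In this form the solution graph is visibly closed, and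
the identities can be compared with the Riesz identity in `Y`. -/
theorem isWeakSolution_iff (hΩ : IsBoundedLipschitzDomain Ω) {z f : L2Pair (cylinder T Ω)}
    {g : L2Ω Ω} : IsWeakSolution z f g ↔ ∀ s ∈ fieldTests T Ω ∪ scalarTests T Ω,
      ⟪z, s.snd.fst⟫ = ⟪f, s.fst⟫ + ⟪g, s.snd.snd⟫ := by
  have hb := isBounded_cylinder T hΩ.isBounded
  have hm := (isOpen_cylinder T hΩ.isOpen).measurableSet
  constructor
  · rintro h s (⟨χ, hχ, p, q, hp, hq, rfl⟩ | ⟨φ, ξ, hφ, p, q, r, hp, hq, hr, rfl⟩)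
    · have e := h.lateral χ hχ
      rw [← inner_eq_integral hp, ← inner_eq_integral_mul hq, inner_sub_left] at e
      change ⟪z, WithLp.toLp 2 (-q, p)⟫ = ⟪f, WithLp.toLp 2 (0, p)⟫ + ⟪g, 0⟫
      rw [inner_toLp, inner_toLp, inner_neg_right, inner_zero_right, inner_zero_right]
      linarith
    · have e := h.eq φ ξ hφ
      rw [← inner_eq_integral hr, ← inner_eq_integral_mul hq, ← inner_eq_integral_mul hp] at e
      change ⟪z, WithLp.toLp 2 (-q, -r)⟫ = ⟪f, WithLp.toLp 2 (p, 0)⟫ + ⟪g, ξ⟫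
      rw [inner_toLp, inner_toLp, inner_neg_right, inner_neg_right, inner_zero_right]
      linarith
  · refine fun h => ⟨fun χ hχ => ?_, fun φ ξ hφ => ?_⟩
    · obtain ⟨p, hp⟩ := exists_Lp_ae_eq hb hm hχ.continuous
      obtain ⟨q, hq⟩ := exists_Lp_ae_eq hb hm (continuous_divx hχ)
      have e := h _ (.inl ⟨χ, hχ, p, q, hp, hq, rfl⟩)
      change ⟪z, WithLp.toLp 2 (-q, p)⟫ = ⟪f, WithLp.toLp 2 (0, p)⟫ + ⟪g, 0⟫ at e
      rw [inner_toLp, inner_toLp, inner_neg_right, inner_zero_right, inner_zero_right] at e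
      rw [← inner_eq_integral hp, ← inner_eq_integral_mul hq, inner_sub_left]
      linarith
    · obtain ⟨p, hp⟩ := exists_Lp_ae_eq hb hm hφ.contDiff.continuous
      obtain ⟨q, hq⟩ := exists_Lp_ae_eq hb hm (continuous_dt hφ.contDiff)
      obtain ⟨r, hr⟩ := exists_Lp_ae_eq hb hm (continuous_gradx hφ.contDiff)
      have e := h _ (.inr ⟨φ, ξ, hφ, p, q, r, hp, hq, hr, rfl⟩)
      change ⟪z, WithLp.toLp 2 (-q, -r)⟫ = ⟪f, WithLp.toLp 2 (p, 0)⟫ + ⟪g, ξ⟫ at e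
      rw [inner_toLp, inner_toLp, inner_neg_right, inner_neg_right, inner_zero_right] at e
      rw [← inner_eq_integral hr, ← inner_eq_integral_mul hq, ← inner_eq_integral_mul hp]
      linarith

/-- Smooth test triples belong to the broken test space, by integration by parts in the cells. -/
theorem tests_subset_Y (P : Partition (cylinder T Ω)) :
    fieldTests T Ω ∪ scalarTests T Ω ⊆ Y P := by
  rintro s (⟨χ, hχ, p, q, hp, hq, rfl⟩ | ⟨φ, ξ, hφ, p, q, r, hp, hq, hr, rfl⟩) K hK
  · have hp' := ae_mono (Measure.restrict_mono_set volume (P.subset K hK)) hp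
    have hq' := ae_mono (Measure.restrict_mono_set volume (P.subset K hK)) hq
    have h0 := ae_mono (Measure.restrict_mono_set volume (P.subset K hK))
      (Lp.coeFn_zero ℝ 2 (volume.restrict (cylinder T Ω)))
    have h0' := ae_mono (Measure.restrict_mono_set volume (P.subset K hK))
      (Lp.coeFn_zero (Space d) 2 (volume.restrict (cylinder T Ω)))
    refine ⟨fun φ hφ => ?_, fun χ' hχ' => ?_⟩
    · change ∫ z in K, (-(-q) : L2Q (cylinder T Ω)) z * φ z
        = -((∫ z in K, (0 : L2Q (cylinder T Ω)) z * dt φ z) + ∫ z in K, ⟪p z, gradx φ z⟫)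
      have e := setIntegral_inner_gradx_eq hφ.1 hχ (.inl hφ)
      have e1 : ∫ z in K, (-(-q) : L2Q (cylinder T Ω)) z * φ z = ∫ z in K, φ z * divx χ z :=
        integral_congr_ae (by filter_upwards [hq'] with z h; rw [neg_neg, h, mul_comm])
      have e2 : ∫ z in K, (0 : L2Q (cylinder T Ω)) z * dt φ z = 0 :=
        integral_eq_zero_of_ae (by filter_upwards [h0] with z h; rw [h]; simp)
      have e3 : ∫ z in K, ⟪p z, gradx φ z⟫ = ∫ z in K, ⟪gradx φ z, χ z⟫ :=
        integral_congr_ae (by filter_upwards [hp'] with z h; rw [h, real_inner_comm])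
      rw [e1, e2, e3, e]
      ring
    · change ∫ z in K, ⟪(p - p : L2QVec (cylinder T Ω)) z, χ' z⟫
        = -∫ z in K, (0 : L2Q (cylinder T Ω)) z * divx χ' z
      rw [sub_self, integral_eq_zero_of_ae, integral_eq_zero_of_ae, neg_zero]
      · filter_upwards [h0] with z h; rw [h]; simp
      · filter_upwards [h0'] with z h; rw [h]; simp
  · have hp' := ae_mono (Measure.restrict_mono_set volume (P.subset K hK)) hp
    have hq' := ae_mono (Measure.restrict_mono_set volume (P.subset K hK)) hq
    have hr' := ae_mono (Measure.restrict_mono_set volume (P.subset K hK)) hr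
    have h0' := ae_mono (Measure.restrict_mono_set volume (P.subset K hK))
      (Lp.coeFn_zero (Space d) 2 (volume.restrict (cylinder T Ω)))
    refine ⟨fun φ' hφ' => ?_, fun χ' hχ' => ?_⟩
    · change ∫ z in K, (-(-q) : L2Q (cylinder T Ω)) z * φ' z
        = -((∫ z in K, p z * dt φ' z)
          + ∫ z in K, ⟪(0 : L2QVec (cylinder T Ω)) z, gradx φ' z⟫)
      have e := setIntegral_dt_mul_eq hφ.contDiff hφ'
      have e1 : ∫ z in K, (-(-q) : L2Q (cylinder T Ω)) z * φ' z = ∫ z in K, dt φ z * φ' z :=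
        integral_congr_ae (by filter_upwards [hq'] with z h; rw [neg_neg, h])
      have e2 : ∫ z in K, p z * dt φ' z = ∫ z in K, φ z * dt φ' z :=
        integral_congr_ae (by filter_upwards [hp'] with z h; rw [h])
      have e3 : ∫ z in K, ⟪(0 : L2QVec (cylinder T Ω)) z, gradx φ' z⟫ = 0 :=
        integral_eq_zero_of_ae (by filter_upwards [h0'] with z h; rw [h]; simp)
      rw [e1, e2, e3, e, add_zero]
    · change ∫ z in K, ⟪(0 - -r : L2QVec (cylinder T Ω)) z, χ' z⟫ = -∫ z in K, p z * divx χ' z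
      have e := setIntegral_inner_gradx_eq hφ.contDiff hχ'.1 (.inr hχ')
      have e1 : ∫ z in K, ⟪(0 - -r : L2QVec (cylinder T Ω)) z, χ' z⟫
          = ∫ z in K, ⟪gradx φ z, χ' z⟫ :=
        integral_congr_ae (by filter_upwards [hr'] with z h; rw [zero_sub, neg_neg, h])
      have e2 : ∫ z in K, p z * divx χ' z = ∫ z in K, φ z * divx χ' z :=
        integral_congr_ae (by filter_upwards [hp'] with z h; rw [h])
      rw [e1, e2, e]

end

section

variable {d : ℕ} {T : ℝ} {Ω : Set (Space d)}

/-! ### Smooth weak solutions -/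

theorem IsInitialTest.integral_inner_gradx (hΩ : IsBoundedLipschitzDomain Ω)
    {φ : TimeSpace d → ℝ} {ξ : L2Ω Ω} (h : IsInitialTest T Ω φ ξ) {χ : TimeSpace d → Space d}
    (hχ : ContDiff ℝ ∞ χ) :
    ∫ z in cylinder T Ω, ⟪gradx φ z, χ z⟫ = -∫ z in cylinder T Ω, φ z * divx χ z := by
  rcases h with ⟨h, -⟩ | ⟨η, ψ, hη, -, hψ, rfl, -⟩
  · exact setIntegral_inner_gradx_eq h.1 hχ (.inl h)
  · simp only [gradx_tensor hη hψ.1]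
    exact integral_inner_gradx_tensor hΩ hη hψ hχ

theorem integral_coeFn_zero_mul {α : Type*} [MeasurableSpace α] {μ : Measure α} (f : α → ℝ) :
    ∫ z, (0 : Lp ℝ 2 μ) z * f z ∂μ = 0 :=
  integral_eq_zero_of_ae (by filter_upwards [Lp.coeFn_zero ℝ 2 μ] with z h; rw [h]; simp)

theorem integral_inner_coeFn_zero {α F : Type*} [MeasurableSpace α] {μ : Measure α}
    [NormedAddCommGroup F] [InnerProductSpace ℝ F] (f : α → F) :
    ∫ z, ⟪(0 : Lp F 2 μ) z, f z⟫ ∂μ = 0 :=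
  integral_eq_zero_of_ae (by filter_upwards [Lp.coeFn_zero F 2 μ] with z h; rw [h]; simp)

/-- Explicit elements of the range of `(A, γ₀)`. The first component is zero, so `χ` needs no
boundary condition. -/
theorem isWeakSolution_field (hΩ : IsBoundedLipschitzDomain Ω) {χ : TimeSpace d → Space d}
    (hχ : ContDiff ℝ ∞ χ) {p : L2QVec (cylinder T Ω)} {q : L2Q (cylinder T Ω)}
    (hp : p =ᵐ[volume.restrict (cylinder T Ω)] χ)
    (hq : q =ᵐ[volume.restrict (cylinder T Ω)] divx χ) :
    IsWeakSolution (WithLp.toLp 2 (0, p)) (WithLp.toLp 2 (q, p)) (0 : L2Ω Ω) := by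
  refine ⟨?_, fun φ ξ hφ => ?_⟩
  · change HasZeroLateralGrad 0 (p - p)
    intro χ' _
    rw [sub_self, integral_inner_coeFn_zero, integral_coeFn_zero_mul, neg_zero]
  · change (∫ y in cylinder T Ω, q y * φ y) + ⟪0, ξ⟫
      = -((∫ y in cylinder T Ω, (0 : L2Q (cylinder T Ω)) y * dt φ y)
        + ∫ y in cylinder T Ω, ⟪p y, gradx φ y⟫)
    have e1 : ∫ y in cylinder T Ω, q y * φ y = ∫ y in cylinder T Ω, φ y * divx χ y :=
      integral_congr_ae (by filter_upwards [hq] with z h; rw [h, mul_comm])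
    have e2 : ∫ y in cylinder T Ω, ⟪p y, gradx φ y⟫ = ∫ y in cylinder T Ω, ⟪gradx φ y, χ y⟫ :=
      integral_congr_ae (by filter_upwards [hp] with z h; rw [h, real_inner_comm])
    rw [e1, e2, integral_coeFn_zero_mul, hφ.integral_inner_gradx hΩ hχ, inner_zero_left]
    ring

/-- Further explicit elements of the range. Nothing is required of `η` at time `T`; this freedom
yields the terminal condition of the dual problem. -/
theorem isWeakSolution_tensor (hT : 0 < T) (hΩ : IsBoundedLipschitzDomain Ω) {η : ℝ → ℝ}
    (hη : ContDiff ℝ ∞ η) {ψ : Space d → ℝ} (hψ : IsSpaceTest Ω ψ)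
    {p q : L2Q (cylinder T Ω)} {r : L2QVec (cylinder T Ω)} {w : L2Ω Ω}
    (hp : p =ᵐ[volume.restrict (cylinder T Ω)] fun z => η z.1 * ψ z.2)
    (hq : q =ᵐ[volume.restrict (cylinder T Ω)] fun z => deriv η z.1 * ψ z.2)
    (hr : r =ᵐ[volume.restrict (cylinder T Ω)] fun z => η z.1 • grad ψ z.2)
    (hw : w =ᵐ[volume.restrict Ω] ψ) :
    IsWeakSolution (WithLp.toLp 2 (p, 0)) (WithLp.toLp 2 (q, r)) (η 0 • w) := by
  have hQ := isOpen_cylinder T hΩ.isOpen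
  have hlat : HasZeroLateralGrad p r := fun χ hχ => by
    refine Eq.trans (integral_congr_ae ?_) ((integral_inner_gradx_tensor hΩ hη hψ hχ).trans
      (congrArg Neg.neg (integral_congr_ae ?_)))
    · filter_upwards [hr] with z h; rw [h]
    · filter_upwards [hp] with z h; rw [h]
  have hdiv : IsWeakDiv (cylinder T Ω) (WithLp.toLp 2 (p, 0)) q := fun φ hφ => by
    change ∫ z in cylinder T Ω, q z * φ z = -((∫ z in cylinder T Ω, p z * dt φ z)
      + ∫ z in cylinder T Ω, ⟪(0 : L2QVec (cylinder T Ω)) z, gradx φ z⟫)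
    rw [integral_inner_coeFn_zero, add_zero]
    have e := setIntegral_dt_mul_eq (contDiff_tensor hη hψ.1) hφ
    simp only [dt_tensor hη hψ.1] at e
    refine Eq.trans (integral_congr_ae ?_) (e.trans (congrArg Neg.neg (integral_congr_ae ?_)))
    · filter_upwards [hq] with z h; rw [h]
    · filter_upwards [hp] with z h; rw [h]
  have htr : IsInitialTrace p (η 0 • w) := by
    refine ⟨fun t => η t • w, (hη.continuous.smul continuous_const).continuousOn, ?_, rfl⟩
    have hp' : ∀ᵐ z ∂(timeMeasure T).prod (volume.restrict Ω), p z = η z.1 * ψ z.2 :=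
      (congrArg ae (volume_restrict_cylinder T Ω)).symm.le hp
    filter_upwards [Measure.ae_ae_of_ae_prod hp'] with t ht
    filter_upwards [ht, hw, Lp.coeFn_smul (η t) w] with x h1 h2 h3
    rw [h3, h1, Pi.smul_apply, h2, smul_eq_mul]
  have key := isWeakSolution_opA hT hΩ (mem_U₀_of_weak (v := WithLp.toLp 2 (p, 0)) hQ hdiv hlat)
  rw [γ₀_eq (v := WithLp.toLp 2 (p, 0)) hT htr,
    opA_eq (v := WithLp.toLp 2 (p, 0)) hQ hdiv hlat] at key
  have e : r + (WithLp.toLp 2 (p, (0 : L2QVec (cylinder T Ω)))).snd = r := add_zero r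
  rwa [e] at key

/-! ### Surjectivity of `(A, γ₀)` -/

/-- The graph of the solution operator. -/
def solutionGraph (T : ℝ) (Ω : Set (Space d)) :
    Submodule ℝ (L2Pair (cylinder T Ω) × WithLp 2 (L2Pair (cylinder T Ω) × L2Ω Ω)) where
  carrier := {p | ∀ s ∈ fieldTests T Ω ∪ scalarTests T Ω,
    ⟪p.1, s.snd.fst⟫ = ⟪p.2.fst, s.fst⟫ + ⟪p.2.snd, s.snd.snd⟫}
  zero_mem' := fun s _ => by simp
  add_mem' := fun {p q} hp hq s hs => by
    have h1 := hp s hs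
    have h2 := hq s hs
    simp only [Prod.fst_add, Prod.snd_add, WithLp.add_fst, WithLp.add_snd, inner_add_left]
    linarith
  smul_mem' := fun c p hp s hs => by
    have h1 := hp s hs
    simp only [Prod.smul_fst, Prod.smul_snd, WithLp.smul_fst, WithLp.smul_snd,
      real_inner_smul_left, h1]
    ring

theorem mem_solutionGraph (hΩ : IsBoundedLipschitzDomain Ω) {z : L2Pair (cylinder T Ω)}
    {y : WithLp 2 (L2Pair (cylinder T Ω) × L2Ω Ω)} :
    (z, y) ∈ solutionGraph T Ω ↔ IsWeakSolution z y.fst y.snd :=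
  (isWeakSolution_iff hΩ).symm

theorem isClosed_solutionGraph : IsClosed (solutionGraph T Ω : Set (L2Pair (cylinder T Ω) ×
    WithLp 2 (L2Pair (cylinder T Ω) × L2Ω Ω))) := by
  have : (solutionGraph T Ω : Set (L2Pair (cylinder T Ω) ×
      WithLp 2 (L2Pair (cylinder T Ω) × L2Ω Ω))) = ⋂ s ∈ fieldTests T Ω ∪ scalarTests T Ω,
      {p | ⟪p.1, s.snd.fst⟫ = ⟪p.2.fst, s.fst⟫ + ⟪p.2.snd, s.snd.snd⟫} := by
    ext p
    simp only [mem_iInter]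
    rfl
  rw [this]
  have c1 : Continuous fun p : L2Pair (cylinder T Ω) ×
      WithLp 2 (L2Pair (cylinder T Ω) × L2Ω Ω) => p.2.fst :=
    (WithLp.continuous_fst 2 _ _).comp continuous_snd
  have c2 : Continuous fun p : L2Pair (cylinder T Ω) ×
      WithLp 2 (L2Pair (cylinder T Ω) × L2Ω Ω) => p.2.snd :=
    (WithLp.continuous_snd 2 _ _).comp continuous_snd
  exact isClosed_biInter fun s _ => isClosed_eq (continuous_fst.inner continuous_const)
    ((c1.inner continuous_const).add (c2.inner continuous_const))

/-- On a closed graph with `‖p.1‖ ≤ C ‖p.2‖` the projection to the second factor is bounded below,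
and such a map on a complete space has closed range. -/
theorem isClosed_map_snd {E F : Type*} [NormedAddCommGroup E] [NormedSpace ℝ E] [CompleteSpace E]
    [NormedAddCommGroup F] [NormedSpace ℝ F] [CompleteSpace F] {S : Submodule ℝ (E × F)}
    (hS : IsClosed (S : Set (E × F))) {C : ℝ} (hC : 0 ≤ C) (h : ∀ p ∈ S, ‖p.1‖ ≤ C * ‖p.2‖) :
    IsClosed (S.map (LinearMap.snd ℝ E F) : Set F) := by
  have : CompleteSpace S := hS.completeSpace_coe
  let f := (ContinuousLinearMap.snd ℝ E F).comp S.subtypeL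
  have hf : AntilipschitzWith (Real.toNNReal (1 + C)) f := by
    refine AddMonoidHomClass.antilipschitz_of_bound f fun p => ?_
    rw [Real.coe_toNNReal _ (by positivity)]
    refine max_le ((h p.1 p.2).trans ?_) ?_
    · exact mul_le_mul_of_nonneg_right (by linarith) (norm_nonneg _)
    · exact le_mul_of_one_le_left (norm_nonneg p.1.2) (by linarith)
  have hR : (S.map (LinearMap.snd ℝ E F) : Set F) = range f := by
    ext y
    exact ⟨fun ⟨p, hp, e⟩ => ⟨⟨p, hp⟩, e⟩, fun ⟨p, e⟩ => ⟨p.1, p.2, e⟩⟩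
  rw [hR]
  exact hf.isClosed_range f.uniformContinuous

theorem isClosed_range_solutionGraph (hT : 0 < T) (hΩ : IsBoundedLipschitzDomain Ω) :
    IsClosed ((solutionGraph T Ω).map (LinearMap.snd ℝ _ _) :
      Set (WithLp 2 (L2Pair (cylinder T Ω) × L2Ω Ω))) := by
  obtain ⟨c, hc, hst⟩ := exists_isStabilityConstant hT hΩ
  refine isClosed_map_snd isClosed_solutionGraph (Real.sqrt_nonneg c⁻¹) fun p hp => ?_
  have hp := (mem_solutionGraph hΩ).1 hp
  have h1 := hst _ (hp.mem_U₀ hΩ)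
  rw [hp.opA_eq hΩ, hp.γ₀_eq hT hΩ, ← WithLp.prod_norm_sq_eq_of_L2] at h1
  refine (pow_le_pow_iff_left₀ (norm_nonneg _) (by positivity) two_ne_zero).1 ?_
  rw [mul_pow, Real.sq_sqrt (by positivity), ← div_eq_inv_mul, le_div_iff₀ hc, mul_comm]
  exact h1

/-- A function orthogonal to the range of `(A, γ₀)` vanishes. -/
theorem eq_zero_of_orthogonal_range (hT : 0 < T) (hΩ : IsBoundedLipschitzDomain Ω)
    {w : L2Pair (cylinder T Ω)} {ξ : L2Ω Ω}
    (h : ∀ z f g, IsWeakSolution z f g → ⟪f, w⟫ + ⟪g, ξ⟫ = 0) : w = 0 ∧ ξ = 0 := by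
  have hb := isBounded_cylinder T hΩ.isBounded
  have hm := (isOpen_cylinder T hΩ.isOpen).measurableSet
  -- Orthogonality to the elements produced by `(0, χ)` says `∇_x w₁ = w₂`, with `w₁` vanishing on
  -- the lateral boundary.
  have hlat : HasZeroLateralGrad w.fst w.snd := fun χ hχ => by
    obtain ⟨p, hp⟩ := exists_Lp_ae_eq hb hm hχ.continuous
    obtain ⟨q, hq⟩ := exists_Lp_ae_eq hb hm (continuous_divx hχ)
    have e := h _ _ _ (isWeakSolution_field hΩ hχ hp hq)
    rw [real_inner_comm, inner_toLp, inner_zero_left] at e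
    rw [← inner_eq_integral hp, ← inner_eq_integral_mul hq]
    linarith
  have htest : ∀ η : ℝ → ℝ, ContDiff ℝ ∞ η → ∀ ψ, IsSpaceTest Ω ψ → ∀ u : L2Ω Ω,
      u =ᵐ[volume.restrict Ω] ψ →
      (∫ z in cylinder T Ω, w.fst z * (deriv η z.1 * ψ z.2))
        + (∫ z in cylinder T Ω, ⟪w.snd z, η z.1 • grad ψ z.2⟫) + η 0 * ⟪u, ξ⟫ = 0 := by
    intro η hη ψ hψ u hu
    have cη' := hη.continuous_deriv (by simp)
    obtain ⟨p, hp⟩ := exists_Lp_ae_eq hb hm (contDiff_tensor hη hψ.1).continuous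
    obtain ⟨q, hq⟩ := exists_Lp_ae_eq hb hm
      (f := fun z : TimeSpace d => deriv η z.1 * ψ z.2)
      ((cη'.comp continuous_fst).mul (hψ.1.continuous.comp continuous_snd))
    obtain ⟨r, hr⟩ := exists_Lp_ae_eq hb hm
      (f := fun z : TimeSpace d => η z.1 • grad ψ z.2)
      ((hη.continuous.comp continuous_fst).smul ((continuous_grad hψ.1).comp continuous_snd))
    have e := h _ _ _ (isWeakSolution_tensor hT hΩ hη hψ hp hq hr hu)
    rw [real_inner_comm, inner_toLp, real_inner_smul_left] at e
    rw [← inner_eq_integral hr, ← inner_eq_integral_mul hq]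
    exact e
  -- With `η` supported in `(0, T)` the initial term disappears, so `∂_t w₁ + div_x w₂ = 0`: a
  -- backward heat equation.
  have hdiv : IsTensorWeakDiv w 0 := fun η ψ hη _ hs hψ => by
    obtain ⟨u, hu⟩ := exists_space_ae_eq hψ
    have e := htest η hη ψ hψ u hu
    have h0 : η 0 = 0 := image_eq_zero_of_notMem_tsupport fun hmem => (hs hmem).1.ne rfl
    rw [h0, zero_mul, add_zero] at e
    rw [integral_coeFn_zero_mul, e, neg_zero]
  obtain ⟨V, -, h2, h3, h4, h5⟩ := exists_trace_curve hT hΩ hdiv hlat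
  have h6 : ∀ η : ℝ → ℝ, ContDiff ℝ ∞ η → ∀ ψ, IsSpaceTest Ω ψ → ∀ u : L2Ω Ω,
      u =ᵐ[volume.restrict Ω] ψ → η T * ⟪V T, u⟫ - η 0 * ⟪V 0, u⟫ = -(η 0 * ⟪u, ξ⟫) := by
    intro η hη ψ hψ u hu
    have e1 := h5 η hη ψ hψ u hu
    have e2 := htest η hη ψ hψ u hu
    rw [integral_coeFn_zero_mul] at e1
    linarith
  -- The weight `η(t) = t` removes both initial terms and leaves the terminal value.
  have hVT : V T = 0 := eq_of_inner_test_eq hΩ.isOpen fun ψ hψ u hu => by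
    have e := h6 (fun t => t) contDiff_id ψ hψ u hu
    simp only [zero_mul, sub_zero, neg_zero] at e
    rw [inner_zero_left]
    exact (mul_eq_zero.1 e).resolve_left hT.ne'
  -- With zero source, zero terminal value and flux equal to the gradient, the energy identity reads
  -- `-‖V 0‖² = 2‖w₂‖²`, so both sides vanish.
  rw [hVT, norm_zero, inner_zero_left, real_inner_self_eq_norm_sq] at h4
  have hw2 : w.snd = 0 := norm_eq_zero.1 (pow_eq_zero_iff two_ne_zero |>.1 (by
    linarith [sq_nonneg ‖V 0‖, sq_nonneg ‖w.snd‖]))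
  have hV0 : V 0 = 0 := norm_eq_zero.1 (pow_eq_zero_iff two_ne_zero |>.1 (by
    linarith [sq_nonneg ‖V 0‖, sq_nonneg ‖w.snd‖]))
  have hw1 : w.fst = 0 := by
    have := sq_norm_le_of_isCurry hT.le h2 (M := 0) fun t ht => by
      simpa [hV0, hw2] using h3 t ht
    rw [mul_zero] at this
    exact norm_eq_zero.1 (pow_eq_zero_iff two_ne_zero |>.1 (le_antisymm this (sq_nonneg _)))
  refine ⟨WithLp.ofLp_injective 2 (Prod.ext hw1 hw2), ?_⟩
  refine eq_of_inner_test_eq hΩ.isOpen fun ψ hψ u hu => ?_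
  -- With both end values of `V` equal to zero, the constant weight leaves only the pairing with
  -- `ξ`.
  have e := h6 (fun _ => 1) contDiff_const ψ hψ u hu
  simp only [hVT, hV0, inner_zero_left, one_mul, sub_zero] at e
  rw [inner_zero_left, real_inner_comm]
  linarith

/-- The operator `(A, γ₀)` maps `U₀` onto `L²(Q) × L²(Q; ℝ^d) × L²(Ω)`. -/
theorem exists_isWeakSolution (hT : 0 < T) (hΩ : IsBoundedLipschitzDomain Ω)
    (f : L2Pair (cylinder T Ω)) (g : L2Ω Ω) : ∃ z, IsWeakSolution z f g := by
  set R : Submodule ℝ (WithLp 2 (L2Pair (cylinder T Ω) × L2Ω Ω)) :=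
    (solutionGraph T Ω).map (LinearMap.snd ℝ _ _) with hR
  have : CompleteSpace R := (isClosed_range_solutionGraph hT hΩ).completeSpace_coe
  have htop : R = ⊤ := by
    rw [← Submodule.orthogonal_eq_bot_iff, Submodule.eq_bot_iff]
    intro y hy
    obtain ⟨h1, h2⟩ := eq_zero_of_orthogonal_range hT hΩ (w := y.fst) (ξ := y.snd)
      fun z f g hz => by
        have := hy (WithLp.toLp 2 (f, g)) ⟨(z, WithLp.toLp 2 (f, g)),
          (mem_solutionGraph hΩ).2 hz, rfl⟩
        rw [WithLp.prod_inner_apply] at this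
        exact this
    exact WithLp.ofLp_injective 2 (Prod.ext h1 h2)
  have hmem : WithLp.toLp 2 (f, g) ∈ R := htop ▸ Submodule.mem_top
  obtain ⟨⟨z, y⟩, hz, rfl⟩ := hmem
  exact ⟨z, (mem_solutionGraph hΩ).1 hz⟩

end

section

variable {d : ℕ} {T : ℝ} {Ω : Set (Space d)}

/-! ### The broken variational formulation -/

theorem IsWeakSolution.unique (hT : 0 < T) (hΩ : IsBoundedLipschitzDomain Ω)
    {z z' f : L2Pair (cylinder T Ω)} {g : L2Ω Ω} (h : IsWeakSolution z f g)
    (h' : IsWeakSolution z' f g) : z = z' := by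
  obtain ⟨c, hc, hst⟩ := exists_isStabilityConstant hT hΩ
  have h0 : IsWeakSolution (z - z') 0 (0 : L2Ω Ω) := by
    rw [isWeakSolution_iff hΩ] at h h' ⊢
    intro s hs
    rw [inner_sub_left, h s hs, h' s hs, sub_self, inner_zero_left, inner_zero_left, add_zero]
  have h1 := hst _ (h0.mem_U₀ hΩ)
  rw [h0.opA_eq hΩ, h0.γ₀_eq hT hΩ] at h1
  simp only [norm_zero, ne_eq, OfNat.ofNat_ne_zero, not_false_eq_true, zero_pow, add_zero] at h1
  rw [← sub_eq_zero, ← norm_eq_zero]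
  by_contra hne
  have : 0 < ‖z - z'‖ := lt_of_le_of_ne (norm_nonneg _) (Ne.symm hne)
  have : 0 < c * ‖z - z'‖ ^ 2 := by positivity
  linarith

/-! ### Riesz representatives and the boundary term, abstractly -/

section Abstract

theorem inner_prod_prod {A B C : Type*} [NormedAddCommGroup A] [InnerProductSpace ℝ A]
    [NormedAddCommGroup B] [InnerProductSpace ℝ B] [NormedAddCommGroup C] [InnerProductSpace ℝ C]
    (y y' : WithLp 2 (A × WithLp 2 (B × C))) :
    ⟪y, y'⟫ = ⟪y.fst, y'.fst⟫ + (⟪y.snd.fst, y'.snd.fst⟫ + ⟪y.snd.snd, y'.snd.snd⟫) := rfl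

variable {E H Z : Type*} [NormedAddCommGroup E] [InnerProductSpace ℝ E] [NormedAddCommGroup H]
  [InnerProductSpace ℝ H] [NormedAddCommGroup Z] [InnerProductSpace ℝ Z]
  {w a : Z → E} {ξ : Z → H}

/-- Hypothesis `hu` says that the trace term of `u` vanishes on the test element `y`. The Riesz
identity for `r` then no longer contains `u` and becomes the weak equation for `v - a r`. -/
theorem inner_sub_eq_of_riesz
    (hZ : ∀ y y', ⟪y, y'⟫ = ⟪w y, w y'⟫ + (⟪a y, a y'⟫ + ⟪ξ y, ξ y'⟫)) {v u u' : E} {g : H} {r y : Z}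
    (hu : ⟪u, a y⟫ = ⟪u', w y⟫ + ⟪g, ξ y⟫)
    (hr : ⟪r, y⟫ = ⟪v, a y⟫ + (⟪u', w y⟫ - ⟪u, a y⟫ + ⟪g, ξ y⟫)) :
    ⟪v - a r, a y⟫ = ⟪w r, w y⟫ + ⟪ξ r, ξ y⟫ := by
  rw [hZ] at hr
  rw [inner_sub_left]
  linarith

theorem norm_sq_eq_of_inner_eq
    (hZ : ∀ y y', ⟪y, y'⟫ = ⟪w y, w y'⟫ + (⟪a y, a y'⟫ + ⟪ξ y, ξ y'⟫)) (y : Z) :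
    ‖y‖ ^ 2 = ‖w y‖ ^ 2 + (‖a y‖ ^ 2 + ‖ξ y‖ ^ 2) := by
  simp only [← real_inner_self_eq_norm_sq, hZ]

/-- The choice `v = u + a r` makes `⟪u, a y⟫` cancel against the trace term; what remains is the
inner product of `Z` applied to the Riesz representative. -/
theorem add_eq_of_riesz [CompleteSpace Z]
    (hZ : ∀ y y', ⟪y, y'⟫ = ⟪w y, w y'⟫ + (⟪a y, a y'⟫ + ⟪ξ y, ξ y'⟫)) (F : Z →L[ℝ] ℝ) {u u' : E}
    {g : H} {r : Z} (hr : r = (InnerProductSpace.toDual ℝ Z).symm F) (hu : u' = w r) (hg : g = ξ r)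
    (y : Z) : ⟪u + a r, a y⟫ + (⟪u', w y⟫ - ⟪u, a y⟫ + ⟪g, ξ y⟫) = F y := by
  have h : ⟪r, y⟫ = F y := by rw [hr]; exact InnerProductSpace.toDual_symm_apply
  rw [hZ, ← hu, ← hg] at h
  rw [inner_add_left]
  linarith

theorem sub_eq_sub_iff_of_eq {G : Type*} [AddGroup G] {v v' r r' : G} (h : r = r') :
    v - r = v' - r' ↔ v = v' := by
  rw [h, sub_left_inj]

theorem add_eq_add_iff_of_eq {G : Type*} [AddGroup G] {v v' r r' : G} (h : v = v') :
    v + r = v' + r' ↔ r = r' := by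
  rw [h, add_right_inj]

end Abstract

section Broken

variable (P : Partition (cylinder T Ω))

theorem Y.inner_eq (y y' : Y P) :
    ⟪y, y'⟫ = ⟪Y.w P y, Y.w P y'⟫ + (⟪Y.adj P y, Y.adj P y'⟫ + ⟪Y.ξ P y, Y.ξ P y'⟫) :=
  inner_prod_prod (y : Triple T Ω) (y' : Triple T Ω)

theorem b_mk_apply (v : L2Pair (cylinder T Ω)) {u : L2Pair (cylinder T Ω)}
    (hu : u ∈ U₀ (cylinder T Ω)) (y : Y P) :
    b P (v, ⟨γA P u, u, hu, rfl⟩) y = ⟪v, Y.adj P y⟫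
      + (⟪opA u, Y.w P y⟫ - ⟪u, Y.adj P y⟫ + ⟪γ₀ u, Y.ξ P y⟫) := rfl

/-- The extension `ℰ(v, t)` solves `A ℰ = T₁`, `γ₀ ℰ = T₂`. -/
theorem isWeakSolution_extension (hT : 0 < T) (hΩ : IsBoundedLipschitzDomain Ω) (x : X P) :
    IsWeakSolution (extension P x) (Y.w P (trialToTest P x)) (Y.ξ P (trialToTest P x)) := by
  obtain ⟨v, t, u, hu, rfl⟩ := x
  refine (isWeakSolution_iff hΩ).2 fun s hs => ?_
  have h1 := (isWeakSolution_iff hΩ).1 (isWeakSolution_opA hT hΩ hu) s hs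
  have h2 : ⟪trialToTest P (v, ⟨γA P u, u, hu, rfl⟩), (⟨s, tests_subset_Y P hs⟩ : Y P)⟫ = _ :=
    InnerProductSpace.toDual_symm_apply.trans (b_mk_apply P v hu ⟨s, tests_subset_Y P hs⟩)
  exact inner_sub_eq_of_riesz (Y.inner_eq P) (y := ⟨s, tests_subset_Y P hs⟩) h1 h2

theorem trialToTest_eq {x : X P} {F : Y P →L[ℝ] ℝ} (h : ∀ y, b P x y = F y) :
    trialToTest P x = (InnerProductSpace.toDual ℝ (Y P)).symm F :=
  congrArg _ (ContinuousLinearMap.ext h)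

/-- Equal functionals have equal Riesz representatives, so the two extensions solve the same
initial-boundary value problem and coincide. This gives equal volume components, and subtracting
them from the functionals gives equal traces. -/
theorem b_injective (hT : 0 < T) (hΩ : IsBoundedLipschitzDomain Ω) {x x' : X P}
    (h : b P x = b P x') : x = x' := by
  have hT' : trialToTest P x = trialToTest P x' :=
    congrArg (InnerProductSpace.toDual ℝ (Y P)).symm h
  have h1 : IsWeakSolution (extension P x) (Y.w P (trialToTest P x'))
      (Y.ξ P (trialToTest P x')) := hT' ▸ isWeakSolution_extension P hT hΩ x
  have h2 : x.1 - Y.adj P (trialToTest P x) = x'.1 - Y.adj P (trialToTest P x') :=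
    h1.unique hT hΩ (isWeakSolution_extension P hT hΩ x')
  have h3 : x.1 = x'.1 := (sub_eq_sub_iff_of_eq (congrArg (Y.adj P) hT')).1 h2
  exact Prod.ext h3 (Subtype.ext ((add_eq_add_iff_of_eq
    (congrArg (fun v => (innerSL ℝ v).comp (Y.adj P)) h3)).1 h))

theorem b_apply_of_isWeakSolution (hT : 0 < T) (hΩ : IsBoundedLipschitzDomain Ω)
    {F : Y P →L[ℝ] ℝ} {R : Y P} (hR : R = (InnerProductSpace.toDual ℝ (Y P)).symm F)
    {u v : L2Pair (cylinder T Ω)} (hu : IsWeakSolution u (Y.w P R) (Y.ξ P R))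
    (hv : v = u + Y.adj P R) (y : Y P) :
    b P (v, ⟨γA P u, u, hu.mem_U₀ hΩ, rfl⟩) y = F y := by
  refine (b_mk_apply P v (hu.mem_U₀ hΩ) y).trans ?_
  rw [hv]
  exact add_eq_of_riesz (w := Y.w P) (a := Y.adj P) (ξ := Y.ξ P) (Y.inner_eq P) F hR
      (hu.opA_eq hΩ) (hu.γ₀_eq hT hΩ) y

theorem exists_b_eq (hT : 0 < T) (hΩ : IsBoundedLipschitzDomain Ω) (F : Y P →L[ℝ] ℝ) :
    ∃ x : X P, ∀ y, b P x y = F y :=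
  (exists_isWeakSolution hT hΩ _ _).elim fun _ hu =>
    ⟨_, b_apply_of_isWeakSolution P hT hΩ rfl hu rfl⟩

end Broken

/-! ### The inf-sup constant -/

/-- With `s = √(1 + 4c)` the radicand is `s²`, the numerator is `(s - 1)²/2` and the denominator is
`(s² - 1)/2`. -/
theorem infSupConstant_eq {c : ℝ} (hc : 0 < c) :
    infSupConstant c = (√(1 + 4 * c) - 1) / (√(1 + 4 * c) + 1) := by
  have h1 : (1 + 2 * c) ^ 2 - 4 * c ^ 2 = 1 + 4 * c := by ring
  have h2 : √(1 + 4 * c) ^ 2 = 1 + 4 * c := Real.sq_sqrt (by linarith)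
  rw [infSupConstant, h1, div_eq_div_iff (by positivity) (by positivity)]
  linear_combination -h2

theorem one_lt_sqrt {c : ℝ} (hc : 0 < c) : 1 < √(1 + 4 * c) :=
  Real.lt_sqrt_of_sq_lt (by linarith)

theorem infSupConstant_pos {c : ℝ} (hc : 0 < c) : 0 < infSupConstant c := by
  rw [infSupConstant_eq hc]
  have := one_lt_sqrt hc
  exact div_pos (by linarith) (by linarith)

/-- Here `n`, `e`, `δ` stand for the norms of `v`, `ℰ` and `A*_h T₁`, and `a` for `‖A ℰ‖² + ‖γ₀
ℰ‖²`. With `t = √(1 + 4c) - 1` one has `β⁻¹ = (t + 2)/t` and `4c = t² + 2t`, so the claim is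
polynomial in `t`. -/
theorem sq_add_sq_add_le {c e δ n a : ℝ} (hc : 0 < c) (hn : 0 ≤ n)
    (hne : n ≤ e + δ) (ha : c * e ^ 2 ≤ a) :
    n ^ 2 + e ^ 2 + a ≤ (infSupConstant c)⁻¹ ^ 2 * (a + δ ^ 2) := by
  have h1 := one_lt_sqrt hc
  have h2 : √(1 + 4 * c) ^ 2 = 1 + 4 * c := Real.sq_sqrt (by linarith)
  rw [infSupConstant_eq hc, inv_div]
  obtain ⟨t, ht⟩ : ∃ t, √(1 + 4 * c) = t + 1 := ⟨_, (sub_add_cancel _ 1).symm⟩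
  rw [ht] at h1 h2 ⊢
  have ht0 : 0 < t := by linarith
  have hn2 : n ^ 2 ≤ (e + δ) ^ 2 := pow_le_pow_left₀ hn hne 2
  rw [add_sub_cancel_right, div_pow, div_mul_eq_mul_div, le_div_iff₀ (by positivity)]
  have q1 : t ^ 2 * n ^ 2 ≤ t ^ 2 * (e + δ) ^ 2 := mul_le_mul_of_nonneg_left hn2 (sq_nonneg t)
  have q2 : (t + 1) * (4 * c * e ^ 2) ≤ (t + 1) * (4 * a) :=
    mul_le_mul_of_nonneg_left (by linarith) (by linarith)
  have hc4 : 4 * c = t ^ 2 + 2 * t := by linarith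
  rw [hc4] at q2
  -- This is what remains of `(t + 2)² (a + δ²) - t² (n² + e² + a)` after inserting the bounds `q1`
  -- and `q2`, written as a sum of nonnegative terms.
  have q3 : 0 ≤ t * (t * e - δ) ^ 2 + t ^ 2 * e ^ 2 + 2 * t * e ^ 2 + (4 + 3 * t) * δ ^ 2 := by
    positivity
  linarith

theorem sqrt_le_mul_of_sq_eq {n e a g δ N k : ℝ} (hk : 0 ≤ k) (hN : 0 ≤ N)
    (hN2 : N ^ 2 = a ^ 2 + (δ ^ 2 + g ^ 2))
    (h : n ^ 2 + e ^ 2 + (a ^ 2 + g ^ 2) ≤ k ^ 2 * (a ^ 2 + g ^ 2 + δ ^ 2)) :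
    √(n ^ 2 + (e ^ 2 + a ^ 2) + g ^ 2) ≤ k * N := by
  refine Real.sqrt_le_iff.2 ⟨mul_nonneg hk hN, ?_⟩
  rw [mul_pow, hN2]
  linarith

theorem sq_eq_of_eq {n n' a a' δ g g' : ℝ} (hn : n = n') (ha : a = a') (hg : g = g')
    (h : n' ^ 2 = a' ^ 2 + (δ ^ 2 + g' ^ 2)) : n ^ 2 = a ^ 2 + (δ ^ 2 + g ^ 2) := by
  rw [hn, ha, hg, h]

/-- By the Riesz isometry and `isWeakSolution_extension`, `‖F‖²` is the sum of `‖A ℰ‖²`, `‖A*_h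
T₁‖²` and `‖γ₀ ℰ‖²`. The remaining terms of the norm are controlled by stability for `ℰ ∈ U₀` and
the triangle inequality for `v = ℰ + A*_h T₁`. -/
theorem normX_le (hT : 0 < T) (hΩ : IsBoundedLipschitzDomain Ω) (P : Partition (cylinder T Ω))
    {c : ℝ} (hc : IsStabilityConstant T Ω c) {F : Y P →L[ℝ] ℝ} {x : X P}
    (h : ∀ y, b P x y = F y) : normX P x ≤ (infSupConstant c)⁻¹ * ‖F‖ := by
  have hE := isWeakSolution_extension P hT hΩ x
  have e1 : ‖F‖ = ‖trialToTest P x‖ := by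
    rw [trialToTest_eq P h]
    exact ((InnerProductSpace.toDual ℝ (Y P)).symm.norm_map F).symm
  have e2 := norm_sq_eq_of_inner_eq (Y.inner_eq P) (trialToTest P x)
  have e3 : ‖opA (extension P x)‖ = ‖Y.w P (trialToTest P x)‖ := congrArg _ (hE.opA_eq hΩ)
  have e4 : ‖γ₀ (extension P x)‖ = ‖Y.ξ P (trialToTest P x)‖ := congrArg _ (hE.γ₀_eq hT hΩ)
  refine sqrt_le_mul_of_sq_eq (inv_nonneg.2 (infSupConstant_pos hc.1).le) (norm_nonneg F)
    (sq_eq_of_eq e1 e3 e4 e2) (sq_add_sq_add_le hc.1 (norm_nonneg x.1)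
      (norm_le_norm_sub_add x.1 (Y.adj P (trialToTest P x))) (hc.2 _ (hE.mem_U₀ hΩ)))

end

end HeatDPG

end

open HeatDPG in
theorem mainTheorem1 {d : ℕ} (hd : 1 ≤ d) {T : ℝ} (hT : 0 < T) {Ω : Set (Space d)}
    (hΩ : IsBoundedLipschitzDomain Ω) (P : HeatDPG.Partition (cylinder T Ω)) :
    -- the initial trace exists on `U₀`, and the extension operator maps into `U₀`
    (∀ v ∈ U₀ (cylinder T Ω), ∃ g, IsInitialTrace v.fst g) ∧
    (∀ x : X P, extension P x ∈ U₀ (cylinder T Ω)) ∧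
    -- existence and uniqueness of solutions
    (∀ F : Y P →L[ℝ] ℝ, ∃! x : X P, ∀ y : Y P, b P x y = F y) ∧
    -- the constant `c_L` exists, and solutions are bounded by `β⁻¹ ‖F‖`
    (∃ c, IsStabilityConstant T Ω c) ∧
    (∀ c, IsStabilityConstant T Ω c → 0 < infSupConstant c ∧
      ∀ (F : Y P →L[ℝ] ℝ) (x : X P), (∀ y : Y P, b P x y = F y) →
        normX P x ≤ (infSupConstant c)⁻¹ * ‖F‖) := by
  refine ⟨fun v hv => exists_isInitialTrace hT hΩ hv,
    fun x => (isWeakSolution_extension P hT hΩ x).mem_U₀ hΩ, fun F => ?_,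
    exists_isStabilityConstant hT hΩ,
    fun c hc => ⟨infSupConstant_pos hc.1, fun F x hx => normX_le hT hΩ P hc hx⟩⟩
  obtain ⟨x, hx⟩ := exists_b_eq P hT hΩ F
  exact ⟨x, hx, fun x' hx' => b_injective P hT hΩ
    (ContinuousLinearMap.ext fun y => (hx' y).trans (hx y).symm)⟩
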